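/- Let $M$ be a compact smooth (Hausdorff) manifold without boundary and let $A\to M$ be a Lie algebroid, that is, a smooth real vector bundle of finite rank with a smooth bundle map $\rho:A\to TM$ (the anchor) and a Lie bracket $[\cdot,\cdot]$ on $\Gamma(A)$ such that $\rho([a,b])=[\rho(a),\rho(b)]$ and $[a,fb]=f[a,b]+(\rho(a)f)\,b$ for all $a,b\in\Gamma(A)$, $f\in C^\infty(M)$. Let $d_A:\Gamma(\wedge^kA^*)\to\Gamma(\wedge^{k+1}A^*)$ be the Lie algebroid differential; for $\xi\in\Gamma(A^*)$ it is $(d_A\xi)(a,b)=\rho(a)\,\xi(b)-\rho(b)\,\xi(a)-\xi([a,b])$, and for $\Omega\in\Gamma(\wedge^2A^*)$ it is $(d_A\Omega)(a,b,c)=\rho(a)\,\Omega(b,c)-\rho(b)\,\Omega(a,c)+\rho(c)\,\Omega(a,b)-\Omega([a,b],c)+\Omega([a,c],b)-\Omega([b,c],a)$. A symplectic form on $A$ is a smooth section $\Omega$ of $\wedge^2A^*$ with $d_A\Omega=0$ that is non-degenerate on every fibre of $A$. Let $(\Omega_t)_{t\in[0,1]}$ be a smooth family of symplectic forms on $A$,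 and suppose that there is a smooth path $t\mapsto\xi_t$, $t\in[0,1]$, in $\Gamma(A^*)$ such that $$\dot\Omega_t=-d_A\xi_t\qquad\text{for all } t\in[0,1].$$ (Smoothness of the two families is smoothness as maps on $[0,1]\times M$.) Then there is a Lie algebroid automorphism $\phi$ of $A$ (a smooth vector bundle automorphism, covering a diffeomorphism of $M$, that is compatible with the anchor and with the bracket), isotopic to the identity, such that $\phi^*\Omega_1=\Omega_0$. Here "isotopic to the identity" means that there is a path $(\phi_t)_{t\in[0,1]}$ of Lie algebroid automorphisms of $A$, smooth as a map $[0,1]\times A\to A$, with $\phi_0=\mathrm{id}$ and $\phi_1=\phi$. -/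

import Mathlib

open Bundle Set
open scoped Manifold ContDiff

noncomputable section

section

variable {E : Type*} [NormedAddCommGroup E] [NormedSpace ℝ E]
  {H : Type*} [TopologicalSpace H] (I : ModelWithCorners ℝ E H)
  {M : Type*} [TopologicalSpace M] [ChartedSpace H M]
  (F : Type*) [NormedAddCommGroup F] [NormedSpace ℝ F]
  (V : M → Type*) [TopologicalSpace (TotalSpace F V)]
  [∀ x, AddCommGroup (V x)] [∀ x, Module ℝ (V x)] [∀ x, TopologicalSpace (V x)]
  [FiberBundle F V] [VectorBundle ℝ F V]

/-- The product `f s` of a smooth real function `f` and a smooth section `s` of `V`. -/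
def smoothSMul (f : C^∞⟮I, M; ℝ⟯) (s : Cₛ^∞⟮I; F, V⟯) : Cₛ^∞⟮I; F, V⟯ :=
  ⟨fun x => f x • s x, f.contMDiff.smul_section s.contMDiff⟩

variable [IsManifold I ∞ M]
  [∀ x, IsTopologicalAddGroup (V x)] [∀ x, ContinuousSMul ℝ (V x)]

/-- A Lie algebroid structure on the smooth vector bundle `V → M`: a smooth bundle map
`ρ : V → TM` over the identity of `M`, and a Lie bracket on the smooth sections of `V` for which
`ρ` is bracket preserving and the Leibniz rule `[a, f b] = f [a, b] + (ρ(a) f) b` holds. -/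
structure LieAlgebroid where
  /-- The anchor, a smooth bundle map over the identity. -/
  anchor : Cₛ^∞⟮I; F →L[ℝ] E, fun x : M => V x →L[ℝ] TangentSpace I x⟯
  /-- The bracket of smooth sections. -/
  bracket : Cₛ^∞⟮I; F, V⟯ →ₗ[ℝ] Cₛ^∞⟮I; F, V⟯ →ₗ[ℝ] Cₛ^∞⟮I; F, V⟯
  bracket_self : ∀ a, bracket a a = 0
  jacobi : ∀ a b c,
    bracket (bracket a b) c + bracket (bracket b c) a + bracket (bracket c a) b = 0
  anchor_bracket : ∀ a b x, anchor x (bracket a b x) =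
    VectorField.mlieBracket I (fun y => anchor y (a y)) (fun y => anchor y (b y)) x
  leibniz : ∀ (a b : Cₛ^∞⟮I; F, V⟯) (f : C^∞⟮I, M; ℝ⟯) (x : M),
    bracket a (smoothSMul I F V f b) x =
      f x • bracket a b x + mvfderiv I f x (anchor x (a x)) • b x

namespace LieAlgebroid

variable {I F V} (A : LieAlgebroid I F V)

/-- The derivative `ρ(a) f` of a function `f` along the anchor of a section `a`. -/
def anchorDeriv (a : Cₛ^∞⟮I; F, V⟯) (f : M → ℝ) (x : M) : ℝ :=
  mvfderiv I f x (A.anchor x (a x))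

/-- The Lie algebroid differential of a `1`-form `ξ`, evaluated on two sections:
`(d_A ξ)(a, b) = ρ(a) ξ(b) - ρ(b) ξ(a) - ξ([a, b])`. -/
def dOne (ξ : ∀ x, V x →L[ℝ] ℝ) (a b : Cₛ^∞⟮I; F, V⟯) (x : M) : ℝ :=
  A.anchorDeriv a (fun y => ξ y (b y)) x - A.anchorDeriv b (fun y => ξ y (a y)) x
    - ξ x (A.bracket a b x)

/-- The Lie algebroid differential of a `2`-form `η`, evaluated on three sections:
`(d_A η)(a, b, c) = ρ(a) η(b, c) - ρ(b) η(a, c) + ρ(c) η(a, b)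
  - η([a, b], c) + η([a, c], b) - η([b, c], a)`. -/
def dTwo (η : ∀ x, V x →L[ℝ] V x →L[ℝ] ℝ) (a b c : Cₛ^∞⟮I; F, V⟯) (x : M) : ℝ :=
  A.anchorDeriv a (fun y => η y (b y) (c y)) x
    - A.anchorDeriv b (fun y => η y (a y) (c y)) x
    + A.anchorDeriv c (fun y => η y (a y) (b y)) x
    - η x (A.bracket a b x) (c x)
    + η x (A.bracket a c x) (b x)
    - η x (A.bracket b c x) (a x)

/-- `η` is a symplectic form on the Lie algebroid `A`: a smooth section of `Λ² A^*` which is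
`d_A`-closed and (fibrewise) non-degenerate. -/
structure IsSymplectic (η : ∀ x, V x →L[ℝ] V x →L[ℝ] ℝ) : Prop where
  smooth : ContMDiff I (I.prod 𝓘(ℝ, F →L[ℝ] F →L[ℝ] ℝ)) ∞
    (fun x => TotalSpace.mk' (F →L[ℝ] F →L[ℝ] ℝ)
      (E := fun x : M => V x →L[ℝ] V x →L[ℝ] ℝ) x (η x))
  alternating : ∀ x v, η x v v = 0
  closed : ∀ a b c x, A.dTwo η a b c x = 0
  nondegenerate : ∀ x v, (∀ w, η x v w = 0) → v = 0

variable (I F) in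
/-- The family `t ↦ η t`, `t ∈ [0, 1]`, of sections of `A^* ⊗ A^*` is smooth, as a map on
`[0, 1] × M`. -/
def IsSmoothFamilyTwo (η : ℝ → ∀ x : M, V x →L[ℝ] V x →L[ℝ] ℝ) : Prop :=
  ContMDiffOn (𝓘(ℝ, ℝ).prod I) (I.prod 𝓘(ℝ, F →L[ℝ] F →L[ℝ] ℝ)) ∞
    (fun p : ℝ × M => TotalSpace.mk' (F →L[ℝ] F →L[ℝ] ℝ)
      (E := fun x : M => V x →L[ℝ] V x →L[ℝ] ℝ) p.2 (η p.1 p.2))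
    (Icc (0 : ℝ) 1 ×ˢ univ)

variable (I F) in
/-- The family `t ↦ ξ t`, `t ∈ [0, 1]`, of sections of `A^*` is smooth, as a map on
`[0, 1] × M`. -/
def IsSmoothFamilyOne (ξ : ℝ → ∀ x : M, V x →L[ℝ] ℝ) : Prop :=
  ContMDiffOn (𝓘(ℝ, ℝ).prod I) (I.prod 𝓘(ℝ, F →L[ℝ] ℝ)) ∞
    (fun p : ℝ × M => TotalSpace.mk' (F →L[ℝ] ℝ)
      (E := fun x : M => V x →L[ℝ] ℝ) p.2 (ξ p.1 p.2))
    (Icc (0 : ℝ) 1 ×ˢ univ)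

/-- An automorphism of the Lie algebroid `A`: a diffeomorphism of the total space which maps each
fibre linearly onto a fibre, covers a diffeomorphism of `M`, and is compatible with the anchor and
with the bracket. -/
structure Aut where
  /-- The map on the total space. -/
  total : Diffeomorph (I.prod 𝓘(ℝ, F)) (I.prod 𝓘(ℝ, F)) (TotalSpace F V) (TotalSpace F V) ∞
  /-- The map on the base. -/
  base : Diffeomorph I I M M ∞
  /-- The linear isomorphisms between the fibres. -/
  fiber : ∀ x, V x ≃L[ℝ] V (base x)
  total_mk : ∀ (x : M) (v : V x), total ⟨x, v⟩ = ⟨base x, fiber x v⟩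
  map_anchor : ∀ (x : M) (v : V x),
    A.anchor (base x) (fiber x v) = mfderiv I I base x (A.anchor x v)
  /-- If `a'` and `b'` are the push-forwards of the sections `a` and `b`, then `[a', b']` is the
  push-forward of `[a, b]`. -/
  map_bracket : ∀ a b a' b' : Cₛ^∞⟮I; F, V⟯,
    (∀ x, a' (base x) = fiber x (a x)) → (∀ x, b' (base x) = fiber x (b x)) →
      ∀ x, A.bracket a' b' (base x) = fiber x (A.bracket a b x)

variable {A} in
/-- The pull-back `φ^* η` of a `2`-form `η` by an automorphism `φ`. -/
def Aut.pullback (φ : A.Aut) (η : ∀ x, V x →L[ℝ] V x →L[ℝ] ℝ) (x : M) (v w : V x) : ℝ :=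
  η (φ.base x) (φ.fiber x v) (φ.fiber x w)

variable {A} in
/-- `φ` is isotopic to the identity: there is a smooth path `Φ t`, `t ∈ [0, 1]`, of Lie algebroid
automorphisms from the identity to `φ`. -/
def Aut.IsotopicToId (φ : A.Aut) : Prop :=
  ∃ Φ : ℝ → A.Aut,
    ContMDiffOn (𝓘(ℝ, ℝ).prod (I.prod 𝓘(ℝ, F))) (I.prod 𝓘(ℝ, F)) ∞
      (fun p : ℝ × TotalSpace F V => (Φ p.1).total p.2) (Icc (0 : ℝ) 1 ×ˢ univ) ∧
    (∀ p, (Φ 0).total p = p) ∧ (∀ p, (Φ 1).total p = φ.total p)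

end LieAlgebroid

end

end

noncomputable section

section EuclideanODE

open Metric Filter Topology Function
open scoped NNReal

variable {E : Type*} [NormedAddCommGroup E] [NormedSpace ℝ E]

/-- Two-sided Grönwall bound on a symmetric interval. -/
lemma norm_le_gronwallBound_of_Icc_symm {α α' : ℝ → E} {T K C δ : ℝ}
    (hK : 0 ≤ K) (hC : 0 ≤ C) (hδ : 0 ≤ δ)
    (hα : ∀ t ∈ Icc (-T) T, HasDerivWithinAt α (α' t) (Icc (-T) T) t)
    (h0 : ‖α 0‖ ≤ δ) (hb : ∀ t ∈ Icc (-T) T, ‖α' t‖ ≤ K * ‖α t‖ + C) {t : ℝ}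
    (ht : t ∈ Icc (-T) T) : ‖α t‖ ≤ gronwallBound δ K C T := by
  have hT : 0 ≤ T := by have := ht.1.trans ht.2; linarith
  have key : ∀ (β β' : ℝ → E), (∀ t ∈ Icc (-T) T, HasDerivWithinAt β (β' t) (Icc (-T) T) t) →
      ‖β 0‖ ≤ δ → (∀ t ∈ Icc (-T) T, ‖β' t‖ ≤ K * ‖β t‖ + C) → ∀ t ∈ Icc 0 T,
      ‖β t‖ ≤ gronwallBound δ K C T := by
    intro β β' hβ hβ0 hβb t ht
    have hsub : Icc 0 T ⊆ Icc (-T) T := Icc_subset_Icc_left (by linarith)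
    have h1 := norm_le_gronwallBound_of_norm_deriv_right_le (f := β) (f' := β') (δ := δ)
      (K := K) (ε := C) (a := 0) (b := T)
      (fun s hs => ((hβ s (hsub hs)).continuousWithinAt).mono hsub)
      (fun s hs => (hβ s (hsub ⟨hs.1, hs.2.le⟩)).mono_of_mem_nhdsWithin
        (mem_of_superset (Icc_mem_nhdsGE_of_mem hs) hsub))
      hβ0 (fun s hs => hβb s (hsub ⟨hs.1, hs.2.le⟩)) t ht
    rw [sub_zero] at h1
    exact h1.trans (gronwallBound_mono hδ hC hK ht.2)
  rcases le_total 0 t with h | h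
  · exact key α α' hα h0 hb t ⟨h, ht.2⟩
  · have hm : MapsTo Neg.neg (Icc (-T) T) (Icc (-T) T) := fun s hs => ⟨by linarith [hs.2], by
      linarith [hs.1]⟩
    have := key (fun s => α (-s)) (fun s => -α' (-s)) (fun s hs => by
      simpa [Function.comp_def] using (hα (-s) (hm hs)).scomp s (hasDerivAt_neg s).hasDerivWithinAt hm) (by simpa)
      (fun s hs => by simpa using hb (-s) (hm hs)) (-t) ⟨by linarith, by linarith [ht.1]⟩
    simpa using this

variable [FiniteDimensional ℝ E]

/-- A Lipschitz map which is the identity on a given ball, does not increase norms and is bounded. -/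
lemma exists_lipschitz_retract (ρ : ℝ) : ∃ (c : E → E) (K : ℝ≥0) (B : ℝ), LipschitzWith K c ∧
    (∀ x, ‖x‖ ≤ ρ → c x = x) ∧ (∀ x, ‖c x‖ ≤ ‖x‖) ∧ 0 ≤ B ∧ ∀ x, ‖c x‖ ≤ B := by
  let χ : ContDiffBump (0 : E) := ⟨|ρ| + 1, |ρ| + 2, by positivity, by linarith⟩
  have hsm : ContDiff ℝ 1 (fun x => χ x • x) := χ.contDiff.smul contDiff_id
  obtain ⟨K, hK⟩ := ContDiff.lipschitzWith_of_hasCompactSupport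
    (χ.hasCompactSupport.smul_right (f' := fun x : E => x)) hsm one_ne_zero
  have hn : ∀ x, ‖χ x • x‖ ≤ ‖x‖ := fun x => by
    rw [norm_smul, Real.norm_of_nonneg χ.nonneg]
    exact mul_le_of_le_one_left (norm_nonneg _) χ.le_one
  refine ⟨fun x => χ x • x, K, |ρ| + 2, hK, fun x hx => ?_, hn, by positivity, fun x => ?_⟩
  · have : χ x = 1 := χ.one_of_mem_closedBall (by
      simpa using hx.trans ((le_abs_self ρ).trans (by simp [χ])))
    simp [this]
  · by_cases hx : ‖x‖ < |ρ| + 2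
    · exact (hn x).trans hx.le
    · have : χ x = 0 := χ.zero_of_le_dist (by simpa [χ] using hx)
      simp only [this, zero_smul, norm_zero]; positivity

/-- A time-dependent vector field that is Lipschitz, uniformly on compact time intervals, has a
solution on every symmetric compact interval. -/
lemma exists_solution_Icc {f : ℝ → E → E} (hf : Continuous (uncurry f)) {T : ℝ} (hT : 0 < T)
    {K : ℝ≥0} (hK : ∀ t ∈ Icc (-T) T, LipschitzWith K (f t)) (x : E) :
    ∃ γ : ℝ → E, γ 0 = x ∧ ∀ t ∈ Icc (-T) T, HasDerivWithinAt γ (f t (γ t)) (Icc (-T) T) t := by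
  obtain ⟨C, hC⟩ : ∃ C, ∀ t ∈ Icc (-T) T, ‖f t 0‖ ≤ C :=
    isCompact_Icc.exists_bound_of_continuousOn
      (f := fun t => f t 0) (hf.comp (by fun_prop : Continuous fun t : ℝ => (t, (0 : E)))).continuousOn
  have hC0 : 0 ≤ C := (norm_nonneg _).trans (hC 0 ⟨by linarith, hT.le⟩)
  have hgrow : ∀ t ∈ Icc (-T) T, ∀ y, ‖f t y‖ ≤ K * ‖y‖ + C := fun t ht y => by
    have := (hK t ht).dist_le_mul y 0
    rw [dist_eq_norm, dist_zero_right] at this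
    calc ‖f t y‖ = ‖(f t y - f t 0) + f t 0‖ := by simp
      _ ≤ _ := (norm_add_le _ _).trans (add_le_add this (hC t ht))
  obtain ⟨c, Kc, B, hc, hcid, hcn, hB, hcB⟩ :=
    exists_lipschitz_retract (E := E) (gronwallBound ‖x‖ K C T)
  have hpl : IsPicardLindelof (fun t y => f t (c y)) (tmin := -T) (tmax := T)
      ⟨0, by constructor <;> linarith⟩ x ((K * B + C).toNNReal * T.toNNReal) 0 (K * B + C).toNNReal
      (K * Kc) := by
    refine ⟨fun t ht => ((hK t ht).comp hc).lipschitzOnWith, fun y _ =>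
      (hf.comp (by fun_prop : Continuous fun t : ℝ => (t, c y))).continuousOn, fun t ht y _ => ?_, ?_⟩
    · rw [Real.coe_toNNReal _ (by positivity)]
      exact (hgrow t ht _).trans (by gcongr; exact hcB y)
    · simp [hT.le]
  obtain ⟨γ, h0, hγ⟩ := hpl.exists_eq_forall_mem_Icc_hasDerivWithinAt₀
  refine ⟨γ, h0, fun t ht => ?_⟩
  have hb : ‖γ t‖ ≤ gronwallBound ‖x‖ K C T := by
    refine norm_le_gronwallBound_of_Icc_symm (α' := fun t => f t (c (γ t))) K.2 hC0
      (norm_nonneg x) hγ (by rw [h0]) (fun s hs => (hgrow s hs _).trans ?_) ht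
    exact add_le_add_left (mul_le_mul_of_nonneg_left (hcn _) K.2) C
  have := hγ t ht
  rwa [hcid _ hb] at this

/-- A time-dependent vector field that is Lipschitz, uniformly on compact time intervals, has global
solutions. -/
lemma exists_global_solution {f : ℝ → E → E} (hf : Continuous (uncurry f))
    (hK : ∀ T : ℝ, ∃ K : ℝ≥0, ∀ t ∈ Icc (-T) T, LipschitzWith K (f t)) (x : E) :
    ∃ γ : ℝ → E, γ 0 = x ∧ ∀ t, HasDerivAt γ (f t (γ t)) t := by
  choose K hK using hK
  have hex : ∀ T : ℝ, ∃ γ : ℝ → E, γ 0 = x ∧ ∀ t ∈ Ioo (-T) T, HasDerivAt γ (f t (γ t)) t := by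
    intro T
    by_cases hT : 0 < T
    · obtain ⟨γ, h0, h⟩ := exists_solution_Icc hf hT (hK T) x
      exact ⟨γ, h0, fun t ht => (h t (Ioo_subset_Icc_self ht)).hasDerivAt (Icc_mem_nhds ht.1 ht.2)⟩
    · exact ⟨fun _ => x, rfl, fun t ht => absurd (ht.1.trans ht.2) (by linarith)⟩
  choose γ h0 hγ using hex
  have huniq : ∀ S T : ℝ, 0 < S → S ≤ T → EqOn (γ S) (γ T) (Ioo (-S) S) := fun S T hS hST =>
    ODE_solution_unique_of_mem_Ioo (v := f) (s := fun _ => univ) (K := K S) (t₀ := 0)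
      (fun t ht => (hK S t (Ioo_subset_Icc_self ht)).lipschitzOnWith) ⟨by linarith, hS⟩
      (fun t ht => ⟨hγ S t ht, trivial⟩)
      (fun t ht => ⟨hγ T t ⟨by linarith [ht.1], by linarith [ht.2]⟩, trivial⟩) (by rw [h0, h0])
  refine ⟨fun t => γ (|t| + 1) t, by simp [h0], fun t => ?_⟩
  have hmem : t ∈ Ioo (-(|t| + 1)) (|t| + 1) := ⟨by linarith [neg_abs_le t], by
    linarith [le_abs_self t]⟩
  have hev : (fun s => γ (|s| + 1) s) =ᶠ[𝓝 t] γ (|t| + 1) := by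
    filter_upwards [Ioo_mem_nhds hmem.1 hmem.2] with s hs
    have hs' : s ∈ Ioo (-(|s| + 1)) (|s| + 1) := ⟨by linarith [neg_abs_le s], by
      linarith [le_abs_self s]⟩
    rcases le_total |s| |t| with h | h
    · exact huniq _ _ (by positivity) (by linarith) hs'
    · exact (huniq _ _ (by positivity) (by linarith) hs).symm
  exact (hγ (|t| + 1) t hmem).congr_of_eventuallyEq hev

/-- The linear variational equation along a curve has a global fundamental solution. -/
lemma exists_fundamental_solution {A : ℝ → E →L[ℝ] E} (hA : Continuous A) :
    ∃ ψ : ℝ → E →L[ℝ] E, ψ 0 = ContinuousLinearMap.id ℝ E ∧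
      ∀ t, HasDerivAt ψ ((A t).comp (ψ t)) t := by
  refine exists_global_solution (f := fun t W => (A t).comp W)
    (by unfold uncurry; fun_prop) (fun T => ?_) _
  obtain ⟨C, hC⟩ := isCompact_Icc.exists_bound_of_continuousOn (s := Icc (-T) T) hA.continuousOn
  refine ⟨C.toNNReal, fun t ht => LipschitzWith.of_dist_le_mul fun V W => ?_⟩
  rw [dist_eq_norm, dist_eq_norm, ← ContinuousLinearMap.comp_sub]
  refine (ContinuousLinearMap.opNorm_comp_le _ _).trans ?_
  gcongr
  exact (hC t ht).trans (Real.le_coe_toNNReal C)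

variable {f : E → E} {φ : ℝ → E → E}

/-- Trajectories of a `C¹` field depend Lipschitz continuously on the initial condition. -/
lemma flow_lipschitz_estimate (hf : ContDiff ℝ 1 f) (h0 : ∀ x, φ 0 x = x)
    (hφ : ∀ x t, HasDerivAt (φ · x) (f (φ t x)) t) (x : E) (T : ℝ) :
    ∃ ρ C δ : ℝ, 0 < δ ∧ 0 ≤ C ∧ ∀ y, ‖y - x‖ ≤ δ → ∀ t ∈ Icc 0 T,
      ‖φ t x‖ ≤ ρ ∧ ‖φ t y‖ ≤ ρ ∧ ‖φ t y - φ t x‖ ≤ C * ‖y - x‖ := by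
  have hc : ∀ y, Continuous (φ · y) := fun y =>
    continuous_iff_continuousAt.2 fun t => (hφ y t).continuousAt
  obtain ⟨ρ, hρ⟩ := isCompact_Icc.exists_bound_of_continuousOn (s := Icc 0 T) (hc x).continuousOn
  obtain ⟨K, hK⟩ := (hf.contDiffOn (s := closedBall 0 (ρ + 1))).exists_lipschitzOnWith one_ne_zero
    (convex_closedBall _ _) (isCompact_closedBall _ _)
  set C := Real.exp ((K + 1) * T)
  have hC : 0 < C := Real.exp_pos _
  have key : ∀ y, ‖y - x‖ ≤ C⁻¹ → ∀ t ∈ Icc 0 T,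
      ‖φ t y - φ t x‖ ≤ ‖y - x‖ * Real.exp ((K + 1) * t) := by
    intro y hy
    rcases eq_or_ne y x with rfl | hyx
    · intro t _; simp
    have hpos : 0 < ‖y - x‖ := norm_pos_iff.2 (sub_ne_zero.2 hyx)
    refine image_norm_le_of_norm_deriv_right_lt_deriv_boundary'
      (f := fun t => φ t y - φ t x) (f' := fun t => f (φ t y) - f (φ t x))
      (B' := fun t => ‖y - x‖ * (Real.exp ((K + 1) * t) * (K + 1)))
      ((hc y).sub (hc x)).continuousOn
      (fun t _ => ((hφ y t).sub (hφ x t)).hasDerivWithinAt) (by simp [h0]) (by fun_prop)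
      (fun t _ => ?_) (fun t ht hEq => ?_)
    · have h1 : HasDerivAt (fun t : ℝ => (K + 1 : ℝ) * t) (K + 1) t := by
        simpa using (hasDerivAt_id t).const_mul (K + 1 : ℝ)
      exact (h1.exp.const_mul _).hasDerivWithinAt
    · have hx : φ t x ∈ closedBall (0 : E) (ρ + 1) := by
        simpa using (hρ t (Ico_subset_Icc_self ht)).trans (by linarith)
      have hle : ‖φ t y - φ t x‖ ≤ 1 := by
        rw [hEq]
        calc ‖y - x‖ * Real.exp ((K + 1) * t) ≤ C⁻¹ * C := by
              gcongr; exact Real.exp_le_exp.2 (by gcongr; exact ht.2.le)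
          _ = 1 := inv_mul_cancel₀ hC.ne'
      have hy' : φ t y ∈ closedBall (0 : E) (ρ + 1) := by
        rw [mem_closedBall_zero_iff]
        calc ‖φ t y‖ = ‖φ t x + (φ t y - φ t x)‖ := by simp
          _ ≤ _ := (norm_add_le _ _).trans (add_le_add (hρ t (Ico_subset_Icc_self ht)) hle)
      have := hK.dist_le_mul _ hy' _ hx
      rw [dist_eq_norm, dist_eq_norm, hEq] at this
      refine this.trans_lt ?_
      have h2 : 0 < ‖y - x‖ * Real.exp ((K + 1) * t) := by positivity
      nlinarith
  refine ⟨ρ + 1, C, C⁻¹, by positivity, hC.le, fun y hy t ht => ?_⟩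
  have h1 : ‖φ t y - φ t x‖ ≤ C * ‖y - x‖ := by
    refine (key y hy t ht).trans ?_
    rw [mul_comm]
    gcongr; exact Real.exp_le_exp.2 (by gcongr; exact ht.2)
  have h2 : ‖φ t y - φ t x‖ ≤ 1 := h1.trans (by
    calc C * ‖y - x‖ ≤ C * C⁻¹ := by gcongr
      _ = 1 := mul_inv_cancel₀ hC.ne')
  refine ⟨(hρ t ht).trans (by linarith), ?_, h1⟩
  calc ‖φ t y‖ = ‖φ t x + (φ t y - φ t x)‖ := by simp
    _ ≤ _ := (norm_add_le _ _).trans (add_le_add (hρ t ht) h2)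

/-- Second order remainder of the flow of a `C²` field, forward in time. -/
lemma flow_quadratic_estimate (hf : ContDiff ℝ 2 f) (h0 : ∀ x, φ 0 x = x)
    (hφ : ∀ x t, HasDerivAt (φ · x) (f (φ t x)) t) {x : E} {ψ : ℝ → E →L[ℝ] E}
    (hψ0 : ψ 0 = ContinuousLinearMap.id ℝ E)
    (hψ : ∀ t, HasDerivAt ψ ((fderiv ℝ f (φ t x)).comp (ψ t)) t) (T : ℝ) :
    ∃ C δ : ℝ, 0 ≤ C ∧ 0 < δ ∧ ∀ y, ‖y - x‖ ≤ δ → ∀ t ∈ Icc 0 T,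
      ‖φ t y - φ t x - ψ t (y - x)‖ ≤ C * ‖y - x‖ ^ 2 := by
  have hf1 : ContDiff ℝ 1 f := hf.of_le (by norm_num)
  have hdf : ContDiff ℝ 1 (fderiv ℝ f) := hf.fderiv_right (by norm_num)
  obtain ⟨ρ, C, δ, hδ, hC, hest⟩ := flow_lipschitz_estimate hf1 h0 hφ x T
  obtain ⟨L, hL⟩ := (hdf.contDiffOn (s := closedBall 0 ρ)).exists_lipschitzOnWith one_ne_zero
    (convex_closedBall _ _) (isCompact_closedBall _ _)
  obtain ⟨K, hK⟩ := (isCompact_closedBall (0 : E) ρ).exists_bound_of_continuousOn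
    hdf.continuous.continuousOn
  refine ⟨max (gronwallBound 0 (max K 0) (L * C ^ 2) T) 0, δ, le_max_right _ _, hδ, fun y hy t ht => ?_⟩
  set r : ℝ → E := fun t => φ t y - φ t x - ψ t (y - x)
  set r' : ℝ → E := fun t => f (φ t y) - f (φ t x) - fderiv ℝ f (φ t x) (ψ t (y - x))
  have hr : ∀ t, HasDerivAt r (r' t) t := fun t =>
    ((hφ y t).sub (hφ x t)).sub (by simpa using (hψ t).clm_apply (hasDerivAt_const t (y - x)))
  have hbound : ∀ s ∈ Ico 0 T, ‖r' s‖ ≤ max K 0 * ‖r s‖ + L * C ^ 2 * ‖y - x‖ ^ 2 := by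
    intro s hs
    obtain ⟨hx, hy', hd⟩ := hest y hy s (Ico_subset_Icc_self hs)
    have hx' : φ s x ∈ closedBall (0 : E) ρ := by simpa using hx
    have hy'' : φ s y ∈ closedBall (0 : E) ρ := by simpa using hy'
    have hseg : segment ℝ (φ s x) (φ s y) ⊆ closedBall (0 : E) ρ :=
      (convex_closedBall _ _).segment_subset hx' hy''
    have h1 : ‖f (φ s y) - f (φ s x) - fderiv ℝ f (φ s x) (φ s y - φ s x)‖ ≤
        (L * ‖φ s y - φ s x‖) * ‖φ s y - φ s x‖ := by
      refine Convex.norm_image_sub_le_of_norm_hasFDerivWithin_le'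
        (fun z _ => (hf1.differentiable one_ne_zero z).hasFDerivAt.hasFDerivWithinAt)
        (fun z hz => ?_) (convex_segment _ _) (left_mem_segment ℝ _ _) (right_mem_segment ℝ _ _)
      have h2 := hL.dist_le_mul z (hseg hz) _ hx'
      rw [dist_eq_norm, dist_eq_norm] at h2
      refine h2.trans ?_
      gcongr
      exact norm_sub_le_of_mem_segment hz
    have h3 : r' s = (f (φ s y) - f (φ s x) - fderiv ℝ f (φ s x) (φ s y - φ s x)) +
        fderiv ℝ f (φ s x) (r s) := by simp only [r, r', map_sub]; abel
    rw [h3, add_comm]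
    refine (norm_add_le _ _).trans (add_le_add ?_ (h1.trans ?_))
    · refine (ContinuousLinearMap.le_opNorm _ _).trans ?_
      gcongr
      exact (hK _ hx').trans (le_max_left _ _)
    · calc (L * ‖φ s y - φ s x‖) * ‖φ s y - φ s x‖ ≤ (L * (C * ‖y - x‖)) * (C * ‖y - x‖) := by
            gcongr
        _ = _ := by ring
  have h := norm_le_gronwallBound_of_norm_deriv_right_le (f := r) (f' := r') (δ := 0)
    (fun s _ => (hr s).continuousAt.continuousWithinAt)
    (fun s _ => (hr s).hasDerivWithinAt) (by simp [r, h0, hψ0]) hbound t ht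
  rw [sub_zero] at h
  have hmul : ∀ s : ℝ, gronwallBound 0 (max K 0) (L * C ^ 2 * ‖y - x‖ ^ 2) s =
      gronwallBound 0 (max K 0) (L * C ^ 2) s * ‖y - x‖ ^ 2 := fun s => by
    unfold gronwallBound; split_ifs <;> ring
  rw [hmul] at h
  refine h.trans ?_
  gcongr
  exact (gronwallBound_mono le_rfl (by positivity) (le_max_right _ _) ht.2).trans (le_max_left _ _)

/-- The flow of a `C²` field is differentiable, jointly in time and initial condition. -/
lemma hasFDerivAt_flow (hf : ContDiff ℝ 2 f) (h0 : ∀ x, φ 0 x = x)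
    (hφ : ∀ x t, HasDerivAt (φ · x) (f (φ t x)) t) {x : E} {ψ : ℝ → E →L[ℝ] E}
    (hψ0 : ψ 0 = ContinuousLinearMap.id ℝ E)
    (hψ : ∀ t, HasDerivAt ψ ((fderiv ℝ f (φ t x)).comp (ψ t)) t) (t : ℝ) :
    HasFDerivAt (uncurry φ)
      ((ContinuousLinearMap.fst ℝ ℝ E).smulRight (f (φ t x)) +
        (ψ t).comp (ContinuousLinearMap.snd ℝ ℝ E)) (t, x) := by
  obtain ⟨C₁, δ₁, hC₁, hδ₁, h₁⟩ := flow_quadratic_estimate hf h0 hφ hψ0 hψ (|t| + 1)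
  obtain ⟨C₂, δ₂, -, hδ₂, h₂⟩ := flow_quadratic_estimate (f := fun x => -f x)
    (φ := fun t x => φ (-t) x) (ψ := fun t => ψ (-t)) hf.neg (by simpa using h0)
    (fun x t => by
      simpa [Function.comp_def] using (hφ x (-t)).scomp t (hasDerivAt_neg t)) (by simpa using hψ0)
    (fun t => by
      have := (hψ (-t)).scomp t (hasDerivAt_neg t)
      rw [fderiv_fun_neg]
      simpa [Function.comp_def] using this) (|t| + 1)
  have hrem : HasFDerivAt (fun p : ℝ × E => φ p.1 p.2 - φ p.1 x - ψ p.1 (p.2 - x))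
      (0 : ℝ × E →L[ℝ] E) (t, x) := by
    refine Asymptotics.IsBigO.hasFDerivAt (n := 2)
      (Asymptotics.IsBigO.of_bound (max C₁ C₂) ?_) one_lt_two
    have hev : ∀ᶠ p : ℝ × E in 𝓝 (t, x), p.1 ∈ Ioo (-(|t| + 1)) (|t| + 1) ∧
        p.2 ∈ closedBall x (min δ₁ δ₂) := by
      refine (continuous_fst.continuousAt.eventually (Ioo_mem_nhds ?_ ?_)).and
        (continuous_snd.continuousAt.eventually (closedBall_mem_nhds _ (lt_min hδ₁ hδ₂)))
      · simp only; linarith [neg_abs_le t]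
      · simp only; linarith [le_abs_self t]
    filter_upwards [hev] with p hp
    rw [mem_closedBall, dist_eq_norm] at hp
    have hle : ‖p.2 - x‖ ≤ ‖p - (t, x)‖ := norm_snd_le (p - (t, x))
    have hb : ‖φ p.1 p.2 - φ p.1 x - ψ p.1 (p.2 - x)‖ ≤ max C₁ C₂ * ‖p.2 - x‖ ^ 2 := by
      rcases le_total 0 p.1 with hs | hs
      · refine (h₁ p.2 (hp.2.trans (min_le_left _ _)) p.1 ⟨hs, hp.1.2.le⟩).trans ?_
        gcongr; exact le_max_left _ _
      · have := h₂ p.2 (hp.2.trans (min_le_right _ _)) (-p.1)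
          ⟨by linarith, by linarith [hp.1.1]⟩
        simp only [neg_neg] at this
        refine this.trans ?_
        gcongr; exact le_max_right _ _
    rw [norm_pow, norm_norm]
    exact hb.trans (by gcongr)
  have h1 : HasFDerivAt (fun p : ℝ × E => φ p.1 x)
      ((ContinuousLinearMap.fst ℝ ℝ E).smulRight (f (φ t x))) (t, x) := by
    refine ((hφ x t).hasFDerivAt.comp (t, x)
      (hasFDerivAt_fst (𝕜 := ℝ) (p := (t, x)))).congr_fderiv ?_
    ext <;> simp
  have h2 : HasFDerivAt (fun p : ℝ × E => ψ p.1 (p.2 - x))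
      ((ψ t).comp (ContinuousLinearMap.snd ℝ ℝ E)) (t, x) := by
    have ha := (hψ t).hasFDerivAt.comp (t, x) (hasFDerivAt_fst (𝕜 := ℝ) (p := (t, x)))
    have hb := (hasFDerivAt_snd (𝕜 := ℝ) (p := (t, x))).sub_const x
    refine (ha.clm_apply hb).congr_fderiv ?_
    ext <;> simp
  have := (h1.add h2).add hrem
  rw [add_zero] at this
  refine this.congr_of_eventuallyEq (Eventually.of_forall fun p => ?_)
  simp [uncurry]

lemma contDiff_flow_nat (n : ℕ) : ∀ {E : Type*} [NormedAddCommGroup E] [NormedSpace ℝ E]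
    [FiniteDimensional ℝ E] {f : E → E} {φ : ℝ → E → E} (_ : ContDiff ℝ ∞ f)
    (_ : ∀ x, φ 0 x = x) (_ : ∀ x t, HasDerivAt (φ · x) (f (φ t x)) t),
    ContDiff ℝ n (uncurry φ) := by
  induction n with
  | zero =>
    intro E _ _ _ f φ hf h0 hφ
    rw [Nat.cast_zero, contDiff_zero]
    refine continuous_iff_continuousAt.2 fun p => ?_
    have hdf : Continuous (fderiv ℝ f) := hf.continuous_fderiv (by simp)
    obtain ⟨ψ, hψ0, hψ⟩ := exists_fundamental_solution (A := fun t => fderiv ℝ f (φ t p.2))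
      (hdf.comp (continuous_iff_continuousAt.2 fun t => (hφ p.2 t).continuousAt))
    exact (hasFDerivAt_flow (mod_cast contDiff_infty.1 hf 2) h0 hφ hψ0 hψ p.1).continuousAt
  | succ n ih =>
    intro E _ _ _ f φ hf h0 hφ
    have hdf : ContDiff ℝ ∞ (fderiv ℝ f) := hf.fderiv_right (by simp)
    have hex := fun x => exists_fundamental_solution (A := fun t => fderiv ℝ f (φ t x))
      (hdf.continuous.comp (continuous_iff_continuousAt.2 fun t => (hφ x t).continuousAt))
    choose ψ hψ0 hψ using hex
    rw [Nat.cast_succ, contDiff_succ_iff_hasFDerivAt]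
    refine ⟨fun p => (ContinuousLinearMap.fst ℝ ℝ E).smulRight (f (φ p.1 p.2)) +
        (ψ p.2 p.1).comp (ContinuousLinearMap.snd ℝ ℝ E), ?_, fun p =>
      hasFDerivAt_flow (mod_cast contDiff_infty.1 hf 2) h0 hφ (hψ0 p.2) (hψ p.2) p.1⟩
    rw [contDiff_clm_apply_iff]
    rintro ⟨τ, h⟩
    have h1 : ContDiff ℝ n fun p : ℝ × E => f (φ p.1 p.2) :=
      (hf.of_le (by exact_mod_cast le_top)).comp (ih hf h0 hφ)
    have h2 : ContDiff ℝ n fun p : ℝ × E => ψ p.2 p.1 h := by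
      have := ih (E := E × E) (f := fun q => (f q.1, fderiv ℝ f q.1 q.2))
        (φ := fun t q => (φ t q.1, ψ q.1 t q.2))
        ((hf.comp contDiff_fst).prodMk ((hdf.comp contDiff_fst).clm_apply contDiff_snd))
        (fun q => by simp [h0, hψ0]) (fun q t => (hφ q.1 t).prodMk (by
          simpa using (hψ q.1 t).clm_apply (hasDerivAt_const t q.2)))
      exact (contDiff_snd.comp this).comp
        (contDiff_fst.prodMk (contDiff_snd.prodMk contDiff_const))
    simpa using (contDiff_const.smul h1).add h2

/-- The complete flow of a smooth vector field is smooth. -/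
theorem contDiff_flow (hf : ContDiff ℝ ∞ f) (h0 : ∀ x, φ 0 x = x)
    (hφ : ∀ x t, HasDerivAt (φ · x) (f (φ t x)) t) : ContDiff ℝ ∞ (uncurry φ) :=
  contDiff_infty.2 fun n => contDiff_flow_nat n hf h0 hφ

/-- A smooth compactly supported vector field has a complete smooth flow. -/
theorem exists_contDiff_flow (hf : ContDiff ℝ ∞ f) (hc : HasCompactSupport f) :
    ∃ φ : ℝ → E → E, (∀ x, φ 0 x = x) ∧ (∀ x t, HasDerivAt (φ · x) (f (φ t x)) t) ∧
      ContDiff ℝ ∞ (uncurry φ) := by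
  obtain ⟨K, hK⟩ := ContDiff.lipschitzWith_of_hasCompactSupport hc hf (by simp)
  have := fun x => exists_global_solution (f := fun _ => f) (hf.continuous.comp continuous_snd)
    (fun _ => ⟨K, fun _ _ => hK⟩) x
  choose φ h0 hφ using this
  exact ⟨fun t x => φ x t, h0, hφ, contDiff_flow hf h0 (fun x t => hφ x t)⟩

end EuclideanODE

section ManifoldFlow

open Metric Filter Topology Function

variable {E : Type*} [NormedAddCommGroup E] [NormedSpace ℝ E]
  {H : Type*} [TopologicalSpace H] {I : ModelWithCorners ℝ E H}
  {M : Type*} [TopologicalSpace M] [ChartedSpace H M]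

/-- A solution of the coordinate expression of a vector field gives an integral curve. -/
lemma hasMFDerivAt_extChartAt_symm_comp [IsManifold I 1 M] [I.Boundaryless]
    {v : (x : M) → TangentSpace I x}
    {x₀ : M} {f : ℝ → E} {t : ℝ} (hft : f t ∈ (extChartAt I x₀).target)
    (h : HasDerivAt f (tangentCoordChange I ((extChartAt I x₀).symm (f t)) x₀
      ((extChartAt I x₀).symm (f t)) (v ((extChartAt I x₀).symm (f t)))) t) :
    HasMFDerivAt 𝓘(ℝ, ℝ) I ((extChartAt I x₀).symm ∘ f) t
      ((1 : ℝ →L[ℝ] ℝ).smulRight (v ((extChartAt I x₀).symm (f t)))) := by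
  let xₜ : M := (extChartAt I x₀).symm (f t)
  have hft1 := mem_preimage.mp <|
    mem_of_mem_of_subset hft (extChartAt I x₀).target_subset_preimage_source
  have hft2 := mem_extChartAt_source (I := I) xₜ
  have hd : ∀ w : E, HasDerivAt f (tangentCoordChange I xₜ x₀ xₜ w) t →
      HasDerivAt ((extChartAt I xₜ ∘ (extChartAt I x₀).symm) ∘ f) w t := by
    intro w h
    rw [← tangentCoordChange_self (I := I) (x := xₜ) (z := xₜ) (v := w) hft2,
      ← tangentCoordChange_comp (x := x₀) ⟨⟨hft2, hft1⟩, hft2⟩]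
    apply HasFDerivAt.comp_hasDerivAt _ _ h
    apply HasFDerivWithinAt.hasFDerivAt (s := range I) _ (by
      rw [I.range_eq_univ]; exact univ_mem)
    rw [← (extChartAt I x₀).right_inv hft]
    exact hasFDerivWithinAt_tangentCoordChange ⟨hft1, hft2⟩
  have hfd : ∀ w : E, HasDerivAt f (tangentCoordChange I xₜ x₀ xₜ w) t →
      HasFDerivWithinAt ((extChartAt I xₜ ∘ (extChartAt I x₀).symm) ∘ f)
        ((1 : ℝ →L[ℝ] ℝ).smulRight w) univ t := fun w h => by
    rw [hasFDerivWithinAt_univ]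
    refine (hd w h).hasFDerivAt.congr_fderiv ?_
    ext
    simp
  refine ⟨(continuousAt_extChartAt_symm'' hft).comp h.continuousAt, ?_⟩
  simp only [mfld_simps]
  exact hfd _ h

variable [IsManifold I ∞ M]
  {v : (x : M) → TangentSpace I x}

lemma contDiffOn_vectorField_chart
    (hv : ContMDiff I I.tangent ∞ (fun x => (⟨x, v x⟩ : TangentBundle I M))) (p : M) :
    ContDiffOn ℝ ∞ (fun y => tangentCoordChange I ((extChartAt I p).symm y) p
      ((extChartAt I p).symm y) (v ((extChartAt I p).symm y))) (extChartAt I p).target := by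
  have h := (contMDiff_iff.1 hv).2 p ⟨p, v p⟩
  have h2 := contDiff_snd.comp_contDiffOn h
  refine h2.mono fun y hy => ⟨hy, ?_⟩
  rw [mem_preimage, mem_preimage, extChartAt_source]
  have := (extChartAt I p).map_target hy
  rw [extChartAt_source] at this
  simpa [TangentBundle.mem_chart_source_iff] using this

variable [FiniteDimensional ℝ E] [I.Boundaryless]

/-- Local existence of the flow of a smooth vector field, smooth in all variables. -/
lemma exists_contMDiffOn_localFlow
    (hv : ContMDiff I I.tangent ∞ (fun x => (⟨x, v x⟩ : TangentBundle I M))) (p : M) :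
    ∃ U ∈ 𝓝 p, ∃ ε > (0 : ℝ), ∃ Ψ : ℝ → M → M,
      (∀ q ∈ U, Ψ 0 q = q ∧ IsMIntegralCurveOn (Ψ · q) v (Ioo (-ε) ε)) ∧
      ContMDiffOn (𝓘(ℝ, ℝ).prod I) I ∞ (uncurry Ψ) (Ioo (-ε) ε ×ˢ U) := by
  set ψ := extChartAt I p
  have hopen : IsOpen ψ.target := isOpen_extChartAt_target p
  have hmem : ψ p ∈ ψ.target := mem_extChartAt_target p
  obtain ⟨r, hr, hball⟩ := nhds_basis_closedBall.mem_iff.1 (hopen.mem_nhds hmem)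
  let χ : ContDiffBump (ψ p) := ⟨r / 2, r, by positivity, by linarith⟩
  set w : E → E := fun y => tangentCoordChange I (ψ.symm y) p (ψ.symm y) (v (ψ.symm y))
  have hw : ContDiffOn ℝ ∞ w ψ.target := contDiffOn_vectorField_chart hv p
  have hsupp : tsupport χ ⊆ ψ.target := by rw [χ.tsupport_eq]; exact hball
  have hg : ContDiff ℝ ∞ (fun y => χ y • w y) := by
    refine contDiff_iff_contDiffAt.2 fun y => ?_
    by_cases hy : y ∈ ψ.target
    · exact χ.contDiff.contDiffAt.smul (hw.contDiffAt (hopen.mem_nhds hy))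
    · have : (fun y => χ y • w y) =ᶠ[𝓝 y] fun _ => 0 := by
        filter_upwards [notMem_tsupport_iff_eventuallyEq.1 (fun h => hy (hsupp h))] with z hz
        simp [hz]
      exact contDiffAt_const.congr_of_eventuallyEq this
  obtain ⟨φ, h0, hφ, hsm⟩ := exists_contDiff_flow hg (χ.hasCompactSupport.smul_right (f' := w))
  have hpre : uncurry φ ⁻¹' ball (ψ p) (r / 2) ∈ 𝓝 ((0 : ℝ), ψ p) :=
    hsm.continuous.continuousAt.preimage_mem_nhds (by
      simpa [h0] using ball_mem_nhds (ψ p) (half_pos hr))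
  obtain ⟨A, hA, W, hW, hAW⟩ := mem_nhds_prod_iff.1 hpre
  obtain ⟨ε, hε, hεA⟩ := Metric.mem_nhds_iff.1 hA
  rw [Real.ball_eq_Ioo, zero_sub, zero_add] at hεA
  have hin : ∀ t ∈ Ioo (-ε) ε, ∀ y ∈ W, φ t y ∈ ball (ψ p) (r / 2) := fun t ht y hy =>
    hAW (show (t, y) ∈ A ×ˢ W from ⟨hεA ht, hy⟩)
  have hin' : ∀ t ∈ Ioo (-ε) ε, ∀ y ∈ W, φ t y ∈ ψ.target := fun t ht y hy =>
    hball (ball_subset_closedBall (ball_subset_ball (by linarith) (hin t ht y hy)))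
  refine ⟨ψ.source ∩ ψ ⁻¹' W, inter_mem (extChartAt_source_mem_nhds p)
    ((continuousAt_extChartAt p).preimage_mem_nhds hW), ε, hε,
    fun t q => ψ.symm (φ t (ψ q)), fun q hq => ⟨?_, fun t ht => ?_⟩, ?_⟩
  · simp only [h0]; exact ψ.left_inv hq.1
  · refine HasMFDerivAt.hasMFDerivWithinAt ?_
    refine hasMFDerivAt_extChartAt_symm_comp (f := fun t => φ t (ψ q)) (hin' t ht _ hq.2) ?_
    have := hφ (ψ q) t
    rwa [χ.one_of_mem_closedBall (ball_subset_closedBall (hin t ht _ hq.2)), one_smul] at this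
  · refine (contMDiffOn_extChartAt_symm p).comp (t := ψ.target) (f := fun z : ℝ × M => φ z.1 (ψ z.2))
      ?_ (fun z hz => hin' z.1 hz.1 _ hz.2.2)
    refine hsm.contMDiff.comp_contMDiffOn (f := fun z : ℝ × M => (z.1, ψ z.2)) ?_
    exact contMDiffOn_fst.prodMk_space ((contMDiffOn_extChartAt (x := p)).comp contMDiffOn_snd
      (fun z hz => by simpa [ψ] using hz.2.1))

variable [T2Space M]

/-- The complete flow of a smooth vector field is smooth in all variables. -/
theorem contMDiff_flow
    (hv : ContMDiff I I.tangent ∞ (fun x => (⟨x, v x⟩ : TangentBundle I M)))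
    {Φ : ℝ → M → M} (h0 : ∀ q, Φ 0 q = q) (hΦ : ∀ q, IsMIntegralCurve (Φ · q) v) :
    ContMDiff (𝓘(ℝ, ℝ).prod I) I ∞ (uncurry Φ) := by
  have hv1 : ContMDiff I I.tangent 1 (fun x => (⟨x, v x⟩ : TangentBundle I M)) :=
    hv.of_le (by simp)
  have hgroup : ∀ s t q, Φ (s + t) q = Φ s (Φ t q) := fun s t q =>
    congrFun (isMIntegralCurve_Ioo_eq_of_contMDiff_boundaryless (t₀ := 0) hv1
      ((hΦ q).comp_add t) (hΦ (Φ t q)) (by simp [h0])) s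
  rintro ⟨t, p⟩
  let S : Set ℝ := {t | ContMDiffAt (𝓘(ℝ, ℝ).prod I) I ∞ (uncurry Φ) (t, p)}
  have hloc : ∀ q, ∃ U ∈ 𝓝 q, ∃ ε > (0 : ℝ), ∀ x ∈ interior U, ∀ s ∈ Ioo (-ε) ε,
      ContMDiffAt (𝓘(ℝ, ℝ).prod I) I ∞ (uncurry Φ) (s, x) := by
    intro q
    obtain ⟨U, hU, ε, hε, Ψ, hΨ, hsm⟩ := exists_contMDiffOn_localFlow hv q
    refine ⟨U, hU, ε, hε, fun x hx s hs => ?_⟩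
    have hn : Ioo (-ε) ε ×ˢ U ∈ 𝓝 (s, x) :=
      prod_mem_nhds (Ioo_mem_nhds hs.1 hs.2) (mem_interior_iff_mem_nhds.1 hx)
    refine (hsm.contMDiffAt hn).congr_of_eventuallyEq ?_
    filter_upwards [hn] with z hz
    exact isMIntegralCurveOn_Ioo_eqOn_of_contMDiff_boundaryless (t₀ := 0) ⟨by linarith, hε⟩ hv1
      ((hΦ z.2).isMIntegralCurveOn _) (hΨ z.2 hz.2).2 (by rw [h0, (hΨ z.2 hz.2).1]) hz.1
  have hstep : ∀ t, ∃ W ∈ 𝓝 t, ∀ t₁ ∈ W, t₁ ∈ S → W ⊆ S := by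
    intro t
    obtain ⟨U, hU, ε, hε, h⟩ := hloc (Φ t p)
    have hc : ContinuousAt (Φ · p) t := (hΦ p t).continuousAt
    refine ⟨ball t (ε / 2) ∩ (Φ · p) ⁻¹' interior U, inter_mem (ball_mem_nhds _ (half_pos hε))
      (hc.preimage_mem_nhds (interior_mem_nhds.2 hU)), fun t₁ ht₁ hS t₂ ht₂ => ?_⟩
    have hlt : |t₂ - t₁| < ε := by
      have h1 := ht₁.1; have h2 := ht₂.1
      rw [mem_ball, Real.dist_eq] at h1 h2
      rw [abs_lt] at *
      constructor <;> linarith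
    have heq : uncurry Φ = fun z : ℝ × M => uncurry Φ (z.1 - t₁, Φ t₁ z.2) := by
      ext z
      simp [← hgroup, uncurry]
    change ContMDiffAt _ _ _ _ _
    rw [heq]
    refine ContMDiffAt.comp (t₂, p) (g := uncurry Φ) (f := fun z : ℝ × M => (z.1 - t₁, Φ t₁ z.2))
      (h _ ht₁.2 _ (abs_lt.1 hlt)) ?_
    refine ContMDiffAt.prodMk ?_ ?_
    · exact (contDiff_id.sub contDiff_const).contMDiff.contMDiffAt.comp _ contMDiffAt_fst
    · exact ContMDiffAt.comp (t₂, p) (g := fun x => Φ t₁ x)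
        (ContMDiffAt.comp p (g := uncurry Φ) (f := fun x => (t₁, x)) hS
          (contMDiffAt_const.prodMk contMDiffAt_id)) contMDiffAt_snd
  have hclopen : IsClopen S := by
    refine ⟨isOpen_compl_iff.1 (isOpen_iff_mem_nhds.2 fun t ht => ?_),
      isOpen_iff_mem_nhds.2 fun t ht => ?_⟩
    · obtain ⟨W, hW, h⟩ := hstep t
      exact mem_of_superset hW fun s hs hsS => ht (h s hs hsS (mem_of_mem_nhds hW))
    · obtain ⟨W, hW, h⟩ := hstep t
      exact mem_of_superset hW (h t (mem_of_mem_nhds hW) ht)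
  have hne : (0 : ℝ) ∈ S := by
    obtain ⟨U, hU, ε, hε, h⟩ := hloc p
    exact h p (mem_interior_iff_mem_nhds.2 hU) 0 ⟨by linarith, hε⟩
  have := hclopen.eq_univ ⟨0, hne⟩
  exact (this ▸ mem_univ t : t ∈ S)

end ManifoldFlow

section TimeDependentFlow

open Metric Filter Topology Function

section TangentProd

variable {E₀ : Type*} [NormedAddCommGroup E₀] [NormedSpace ℝ E₀]
  {H₀ : Type*} [TopologicalSpace H₀] {J : ModelWithCorners ℝ E₀ H₀}
  {N : Type*} [TopologicalSpace N] [ChartedSpace H₀ N]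
  {E₁ : Type*} [NormedAddCommGroup E₁] [NormedSpace ℝ E₁]
  {H₁ : Type*} [TopologicalSpace H₁] {I₁ : ModelWithCorners ℝ E₁ H₁}
  {M₁ : Type*} [TopologicalSpace M₁] [ChartedSpace H₁ M₁] [IsManifold I₁ 1 M₁]
  {E₂ : Type*} [NormedAddCommGroup E₂] [NormedSpace ℝ E₂]
  {H₂ : Type*} [TopologicalSpace H₂] {I₂ : ModelWithCorners ℝ E₂ H₂}
  {M₂ : Type*} [TopologicalSpace M₂] [ChartedSpace H₂ M₂] [IsManifold I₂ 1 M₂]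
  {G : Type*} [NormedAddCommGroup G] [NormedSpace ℝ G] {n : WithTop ℕ∞}

lemma ContMDiff.tangentProd {f : N → M₁} {g : N → M₂} {u : ∀ m, TangentSpace I₁ (f m)}
    {w : ∀ m, TangentSpace I₂ (g m)}
    (hu : ContMDiff J I₁.tangent n (fun m => (⟨f m, u m⟩ : TangentBundle I₁ M₁)))
    (hw : ContMDiff J I₂.tangent n (fun m => (⟨g m, w m⟩ : TangentBundle I₂ M₂))) :
    ContMDiff J (I₁.prod I₂).tangent n
      (fun m => (⟨(f m, g m), (u m, w m)⟩ : TangentBundle (I₁.prod I₂) (M₁ × M₂))) :=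
  contMDiff_equivTangentBundleProd_symm.comp (hu.prodMk hw)

lemma ContMDiff.tangentVectorSpace {f u : N → G} (hf : ContMDiff J 𝓘(ℝ, G) n f)
    (hu : ContMDiff J 𝓘(ℝ, G) n u) :
    ContMDiff J 𝓘(ℝ, G).tangent n (fun m => (⟨f m, u m⟩ : TangentBundle 𝓘(ℝ, G) G)) := by
  intro m
  rw [Bundle.contMDiffAt_totalSpace]
  exact ⟨hf m, by simpa using hu m⟩

end TangentProd

variable {E : Type*} [NormedAddCommGroup E] [NormedSpace ℝ E] [FiniteDimensional ℝ E]
  {H : Type*} [TopologicalSpace H] {I : ModelWithCorners ℝ E H} [I.Boundaryless]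
  {M : Type*} [TopologicalSpace M] [ChartedSpace H M] [IsManifold I ∞ M]
  [T2Space M] [CompactSpace M]
  {X : ℝ → ∀ x : M, TangentSpace I x}

/-- The autonomous vector field on `ℝ × M` associated with a time-dependent vector field. -/
def suspension (X : ℝ → ∀ x : M, TangentSpace I x) (z : ℝ × M) :
    TangentSpace (𝓘(ℝ, ℝ).prod I) z := ((1 : ℝ), X z.1 z.2)

omit [FiniteDimensional ℝ E] [I.Boundaryless] [T2Space M] [CompactSpace M] in
lemma contMDiff_suspension (hX : ContMDiff (𝓘(ℝ, ℝ).prod I) I.tangent ∞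
      (fun z : ℝ × M => (⟨z.2, X z.1 z.2⟩ : TangentBundle I M))) :
    ContMDiff (𝓘(ℝ, ℝ).prod I) (𝓘(ℝ, ℝ).prod I).tangent ∞
      (fun z => (⟨z, suspension X z⟩ : TangentBundle (𝓘(ℝ, ℝ).prod I) (ℝ × M))) :=
  (ContMDiff.tangentVectorSpace (u := fun _ => (1 : ℝ)) contMDiff_fst contMDiff_const).tangentProd hX

omit [FiniteDimensional ℝ E] [I.Boundaryless] [T2Space M] [CompactSpace M] [IsManifold I ∞ M] in
lemma hasMFDerivAt_suspension {a : ℝ → ℝ} {c : ℝ → M} {t : ℝ} (ha : HasDerivAt a 1 t)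
    (hc : HasMFDerivAt 𝓘(ℝ, ℝ) I c t ((1 : ℝ →L[ℝ] ℝ).smulRight (X (a t) (c t)))) :
    HasMFDerivAt 𝓘(ℝ, ℝ) (𝓘(ℝ, ℝ).prod I) (fun t => (a t, c t)) t
      ((1 : ℝ →L[ℝ] ℝ).smulRight (suspension X (a t, c t))) := by
  convert! ha.hasFDerivAt.hasMFDerivAt.prodMk hc using 1

omit [FiniteDimensional ℝ E] [I.Boundaryless] [T2Space M] [CompactSpace M] [IsManifold I ∞ M] in
lemma hasDerivAt_fst_of_suspension {γ : ℝ → ℝ × M} {t : ℝ}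
    (hγ : HasMFDerivAt 𝓘(ℝ, ℝ) (𝓘(ℝ, ℝ).prod I) γ t
      ((1 : ℝ →L[ℝ] ℝ).smulRight (suspension X (γ t)))) :
    HasDerivAt (fun t => (γ t).1) 1 t := by
  have h := (hasMFDerivAt_fst (I := 𝓘(ℝ, ℝ)) (I' := I) (x := γ t)).comp t hγ
  rw [hasMFDerivAt_iff_hasFDerivAt] at h
  have h' : HasFDerivAt (fun t => (γ t).1) ((1 : ℝ →L[ℝ] ℝ).smulRight (1 : ℝ)) t := h
  simpa using h'.hasDerivAt

omit [FiniteDimensional ℝ E] [I.Boundaryless] [T2Space M] [CompactSpace M] [IsManifold I ∞ M] in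
lemma hasMFDerivAt_snd_of_suspension {γ : ℝ → ℝ × M} {t : ℝ}
    (hγ : HasMFDerivAt 𝓘(ℝ, ℝ) (𝓘(ℝ, ℝ).prod I) γ t
      ((1 : ℝ →L[ℝ] ℝ).smulRight (suspension X (γ t)))) :
    HasMFDerivAt 𝓘(ℝ, ℝ) I (fun t => (γ t).2) t
      ((1 : ℝ →L[ℝ] ℝ).smulRight (X (γ t).1 (γ t).2)) := by
  have h := (hasMFDerivAt_snd (I := 𝓘(ℝ, ℝ)) (I' := I) (x := γ t)).comp t hγ
  convert! h using 1

/-- A time-dependent vector field on a compact manifold which vanishes for times outside `[0, 1]`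
has a complete suspension. -/
lemma exists_isMIntegralCurve_suspension (hX : ContMDiff (𝓘(ℝ, ℝ).prod I) I.tangent ∞
      (fun z : ℝ × M => (⟨z.2, X z.1 z.2⟩ : TangentBundle I M)))
    (hX0 : ∀ s ∉ Icc (0 : ℝ) 1, ∀ x, X s x = 0) (z : ℝ × M) :
    ∃ γ : ℝ → ℝ × M, γ 0 = z ∧ IsMIntegralCurve γ (suspension X) := by
  have hsm := contMDiff_suspension hX
  have hcompact : ∃ ε > (0 : ℝ), ∀ z ∈ Icc (-1 : ℝ) 2 ×ˢ (univ : Set M), ∃ γ : ℝ → ℝ × M,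
      γ 0 = z ∧ IsMIntegralCurveOn γ (suspension X) (Ioo (-ε) ε) := by
    refine (isCompact_Icc.prod isCompact_univ).induction_on
      (p := fun S : Set (ℝ × M) => ∃ ε > (0 : ℝ), ∀ z ∈ S, ∃ γ : ℝ → ℝ × M,
        γ 0 = z ∧ IsMIntegralCurveOn γ (suspension X) (Ioo (-ε) ε)) ⟨1, one_pos, by simp⟩ ?_ ?_ ?_
    · rintro S T hST ⟨ε, hε, h⟩
      exact ⟨ε, hε, fun z hz => h z (hST hz)⟩
    · rintro S T ⟨ε, hε, h⟩ ⟨δ, hδ, h'⟩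
      refine ⟨min ε δ, lt_min hε hδ, ?_⟩
      rintro z (hz | hz)
      · obtain ⟨γ, h0, hγ⟩ := h z hz
        exact ⟨γ, h0, hγ.mono (Ioo_subset_Ioo (neg_le_neg (min_le_left _ _)) (min_le_left _ _))⟩
      · obtain ⟨γ, h0, hγ⟩ := h' z hz
        exact ⟨γ, h0, hγ.mono (Ioo_subset_Ioo (neg_le_neg (min_le_right _ _)) (min_le_right _ _))⟩
    · intro z _
      obtain ⟨U, hU, ε, hε, Ψ, h, -⟩ := exists_contMDiffOn_localFlow hsm z
      exact ⟨U, mem_nhdsWithin_of_mem_nhds hU, ε, hε, fun q hq => ⟨fun t => Ψ t q, h q hq⟩⟩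
  obtain ⟨ε, hε, h⟩ := hcompact
  refine exists_isMIntegralCurve_of_isMIntegralCurveOn (hsm.of_le (by simp)) (lt_min hε one_pos)
    (fun z => ?_) z
  by_cases hz : z.1 ∈ Icc (-1 : ℝ) 2
  · obtain ⟨γ, h0, hγ⟩ := h z ⟨hz, mem_univ _⟩
    exact ⟨γ, h0, hγ.mono (Ioo_subset_Ioo (neg_le_neg (min_le_left _ _)) (min_le_left _ _))⟩
  · refine ⟨fun t => (z.1 + t, z.2), by simp, fun t ht => HasMFDerivAt.hasMFDerivWithinAt ?_⟩
    have ht' : t ∈ Ioo (-1 : ℝ) 1 :=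
      Ioo_subset_Ioo (neg_le_neg (min_le_right _ _)) (min_le_right _ _) ht
    refine hasMFDerivAt_suspension (a := fun t => z.1 + t) (c := fun _ => z.2)
      ((hasDerivAt_id t).const_add z.1) ?_
    have : X (z.1 + t) z.2 = 0 := hX0 _ (fun hmem => hz ⟨by linarith [hmem.1, ht'.2], by
      linarith [hmem.2, ht'.1]⟩) _
    simp only [this]
    exact (hasMFDerivAt_const z.2 t).congr_mfderiv (ContinuousLinearMap.smulRight_zero _).symm

variable {G : Type*} [NormedAddCommGroup G] [NormedSpace ℝ G] [FiniteDimensional ℝ G]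

/-- The flow of a time-dependent vector field which vanishes outside `[0, 1]`, together with the
fundamental solution of a linear equation along its trajectories. -/
theorem exists_timeDependentFlow (hX : ContMDiff (𝓘(ℝ, ℝ).prod I) I.tangent ∞
      (fun z : ℝ × M => (⟨z.2, X z.1 z.2⟩ : TangentBundle I M)))
    (hX0 : ∀ s ∉ Icc (0 : ℝ) 1, ∀ x, X s x = 0) {L : ℝ → M → G →L[ℝ] G}
    (hL : ContMDiff (𝓘(ℝ, ℝ).prod I) 𝓘(ℝ, G →L[ℝ] G) ∞ (uncurry L)) :
    ∃ (φ ψ : ℝ → M → M) (R : ℝ → M → G →L[ℝ] G),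
      ContMDiff (𝓘(ℝ, ℝ).prod I) I ∞ (uncurry φ) ∧ ContMDiff (𝓘(ℝ, ℝ).prod I) I ∞ (uncurry ψ) ∧
      ContMDiff (𝓘(ℝ, ℝ).prod I) 𝓘(ℝ, G →L[ℝ] G) ∞ (uncurry R) ∧
      (∀ x, φ 0 x = x) ∧ (∀ x, R 0 x = ContinuousLinearMap.id ℝ G) ∧
      (∀ s x, ψ s (φ s x) = x) ∧ (∀ s x, φ s (ψ s x) = x) ∧
      (∀ s x, HasMFDerivAt 𝓘(ℝ, ℝ) I (φ · x) s ((1 : ℝ →L[ℝ] ℝ).smulRight (X s (φ s x)))) ∧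
      ∀ s x, HasDerivAt (R · x) ((L s (φ s x)).comp (R s x)) s := by
  have hsm := contMDiff_suspension hX
  choose γ h0 hγ using exists_isMIntegralCurve_suspension hX hX0
  have hfst : ∀ z t, (γ z t).1 = z.1 + t := by
    intro z t
    have hd : ∀ t, HasDerivAt (fun t => (γ z t).1 - t) 0 t := fun t => 
      ((hasDerivAt_fst_of_suspension (hγ z t)).sub (hasDerivAt_id t)).congr_deriv (sub_self _)
    have := is_const_of_deriv_eq_zero (fun t => (hd t).differentiableAt)
      (fun t => (hd t).deriv) t 0
    simp only [h0, sub_zero] at this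
    linarith
  have hcont : ∀ z, Continuous (γ z) := fun z =>
    continuous_iff_continuousAt.2 fun t => (hγ z t).continuousAt
  have hadd : ∀ z s t, γ (γ z s) t = γ z (t + s) := fun z s t =>
    congrFun (isMIntegralCurve_Ioo_eq_of_contMDiff_boundaryless (t₀ := 0) (hsm.of_le (by simp))
      (hγ (γ z s)) ((hγ z).comp_add s) (by simp [h0])) t
  have hψ := fun z => exists_fundamental_solution (A := fun t => uncurry L (γ z t))
    (hL.continuous.comp (hcont z))
  choose S hS0 hS using hψ
  let v : ∀ p : ℝ × M × (G →L[ℝ] G), TangentSpace (𝓘(ℝ, ℝ).prod (I.prod 𝓘(ℝ, G →L[ℝ] G))) p :=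
    fun p => ((1 : ℝ), (X p.1 p.2.1, (L p.1 p.2.1).comp p.2.2))
  let Φ : ℝ → ℝ × M × (G →L[ℝ] G) → ℝ × M × (G →L[ℝ] G) := fun t p =>
    ((γ (p.1, p.2.1) t).1, (γ (p.1, p.2.1) t).2, (S (p.1, p.2.1) t).comp p.2.2)
  have hπ : ContMDiff (𝓘(ℝ, ℝ).prod (I.prod 𝓘(ℝ, G →L[ℝ] G))) (𝓘(ℝ, ℝ).prod I) ∞
      (fun p : ℝ × M × (G →L[ℝ] G) => (p.1, p.2.1)) :=
    contMDiff_fst.prodMk (contMDiff_fst.comp contMDiff_snd)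
  have hv : ContMDiff (𝓘(ℝ, ℝ).prod (I.prod 𝓘(ℝ, G →L[ℝ] G)))
      (𝓘(ℝ, ℝ).prod (I.prod 𝓘(ℝ, G →L[ℝ] G))).tangent ∞
      (fun p => (⟨p, v p⟩ : TangentBundle (𝓘(ℝ, ℝ).prod (I.prod 𝓘(ℝ, G →L[ℝ] G)))
        (ℝ × M × (G →L[ℝ] G)))) := by
    refine (ContMDiff.tangentVectorSpace (u := fun _ => (1 : ℝ)) contMDiff_fst
      contMDiff_const).tangentProd ((hX.comp hπ).tangentProd
        (ContMDiff.tangentVectorSpace (contMDiff_snd.comp contMDiff_snd) ?_))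
    exact (hL.comp hπ).clm_comp (contMDiff_snd.comp contMDiff_snd)
  have hΦ : ContMDiff (𝓘(ℝ, ℝ).prod (𝓘(ℝ, ℝ).prod (I.prod 𝓘(ℝ, G →L[ℝ] G))))
      (𝓘(ℝ, ℝ).prod (I.prod 𝓘(ℝ, G →L[ℝ] G))) ∞ (uncurry Φ) := by
    refine contMDiff_flow hv (fun p => by simp [Φ, h0, hS0]) (fun p t => ?_)
    have h1 := (hasDerivAt_fst_of_suspension (hγ (p.1, p.2.1) t)).hasFDerivAt.hasMFDerivAt
    have h2 := hasMFDerivAt_snd_of_suspension (hγ (p.1, p.2.1) t)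
    have h3 : HasDerivAt (fun t => (S (p.1, p.2.1) t).comp p.2.2) _ t :=
      (hS (p.1, p.2.1) t).clm_comp (hasDerivAt_const t p.2.2)
    refine (h1.prodMk (h2.prodMk h3.hasFDerivAt.hasMFDerivAt)).congr_mfderiv ?_
    rw [ContinuousLinearMap.comp_zero, add_zero, ContinuousLinearMap.comp_assoc]
    rfl
  have key : ∀ s x, γ (0, x) s = (s, (γ (0, x) s).2) := fun s x => by
    rw [Prod.ext_iff]; simp [hfst]
  have key' : ∀ s x, γ (s, x) (-s) = (0, (γ (s, x) (-s)).2) := fun s x => by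
    rw [Prod.ext_iff]; simp [hfst]
  refine ⟨fun s x => (γ (0, x) s).2, fun s x => (γ (s, x) (-s)).2, fun s x => S (0, x) s,
    ?_, ?_, ?_, fun x => by simp [h0], fun x => hS0 _, fun s x => ?_, fun s x => ?_,
    fun s x => ?_, fun s x => ?_⟩
  · exact (contMDiff_fst.comp contMDiff_snd).comp (hΦ.comp (contMDiff_fst.prodMk
      ((contMDiff_const (c := (0 : ℝ))).prodMk (contMDiff_snd.prodMk
        (contMDiff_const (c := (0 : G →L[ℝ] G)))))))
  · exact (contMDiff_fst.comp contMDiff_snd).comp (hΦ.comp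
      ((contDiff_neg.contMDiff.comp contMDiff_fst).prodMk
      (contMDiff_fst.prodMk (contMDiff_snd.prodMk (contMDiff_const (c := (0 : G →L[ℝ] G)))))))
  · exact (contMDiff_snd.comp contMDiff_snd).comp (hΦ.comp (contMDiff_fst.prodMk
      ((contMDiff_const (c := (0 : ℝ))).prodMk (contMDiff_snd.prodMk
        (contMDiff_const (c := (ContinuousLinearMap.id ℝ G)))))))
  · simp only
    rw [← key, hadd]; simp [h0]
  · simp only
    rw [← key', hadd]; simp [h0]
  · have := hasMFDerivAt_snd_of_suspension (hγ (0, x) s)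
    rw [hfst, zero_add] at this
    exact this
  · have := hS (0, x) s
    rw [key] at this
    exact this

end TimeDependentFlow

/-- The continuous linear map with a given matrix, depending linearly on the matrix. -/
def matrixCLM (n : ℕ) : (Fin n → Fin n → ℝ) →L[ℝ] ((Fin n → ℝ) →L[ℝ] (Fin n → ℝ)) :=
  LinearMap.toContinuousLinearMap
    ((LinearMap.toContinuousLinearMap : ((Fin n → ℝ) →ₗ[ℝ] (Fin n → ℝ)) ≃ₗ[ℝ] _).toLinearMap ∘ₗ
      (Matrix.toLin' : Matrix (Fin n) (Fin n) ℝ ≃ₗ[ℝ] _).toLinearMap)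

lemma matrixCLM_apply {n : ℕ} (m : Fin n → Fin n → ℝ) (y : Fin n → ℝ) (i : Fin n) :
    matrixCLM n m y i = ∑ j, m i j * y j := by
  exact congrFun (Matrix.toLin'_apply (Matrix.of m) y) i

section LinearSolve

variable {E₀ : Type*} [NormedAddCommGroup E₀] [NormedSpace ℝ E₀]
  {H₀ : Type*} [TopologicalSpace H₀] {J : ModelWithCorners ℝ E₀ H₀}
  {N : Type*} [TopologicalSpace N] [ChartedSpace H₀ N]

lemma contMDiff_pi₂ {n : ℕ} {m : N → Fin n → Fin n → ℝ}
    (hm : ∀ i j, ContMDiff J 𝓘(ℝ, ℝ) ∞ (fun p => m p i j)) :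
    ContMDiff J 𝓘(ℝ, Fin n → Fin n → ℝ) ∞ m :=
  contMDiff_pi_space.2 fun i => contMDiff_pi_space.2 fun j => hm i j

/-- The inverse of a smooth family of invertible endomorphisms is smooth. -/
lemma ContMDiff.clm_ringInverse {G : Type*} [NormedAddCommGroup G] [NormedSpace ℝ G]
    [FiniteDimensional ℝ G]
    {R : N → G →L[ℝ] G} (hR : ContMDiff J 𝓘(ℝ, G →L[ℝ] G) ∞ R) (hu : ∀ p, IsUnit (R p)) :
    ContMDiff J 𝓘(ℝ, G →L[ℝ] G) ∞ (fun p => Ring.inverse (R p)) := fun p => by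
  have : CompleteSpace G := FiniteDimensional.complete ℝ G
  obtain ⟨u, hu⟩ := hu p
  have h := contDiffAt_ringInverse (n := ∞) ℝ u
  rw [hu] at h
  exact h.contMDiffAt.comp p (hR p)

lemma isUnit_of_ker_eq_zero {G : Type*} [NormedAddCommGroup G] [NormedSpace ℝ G]
    [FiniteDimensional ℝ G] {R : G →L[ℝ] G} (h : ∀ y, R y = 0 → y = 0) : IsUnit R := by
  have hinj : Function.Injective (R : G →ₗ[ℝ] G) := (injective_iff_map_eq_zero _).2 h
  let e := (LinearEquiv.ofInjectiveEndo (R : G →ₗ[ℝ] G) hinj).toContinuousLinearEquiv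
  have he : (e : G →L[ℝ] G) = R := by ext y; rfl
  rw [← he]
  exact ⟨ContinuousLinearEquiv.toUnit e, rfl⟩

/-- A linear system with smooth coefficients and trivial kernel has a smooth solution. -/
lemma exists_contMDiff_solve {n : ℕ} {m : N → Fin n → Fin n → ℝ} {r : N → Fin n → ℝ}
    (hm : ∀ i j, ContMDiff J 𝓘(ℝ, ℝ) ∞ (fun p => m p i j))
    (hr : ∀ i, ContMDiff J 𝓘(ℝ, ℝ) ∞ (fun p => r p i))
    (hinj : ∀ p (y : Fin n → ℝ), (∀ i, ∑ j, m p i j * y j = 0) → y = 0) :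
    ∃ y : N → Fin n → ℝ, (∀ i, ContMDiff J 𝓘(ℝ, ℝ) ∞ (fun p => y p i)) ∧
      ∀ p i, ∑ j, m p i j * y p j = r p i := by
  have hu : ∀ p, IsUnit (matrixCLM n (m p)) := fun p => isUnit_of_ker_eq_zero fun y hy =>
    hinj p y fun i => by rw [← matrixCLM_apply, hy]; rfl
  have hsm : ContMDiff J 𝓘(ℝ, (Fin n → ℝ) →L[ℝ] (Fin n → ℝ)) ∞ (fun p => matrixCLM n (m p)) :=
    (matrixCLM n).contDiff.contMDiff.comp (contMDiff_pi₂ hm)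
  refine ⟨fun p => Ring.inverse (matrixCLM n (m p)) (r p), fun i => ?_, fun p i => ?_⟩
  · exact contMDiff_pi_space.1 ((hsm.clm_ringInverse hu).clm_apply (contMDiff_pi_space.2 hr)) i
  · rw [← matrixCLM_apply, ← mul_apply_eq_comp, Ring.mul_inverse_cancel _ (hu p)]
    rfl

end LinearSolve

section Frame

variable {E : Type*} [NormedAddCommGroup E] [NormedSpace ℝ E]
  {H : Type*} [TopologicalSpace H] (I : ModelWithCorners ℝ E H)
  {M : Type*} [TopologicalSpace M] [ChartedSpace H M]
  (F : Type*) [NormedAddCommGroup F] [NormedSpace ℝ F]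
  (V : M → Type*) [TopologicalSpace (TotalSpace F V)]
  [∀ x, AddCommGroup (V x)] [∀ x, Module ℝ (V x)] [∀ x, TopologicalSpace (V x)]
  [FiberBundle F V] [VectorBundle ℝ F V]

/-- A finite family of global sections `sec i`, together with a dual family of fibrewise linear
functions `coord i`, such that `v = ∑ i, coord i v • sec i` for all `v`. -/
structure GlobalFrame where
  /-- The number of sections. -/
  n : ℕ
  /-- The sections. -/
  sec : Fin n → Cₛ^∞⟮I; F, V⟯
  /-- The coordinates. -/
  coord : Fin n → ∀ x, V x →L[ℝ] ℝ
  contMDiff_coord : ∀ i, ContMDiff (I.prod 𝓘(ℝ, F)) 𝓘(ℝ, ℝ) ∞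
    (fun p : TotalSpace F V => coord i p.1 p.2)
  sum_coord : ∀ x (v : V x), ∑ i, coord i x v • sec i x = v

section Existence

variable [FiniteDimensional ℝ E] [FiniteDimensional ℝ F] [IsManifold I ∞ M] [T2Space M]
  [CompactSpace M] [ContMDiffVectorBundle ∞ F V I]

open scoped Classical in
/-- Smooth vector bundles over compact manifolds have finite global frames. -/
theorem nonempty_globalFrame : Nonempty (GlobalFrame I F V) := by
  have hb : ∀ c : M, ∃ f : SmoothBumpFunction I c,
      tsupport f ⊆ (trivializationAt F V c).baseSet := fun c => by
    obtain ⟨f, -, hf⟩ := (SmoothBumpFunction.nhds_basis_tsupport (I := I) c).mem_iff.1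
      ((trivializationAt F V c).open_baseSet.mem_nhds (mem_baseSet_trivializationAt F V c))
    exact ⟨f, hf⟩
  choose f hf using hb
  obtain ⟨t, ht⟩ := CompactSpace.elim_nhds_subcover (fun c : M => {x | f c x ≠ 0}) (fun c => by
    filter_upwards [(f c).eventuallyEq_one] with x hx
    simp [hx])
  let D : M → ℝ := fun x => ∑ c ∈ t, f c x ^ 2
  have hD : ∀ x, D x ≠ 0 := fun x => by
    have : x ∈ ⋃ c ∈ t, {x | f c x ≠ 0} := ht ▸ mem_univ x
    obtain ⟨c, hc, hx⟩ := mem_iUnion₂.1 this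
    exact (Finset.sum_pos' (fun c _ => sq_nonneg _) ⟨c, hc, by
      have : f c x ≠ 0 := hx
      positivity⟩).ne'
  have hDsm : ContMDiff I 𝓘(ℝ, ℝ) ∞ D :=
    contMDiff_finsetSum fun c _ => (f c).contMDiff.pow 2
  let b := Module.finBasis ℝ F
  let ι := t × Fin (Module.finrank ℝ F)
  let sec : ι → Cₛ^∞⟮I; F, V⟯ := fun k =>
    ⟨(fun x => f k.1 x) • (trivializationAt F V (k.1 : M)).localFrame b k.2,
      ContMDiffOn.smul_section_of_tsupport (f k.1).contMDiff.contMDiffOn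
        (trivializationAt F V (k.1 : M)).open_baseSet (hf k.1)
        ((trivializationAt F V (k.1 : M)).contMDiffOn_localFrame_baseSet ∞ b k.2)⟩
  let coord : ι → ∀ x, V x →L[ℝ] ℝ := fun k x =>
    (f k.1 x / D x) • ((LinearMap.toContinuousLinearMap (b.coord k.2)).comp
      ((trivializationAt F V (k.1 : M)).continuousLinearMapAt ℝ x))
  have hcoord : ∀ k, ContMDiff (I.prod 𝓘(ℝ, F)) 𝓘(ℝ, ℝ) ∞
      (fun p : TotalSpace F V => coord k p.1 p.2) := by
    intro k
    refine contMDiff_of_tsupport fun p hp => ?_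
    have hp1 : p.1 ∈ (trivializationAt F V (k.1 : M)).baseSet := by
      refine hf k.1 ?_
      have hcl : IsClosed ((TotalSpace.proj : TotalSpace F V → M) ⁻¹' tsupport (f k.1)) :=
        (isClosed_tsupport _).preimage (FiberBundle.continuous_proj F V)
      refine closure_minimal (fun q hq => ?_) hcl hp
      refine subset_tsupport _ fun h0 => hq ?_
      simp [coord, h0]
    have hsrc : p ∈ (trivializationAt F V (k.1 : M)).source :=
      (trivializationAt F V (k.1 : M)).mem_source.2 hp1
    have hev : (fun p : TotalSpace F V => coord k p.1 p.2) =ᶠ[nhds p] fun p =>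
        f k.1 p.1 / D p.1 *
          LinearMap.toContinuousLinearMap (b.coord k.2) (trivializationAt F V (k.1 : M) p).2 := by
      filter_upwards [(trivializationAt F V (k.1 : M)).open_source.mem_nhds hsrc] with q hq
      have hq1 := (trivializationAt F V (k.1 : M)).mem_source.1 hq
      simp [coord, Trivialization.continuousLinearMapAt_apply,
        Trivialization.linearMapAt_apply, hq1]
    refine ContMDiffAt.congr_of_eventuallyEq ?_ hev
    have hpr : ContMDiff (I.prod 𝓘(ℝ, F)) I ∞ (TotalSpace.proj : TotalSpace F V → M) :=
      contMDiff_proj V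
    refine ContMDiffAt.mul ?_ ?_
    · exact (((f k.1).contMDiff.div₀ hDsm hD).comp hpr).contMDiffAt
    · have h2 := ((trivializationAt F V (k.1 : M)).contMDiffOn (IB := I) (n := ∞)).contMDiffAt
        ((trivializationAt F V (k.1 : M)).open_source.mem_nhds hsrc)
      exact (LinearMap.toContinuousLinearMap (b.coord k.2)).contMDiff.contMDiffAt.comp p
        (contMDiffAt_snd.comp p h2)
  have hsum : ∀ x (v : V x), ∑ k, coord k x v • sec k x = v := by
    intro x v
    have hterm : ∀ c : t, ∑ i, coord (c, i) x v • sec (c, i) x = (f c x ^ 2 / D x) • v := by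
      intro c
      by_cases hx : x ∈ (trivializationAt F V (c : M)).baseSet
      · have h1 := ((trivializationAt F V (c : M)).basisAt b hx).sum_repr v
        conv_rhs => rw [← h1, Finset.smul_sum]
        refine Finset.sum_congr rfl fun i _ => ?_
        change coord (c, i) x v • (f c x • (trivializationAt F V (c : M)).localFrame b i x) = _
        rw [Trivialization.localFrame_apply_of_mem_baseSet _ _ hx, smul_smul, smul_smul]
        congr 1
        simp [coord, Trivialization.basisAt, Trivialization.linearMapAt_apply, hx]
        ring
      · have h0 : f c x = 0 := by
          by_contra h0
          exact hx (hf c (subset_tsupport _ h0))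
        simp [coord, h0]
    rw [Fintype.sum_prod_type]
    simp_rw [hterm]
    rw [← Finset.sum_smul, ← Finset.sum_div, Finset.sum_coe_sort t (fun c => f c x ^ 2)]
    rw [div_self (hD x), one_smul]
  let e := Fintype.equivFin ι
  exact ⟨⟨Fintype.card ι, fun i => sec (e.symm i), fun i => coord (e.symm i), fun i => hcoord _,
    fun x v => (Equiv.sum_comp e.symm (fun k => coord k x v • sec k x)).trans (hsum x v)⟩⟩

end Existence

namespace GlobalFrame

variable {I F V}

set_option linter.unusedSectionVars false

variable [∀ x, IsTopologicalAddGroup (V x)] [∀ x, ContinuousSMul ℝ (V x)]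

section Basic

variable (fr : GlobalFrame I F V)

/-- The vector with given coefficients. -/
def synth (x : M) : (Fin fr.n → ℝ) →L[ℝ] V x :=
  ∑ i, (ContinuousLinearMap.proj (R := ℝ) (φ := fun _ : Fin fr.n => ℝ) i).smulRight (fr.sec i x)

/-- The coordinates of a vector. -/
def anal (x : M) : V x →L[ℝ] (Fin fr.n → ℝ) :=
  ContinuousLinearMap.pi fun i => fr.coord i x

lemma synth_apply (x : M) (y : Fin fr.n → ℝ) : fr.synth x y = ∑ i, y i • fr.sec i x := by
  simp [synth]

lemma anal_apply (x : M) (v : V x) (i : Fin fr.n) : fr.anal x v i = fr.coord i x v := rfl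

@[simp]
lemma synth_anal (x : M) (v : V x) : fr.synth x (fr.anal x v) = v := by
  rw [synth_apply]
  exact fr.sum_coord x v

lemma synth_single (x : M) (i : Fin fr.n) : fr.synth x (Pi.single i 1) = fr.sec i x := by
  rw [synth_apply, Finset.sum_eq_single i] <;> simp +contextual

/-- The matrix of the projection `anal ∘ synth`. -/
def pmat (k i : Fin fr.n) (x : M) : ℝ := fr.coord k x (fr.sec i x)

lemma anal_synth_apply (x : M) (y : Fin fr.n → ℝ) (k : Fin fr.n) :
    fr.anal x (fr.synth x y) k = ∑ i, fr.pmat k i x * y i := by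
  simp [anal_apply, synth_apply, pmat, mul_comm]

variable {E₀ : Type*} [NormedAddCommGroup E₀] [NormedSpace ℝ E₀]
  {H₀ : Type*} [TopologicalSpace H₀] {J : ModelWithCorners ℝ E₀ H₀}
  {N : Type*} [TopologicalSpace N] [ChartedSpace H₀ N]

lemma contMDiff_coord_comp {b : N → M} {v : ∀ p, V (b p)}
    (hv : ContMDiff J (I.prod 𝓘(ℝ, F)) ∞ (fun p => (⟨b p, v p⟩ : TotalSpace F V)))
    (i : Fin fr.n) : ContMDiff J 𝓘(ℝ, ℝ) ∞ (fun p => fr.coord i (b p) (v p)) :=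
  (fr.contMDiff_coord i).comp hv

lemma contMDiff_coord_section (b : Cₛ^∞⟮I; F, V⟯) (i : Fin fr.n) :
    ContMDiff I 𝓘(ℝ, ℝ) ∞ (fun x => fr.coord i x (b x)) :=
  fr.contMDiff_coord_comp b.contMDiff i

lemma contMDiff_pmat (k i : Fin fr.n) : ContMDiff I 𝓘(ℝ, ℝ) ∞ (fr.pmat k i) :=
  fr.contMDiff_coord_section _ _

lemma contMDiff_synth {b : N → M} (hb : ContMDiff J I ∞ b) {y : N → Fin fr.n → ℝ}
    (hy : ∀ i, ContMDiff J 𝓘(ℝ, ℝ) ∞ (fun p => y p i)) :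
    ContMDiff J (I.prod 𝓘(ℝ, F)) ∞ (fun p => (⟨b p, fr.synth (b p) (y p)⟩ : TotalSpace F V)) := by
  intro p₀
  rw [Bundle.contMDiffAt_totalSpace]
  refine ⟨hb p₀, ?_⟩
  set e := trivializationAt F V (b p₀) with he
  have hmem : ∀ᶠ p in nhds p₀, b p ∈ e.baseSet :=
    hb.continuous.continuousAt.preimage_mem_nhds
      (e.open_baseSet.mem_nhds (mem_baseSet_trivializationAt F V (b p₀)))
  have hev : (fun p => (e (⟨b p, fr.synth (b p) (y p)⟩ : TotalSpace F V)).2) =ᶠ[nhds p₀]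
      fun p => ∑ i, y p i • (e (⟨b p, fr.sec i (b p)⟩ : TotalSpace F V)).2 := by
    filter_upwards [hmem] with p hp
    have h : ∀ v : V (b p), (e (⟨b p, v⟩ : TotalSpace F V)).2 = e.continuousLinearMapAt ℝ (b p) v :=
      fun v => by
        rw [Trivialization.continuousLinearMapAt_apply, Trivialization.linearMapAt_apply, if_pos hp]
    simp only [h, synth_apply, map_sum, map_smul]
  refine ContMDiffAt.congr_of_eventuallyEq ?_ hev
  refine ContMDiffAt.sum fun i _ => (hy i p₀).smul ?_
  have := (fr.sec i).contMDiff (b p₀)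
  rw [Bundle.contMDiffAt_totalSpace] at this
  exact this.2.comp p₀ (hb p₀)

/-- A nondegenerate family of bilinear forms with smooth coefficients identifies one-forms with
smooth coefficients with smooth vectors. -/
theorem exists_solve {b : N → M} (hb : ContMDiff J I ∞ b)
    {β : ∀ p, V (b p) →L[ℝ] V (b p) →L[ℝ] ℝ} {θ : ∀ p, V (b p) →L[ℝ] ℝ}
    (hβ : ∀ i j, ContMDiff J 𝓘(ℝ, ℝ) ∞ (fun p => β p (fr.sec i (b p)) (fr.sec j (b p))))
    (hθ : ∀ i, ContMDiff J 𝓘(ℝ, ℝ) ∞ (fun p => θ p (fr.sec i (b p))))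
    (hnd : ∀ p v, (∀ w, β p v w = 0) → v = 0) :
    ∃ y : N → Fin fr.n → ℝ, (∀ i, ContMDiff J 𝓘(ℝ, ℝ) ∞ (fun p => y p i)) ∧
      ∀ p w, β p (fr.synth (b p) (y p)) w = θ p w := by
  classical
  let q : M → Fin fr.n → Fin fr.n → ℝ := fun x l i => (if l = i then 1 else 0) - fr.pmat l i x
  have hq : ∀ x (y : Fin fr.n → ℝ) l, ∑ i, q x l i * y i = (y - fr.anal x (fr.synth x y)) l := by
    intro x y l
    simp [q, sub_mul, anal_synth_apply, Finset.sum_sub_distrib]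
  let m : N → Fin fr.n → Fin fr.n → ℝ := fun p i j =>
    β p (fr.sec j (b p)) (fr.sec i (b p)) + ∑ l, q (b p) l i * q (b p) l j
  have hform : ∀ p (y z : Fin fr.n → ℝ), ∑ i, z i * ∑ j, m p i j * y j =
      β p (fr.synth (b p) y) (fr.synth (b p) z) +
        ∑ l, (z - fr.anal (b p) (fr.synth (b p) z)) l *
          (y - fr.anal (b p) (fr.synth (b p) y)) l := by
    intro p y z
    have h1 : β p (fr.synth (b p) y) (fr.synth (b p) z) =
        ∑ i, z i * ∑ j, β p (fr.sec j (b p)) (fr.sec i (b p)) * y j := by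
      simp only [synth_apply, map_sum, map_smul, sum_apply,
        smul_apply, smul_eq_mul]
      exact Finset.sum_congr rfl fun i _ => by
        congr 1; exact Finset.sum_congr rfl fun j _ => mul_comm _ _
    have h2 : ∑ l, (z - fr.anal (b p) (fr.synth (b p) z)) l *
          (y - fr.anal (b p) (fr.synth (b p) y)) l =
        ∑ i, z i * ∑ j, (∑ l, q (b p) l i * q (b p) l j) * y j := by
      simp only [← hq, Finset.sum_mul_sum]
      simp only [Finset.sum_mul, Finset.mul_sum]
      rw [Finset.sum_comm]
      refine Finset.sum_congr rfl fun i _ => ?_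
      rw [Finset.sum_comm]
      exact Finset.sum_congr rfl fun j _ => Finset.sum_congr rfl fun l _ => by ring
    rw [h1, h2, ← Finset.sum_add_distrib]
    refine Finset.sum_congr rfl fun i _ => ?_
    rw [← mul_add, ← Finset.sum_add_distrib]
    congr 1
    exact Finset.sum_congr rfl fun j _ => add_mul _ _ _
  have hker : ∀ p (y : Fin fr.n → ℝ) (θ' : V (b p) →L[ℝ] ℝ),
      (∀ i, ∑ j, m p i j * y j = θ' (fr.sec i (b p))) →
        y = fr.anal (b p) (fr.synth (b p) y) ∧ ∀ w, β p (fr.synth (b p) y) w = θ' w := by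
    intro p y θ' h
    have hz : ∀ z : Fin fr.n → ℝ, θ' (fr.synth (b p) z) =
        β p (fr.synth (b p) y) (fr.synth (b p) z) +
        ∑ l, (z - fr.anal (b p) (fr.synth (b p) z)) l *
          (y - fr.anal (b p) (fr.synth (b p) y)) l := by
      intro z
      rw [← hform, synth_apply, map_sum]
      exact Finset.sum_congr rfl fun i _ => by rw [h, map_smul, smul_eq_mul]
    have h0 : y - fr.anal (b p) (fr.synth (b p) y) = 0 := by
      have := hz (y - fr.anal (b p) (fr.synth (b p) y))
      simp only [map_sub, synth_anal, sub_self, map_zero, zero_add, sub_zero] at this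
      have h3 := (Finset.sum_eq_zero_iff_of_nonneg
        (fun l _ => mul_self_nonneg ((y - fr.anal (b p) (fr.synth (b p) y)) l))).1 this.symm
      funext l
      exact mul_self_eq_zero.1 (h3 l (Finset.mem_univ l))
    refine ⟨sub_eq_zero.1 h0, fun w => ?_⟩
    have := hz (fr.anal (b p) w)
    simpa [h0] using this.symm
  obtain ⟨y, hy, hym⟩ := exists_contMDiff_solve (J := J) (m := m)
    (r := fun p i => θ p (fr.sec i (b p)))
    (fun i j => (hβ j i).add (ContMDiff.sum fun l _ =>
      (contMDiff_const.sub ((fr.contMDiff_pmat l i).comp hb)).mul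
        (contMDiff_const.sub ((fr.contMDiff_pmat l j).comp hb)))) hθ (fun p y h => by
      obtain ⟨h1, h2⟩ := hker p y 0 (by simpa using h)
      have h3 : fr.synth (b p) y = 0 := hnd p _ (by simpa using h2)
      exact h1.trans (by rw [h3, map_zero]))
  exact ⟨y, hy, fun p => (hker p (y p) (θ p) (hym p)).2⟩

end Basic

end GlobalFrame

end Frame

section LinearODE

/-- A solution of a linear differential equation which vanishes at some time vanishes. -/
theorem eq_zero_of_linear_ode {G : Type*} [NormedAddCommGroup G] [NormedSpace ℝ G]
    {A : ℝ → G →L[ℝ] G} (hA : Continuous A) {y : ℝ → G}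
    (hy : ∀ t, HasDerivAt y (A t (y t)) t) {t₀ : ℝ} (h0 : y t₀ = 0) (t : ℝ) : y t = 0 := by
  set T := |t₀| + |t| + 1
  have hT : ∀ r, |r| < T → r ∈ Ioo (-T) T := fun r hr => abs_lt.1 hr
  obtain ⟨K, hK⟩ := (isCompact_Icc (a := -T) (b := T)).exists_bound_of_continuousOn hA.continuousOn
  have h := ODE_solution_unique_of_mem_Ioo (v := fun t x => A t x) (s := fun _ => univ)
    (K := K.toNNReal) (a := -T) (b := T) (t₀ := t₀) (f := y) (g := fun _ => 0)
    (fun r hr => LipschitzWith.lipschitzOnWith ((A r).lipschitz.weaken (by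
      rw [← NNReal.coe_le_coe, coe_nnnorm]
      exact (hK r (Ioo_subset_Icc_self hr)).trans (Real.le_coe_toNNReal K))))
    (hT _ (by simp only [T]; linarith [abs_nonneg t])) (fun r _ => ⟨hy r, mem_univ _⟩)
    (fun r _ => ⟨by simpa using hasDerivAt_const r (0 : G), mem_univ _⟩) (by simpa using h0)
  exact h (hT _ (by simp only [T]; linarith [abs_nonneg t₀]))

/-- A solution of a finite linear system which vanishes at some time vanishes. -/
theorem eq_zero_of_linear_system {ι : Type*} [Fintype ι] {m : ℝ → ι → ι → ℝ}
    (hm : ∀ i j, Continuous fun t => m t i j) {z : ℝ → ι → ℝ}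
    (hz : ∀ t i, HasDerivAt (fun t => z t i) (∑ j, m t i j * z t j) t) {t₀ : ℝ}
    (h0 : ∀ i, z t₀ i = 0) (t : ℝ) (i : ι) : z t i = 0 := by
  classical
  let A : ℝ → (ι → ℝ) →L[ℝ] (ι → ℝ) := fun t =>
    ContinuousLinearMap.pi fun i => ∑ j, m t i j • ContinuousLinearMap.proj j
  have hA : Continuous A := continuous_clm_apply.2 fun y => continuous_pi fun i => by
    simp only [A, ContinuousLinearMap.pi_apply, sum_apply, smul_apply,
      ContinuousLinearMap.proj_apply, smul_eq_mul]
    exact continuous_finsetSum _ fun j _ => (hm i j).mul continuous_const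
  have := eq_zero_of_linear_ode hA (y := z) (fun t => hasDerivAt_pi.2 fun i => by
    simpa [A] using hz t i) (t₀ := t₀) (funext h0) t
  exact congrFun this i

end LinearODE

section MixedPartial

variable {E : Type*} [NormedAddCommGroup E] [NormedSpace ℝ E]

lemma HasFDerivAt.partial_snd {h : ℝ × E → ℝ} {p : ℝ × E} (hh : DifferentiableAt ℝ h p) (u : E) :
    fderiv ℝ (fun e => h (p.1, e)) p.2 u = fderiv ℝ h p (0, u) := by
  have h1 : HasFDerivAt (fun e : E => (p.1, e)) (ContinuousLinearMap.inr ℝ ℝ E) p.2 :=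
    hasFDerivAt_prodMk_right p.1 p.2
  have h2 : HasFDerivAt (fun e => h (p.1, e)) ((fderiv ℝ h p).comp (ContinuousLinearMap.inr ℝ ℝ E))
      p.2 := HasFDerivAt.comp (f := fun e : E => (p.1, e)) (g := h) p.2 hh.hasFDerivAt h1
  rw [h2.fderiv]
  rfl

lemma HasFDerivAt.partial_fst {h : ℝ × E → ℝ} {p : ℝ × E} (hh : DifferentiableAt ℝ h p) :
    deriv (fun s => h (s, p.2)) p.1 = fderiv ℝ h p (1, 0) := by
  have h1 : HasFDerivAt (fun s : ℝ => (s, p.2)) (ContinuousLinearMap.inl ℝ ℝ E) p.1 :=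
    hasFDerivAt_prodMk_left p.1 p.2
  have h2 : HasFDerivAt (fun s => h (s, p.2)) ((fderiv ℝ h p).comp (ContinuousLinearMap.inl ℝ ℝ E))
      p.1 := HasFDerivAt.comp (f := fun s : ℝ => (s, p.2)) (g := h) p.1 hh.hasFDerivAt h1
  rw [h2.hasDerivAt.deriv]
  rfl

/-- Symmetry of the mixed second derivatives of a function on `ℝ × E`. -/
lemma ContDiffAt.hasDerivAt_fderiv_snd {h : ℝ × E → ℝ} {s : ℝ} {e : E}
    (hh : ContDiffAt ℝ 2 h (s, e)) (u : E) :
    HasDerivAt (fun t => fderiv ℝ (fun e' => h (t, e')) e u)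
      (fderiv ℝ (fun e' => deriv (fun t => h (t, e')) s) e u) s := by
  have hev : ∀ᶠ p in nhds (s, e), DifferentiableAt ℝ h p := by
    filter_upwards [hh.eventually (by simp)] with p hp
    exact hp.differentiableAt (by simp)
  have hD : HasFDerivAt (fderiv ℝ h) (fderiv ℝ (fderiv ℝ h) (s, e)) (s, e) :=
    ((hh.fderiv_right (m := 1) (by norm_num)).differentiableAt (by simp)).hasFDerivAt
  have hsym := (hh.isSymmSndFDerivAt (by simp)) (1, 0) (0, u)
  have hc1 : Filter.Tendsto (fun t : ℝ => (t, e)) (nhds s) (nhds (s, e)) :=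
    (by fun_prop : Continuous fun t : ℝ => (t, e)).tendsto s
  have hc2 : Filter.Tendsto (fun e' : E => (s, e')) (nhds e) (nhds (s, e)) :=
    (by fun_prop : Continuous fun e' : E => (s, e')).tendsto e
  have e1 : (fun t => fderiv ℝ (fun e' => h (t, e')) e u) =ᶠ[nhds s]
      fun t => fderiv ℝ h (t, e) (0, u) := by
    filter_upwards [hc1.eventually hev] with t ht using HasFDerivAt.partial_snd ht u
  have e2 : (fun e' => deriv (fun t => h (t, e')) s) =ᶠ[nhds e]
      fun e' => fderiv ℝ h (s, e') (1, 0) := by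
    filter_upwards [hc2.eventually hev] with e' ht using HasFDerivAt.partial_fst ht
  have d1 : HasFDerivAt (fun e' : E => fderiv ℝ h (s, e'))
      ((fderiv ℝ (fderiv ℝ h) (s, e)).comp (ContinuousLinearMap.inr ℝ ℝ E)) e :=
    HasFDerivAt.comp (f := fun e' : E => (s, e')) (g := fderiv ℝ h) e hD
      (hasFDerivAt_prodMk_right s e)
  have d2 : HasFDerivAt (fun t : ℝ => fderiv ℝ h (t, e))
      ((fderiv ℝ (fderiv ℝ h) (s, e)).comp (ContinuousLinearMap.inl ℝ ℝ E)) s :=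
    HasFDerivAt.comp (f := fun t : ℝ => (t, e)) (g := fderiv ℝ h) s hD
      (hasFDerivAt_prodMk_left s e)
  rw [e2.fderiv_eq]
  refine HasDerivAt.congr_of_eventuallyEq ?_ e1
  have d1' := d1.clm_apply (hasFDerivAt_const ((1 : ℝ), (0 : E)) e)
  have d2' := (d2.clm_apply (hasFDerivAt_const ((0 : ℝ), u) s)).hasDerivAt
  rw [d1'.fderiv]
  refine d2'.congr_deriv ?_
  simpa using hsym

end MixedPartial

section Families

set_option linter.unusedSectionVars false

variable {E : Type*} [NormedAddCommGroup E] [NormedSpace ℝ E]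
  {H : Type*} [TopologicalSpace H] (I : ModelWithCorners ℝ E H)
  {M : Type*} [TopologicalSpace M] [ChartedSpace H M]

/-- The family `s ↦ g s` of functions on `M` is smooth, jointly in both variables. -/
abbrev SmoothFamily (g : ℝ → M → ℝ) : Prop :=
  ContMDiff (𝓘(ℝ, ℝ).prod I) 𝓘(ℝ, ℝ) ∞ (fun p : ℝ × M => g p.1 p.2)

variable {I} {g : ℝ → M → ℝ}

namespace SmoothFamily

lemma slice (hg : SmoothFamily I g) (s : ℝ) : ContMDiff I 𝓘(ℝ, ℝ) ∞ (g s) :=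
  ContMDiff.comp (g := fun p : ℝ × M => g p.1 p.2) hg (contMDiff_const.prodMk contMDiff_id)

lemma mdifferentiableAt (hg : SmoothFamily I g) (s : ℝ) (x : M) :
    MDifferentiableAt I 𝓘(ℝ, ℝ) (g s) x :=
  (hg.slice s).mdifferentiableAt (by simp)

lemma of_slice {f : M → ℝ} (hf : ContMDiff I 𝓘(ℝ, ℝ) ∞ f) : SmoothFamily I (fun _ => f) :=
  hf.comp contMDiff_snd

lemma differentiable (hg : SmoothFamily I g) (x : M) : Differentiable ℝ (fun s => g s x) := by
  have : ContMDiff 𝓘(ℝ, ℝ) 𝓘(ℝ, ℝ) ∞ (fun s => g s x) :=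
    ContMDiff.comp (g := fun p : ℝ × M => g p.1 p.2) hg (contMDiff_id.prodMk contMDiff_const)
  exact this.contDiff.differentiable (by simp)

lemma continuous_comp (hg : SmoothFamily I g) {c : ℝ → M} (hc : Continuous c) :
    Continuous (fun s => g s (c s)) :=
  hg.continuous.comp (continuous_id.prodMk hc)

variable [IsManifold I ∞ M]

lemma mfderiv_apply (hg : SmoothFamily I g) (p : ℝ × M) (r : ℝ) (v : TangentSpace I p.2) :
    mfderiv (𝓘(ℝ, ℝ).prod I) 𝓘(ℝ, ℝ) (fun p : ℝ × M => g p.1 p.2) p (r, v) =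
      r * deriv (fun s => g s p.2) p.1 + mvfderiv I (g p.1) p.2 v := by
  have h := mfderiv_prod_eq_add_apply (v := ((r, v) : TangentSpace (𝓘(ℝ, ℝ).prod I) p))
    (ContMDiff.mdifferentiableAt hg (by simp) (x := p))
  refine h.trans ?_
  congr 1
  have h2 : fderiv ℝ (fun z : ℝ => g z p.2) p.1 r = r * deriv (fun s => g s p.2) p.1 := by
    rw [((hg.differentiable p.2).differentiableAt (x := p.1)).hasDerivAt.hasFDerivAt.fderiv]
    simp
  rw [mfderiv_eq_fderiv]
  exact h2

variable {E₀ : Type*} [NormedAddCommGroup E₀] [NormedSpace ℝ E₀]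
  {H₀ : Type*} [TopologicalSpace H₀] {J : ModelWithCorners ℝ E₀ H₀}
  {N : Type*} [TopologicalSpace N] [ChartedSpace H₀ N]

lemma contMDiff_mfderiv_apply (hg : SmoothFamily I g) {Y : ℝ → ∀ x : M, TangentSpace I x} {r : ℝ}
    (hY : ContMDiff (𝓘(ℝ, ℝ).prod I) I.tangent ∞
      (fun z : ℝ × M => (⟨z.2, Y z.1 z.2⟩ : TangentBundle I M))) :
    SmoothFamily I (fun s x => r * deriv (fun s => g s x) s + mvfderiv I (g s) x (Y s x)) := by
  have h1 := hg.contMDiff_tangentMap (m := ∞) (by simp)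
  have h2 := h1.comp ((ContMDiff.tangentVectorSpace (J := 𝓘(ℝ, ℝ).prod I) (u := fun _ => r)
    contMDiff_fst contMDiff_const).tangentProd hY)
  intro p
  have h3 := (Bundle.contMDiffAt_totalSpace.1 (h2 p)).2
  refine ContMDiffAt.congr_of_eventuallyEq h3 (Filter.Eventually.of_forall fun q => ?_)
  exact ((by simp [tangentMap] : _ = _).trans (hg.mfderiv_apply q r (Y q.1 q.2))).symm

lemma deriv_left (hg : SmoothFamily I g) : SmoothFamily I (fun s x => deriv (fun s => g s x) s) := by
  have h0 : ContMDiff (𝓘(ℝ, ℝ).prod I) I.tangent ∞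
      (fun z : ℝ × M => (⟨z.2, 0⟩ : TangentBundle I M)) :=
    (contMDiff_zeroSection ℝ (TangentSpace I : M → Type _)).comp contMDiff_snd
  simpa using hg.contMDiff_mfderiv_apply (r := 1) (Y := fun _ _ => 0) h0

lemma mvfderiv_right (hg : SmoothFamily I g) {Y : ℝ → ∀ x : M, TangentSpace I x}
    (hY : ContMDiff (𝓘(ℝ, ℝ).prod I) I.tangent ∞
      (fun z : ℝ × M => (⟨z.2, Y z.1 z.2⟩ : TangentBundle I M))) :
    SmoothFamily I (fun s x => mvfderiv I (g s) x (Y s x)) := by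
  simpa using hg.contMDiff_mfderiv_apply (r := 0) hY

/-- The chain rule for the restriction of a family to a curve. -/
lemma hasDerivAt_comp (hg : SmoothFamily I g) {c : ℝ → M} {s : ℝ} {v : TangentSpace I (c s)}
    (hc : HasMFDerivAt 𝓘(ℝ, ℝ) I c s ((1 : ℝ →L[ℝ] ℝ).smulRight v)) :
    HasDerivAt (fun t => g t (c t)) (deriv (fun t => g t (c s)) s + mvfderiv I (g s) (c s) v) s := by
  have h1 := (hasMFDerivAt_id (I := 𝓘(ℝ, ℝ)) s).prodMk hc
  have h2 := (ContMDiff.mdifferentiableAt hg (by simp) (x := (s, c s))).hasMFDerivAt.comp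
    (f := fun t => (t, c t)) s h1
  rw [hasMFDerivAt_iff_hasFDerivAt] at h2
  have h3 : HasFDerivAt (𝕜 := ℝ) (E := ℝ) (F := ℝ) (fun t => g t (c t)) _ s := h2
  refine h3.hasDerivAt.congr_deriv ?_
  have h4 := hg.mfderiv_apply (s, c s) 1 v
  rw [one_mul] at h4
  have h5 : (((1 : ℝ), (1 : ℝ) • v) : TangentSpace (𝓘(ℝ, ℝ).prod I) (s, c s)) = ((1 : ℝ), v) :=
    Prod.ext rfl (one_smul ℝ v)
  exact (congrArg (mfderiv (𝓘(ℝ, ℝ).prod I) 𝓘(ℝ, ℝ) (fun p : ℝ × M => g p.1 p.2) (s, c s)) h5).trans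
    h4

/-- The derivatives in the two variables commute. -/
lemma hasDerivAt_mvfderiv [I.Boundaryless] (hg : SmoothFamily I g) (s : ℝ) {x : M}
    (u : TangentSpace I x) :
    HasDerivAt (fun t => mvfderiv I (g t) x u)
      (mvfderiv I (fun y => deriv (fun t => g t y) s) x u) s := by
  have key : ∀ f : M → ℝ, MDifferentiableAt I 𝓘(ℝ, ℝ) f x → mvfderiv I f x u =
      fderiv ℝ (fun e => f ((extChartAt I x).symm e)) (extChartAt I x x) u := by
    intro f hf
    have h := hf.mfderiv
    rw [I.range_eq_univ, fderivWithin_univ] at h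
    change (mfderiv I 𝓘(ℝ, ℝ) f x) u = _
    rw [h]
    rfl
  rw [key _ ((hg.deriv_left.slice s).mdifferentiableAt (by simp))]
  simp_rw [fun t => key _ (hg.mdifferentiableAt t x)]
  refine ContDiffAt.hasDerivAt_fderiv_snd
    (h := fun p : ℝ × E => g p.1 ((extChartAt I x).symm p.2)) ?_ u
  have h1 : ContMDiffAt 𝓘(ℝ, E) I ∞ (extChartAt I x).symm (extChartAt I x x) :=
    (contMDiffOn_extChartAt_symm x).contMDiffAt (extChartAt_target_mem_nhds x)
  have h2 : ContMDiffAt 𝓘(ℝ, ℝ × E) 𝓘(ℝ, ℝ) ∞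
      (fun p : ℝ × E => g p.1 ((extChartAt I x).symm p.2)) (s, extChartAt I x x) := by
    rw [modelWithCornersSelf_prod, ← chartedSpaceSelf_prod]
    exact ContMDiffAt.comp (g := fun p : ℝ × M => g p.1 p.2) (s, extChartAt I x x) (hg _)
      (contMDiffAt_fst.prodMk (ContMDiffAt.comp (s, extChartAt I x x) (g := (extChartAt I x).symm)
        (f := Prod.snd) h1 contMDiffAt_snd))
  exact mod_cast contDiffAt_infty.1 (contMDiffAt_iff_contDiffAt.1 h2) 2

end SmoothFamily

end Families

section Algebroid

set_option linter.unusedSectionVars false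

variable {E : Type*} [NormedAddCommGroup E] [NormedSpace ℝ E]
  {H : Type*} [TopologicalSpace H] {I : ModelWithCorners ℝ E H}
  {M : Type*} [TopologicalSpace M] [ChartedSpace H M]
  {F : Type*} [NormedAddCommGroup F] [NormedSpace ℝ F]
  {V : M → Type*} [TopologicalSpace (TotalSpace F V)]
  [∀ x, AddCommGroup (V x)] [∀ x, Module ℝ (V x)] [∀ x, TopologicalSpace (V x)]
  [FiberBundle F V] [VectorBundle ℝ F V]
  [IsManifold I ∞ M] [∀ x, IsTopologicalAddGroup (V x)] [∀ x, ContinuousSMul ℝ (V x)]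

@[simp]
lemma smoothSMul_apply (f : C^∞⟮I, M; ℝ⟯) (s : Cₛ^∞⟮I; F, V⟯) (x : M) :
    smoothSMul I F V f s x = f x • s x := rfl

lemma ContMDiffSection.sum_apply {ι : Type*} (t : Finset ι) (s : ι → Cₛ^∞⟮I; F, V⟯) (x : M) :
    (∑ i ∈ t, s i) x = ∑ i ∈ t, s i x := by
  have h := congrFun (map_sum (ContMDiffSection.coeAddHom I F ∞ V) s t) x
  rw [Finset.sum_apply] at h
  exact h

namespace LieAlgebroid

variable (A : LieAlgebroid I F V)

section Smoothness

variable {E₀ : Type*} [NormedAddCommGroup E₀] [NormedSpace ℝ E₀]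
  {H₀ : Type*} [TopologicalSpace H₀] {J : ModelWithCorners ℝ E₀ H₀}
  {N : Type*} [TopologicalSpace N] [ChartedSpace H₀ N]

lemma contMDiff_anchor_comp {b : N → M} {v : ∀ p, V (b p)}
    (hb : ContMDiff J I ∞ b)
    (hv : ContMDiff J (I.prod 𝓘(ℝ, F)) ∞ (fun p => (⟨b p, v p⟩ : TotalSpace F V))) :
    ContMDiff J I.tangent ∞ (fun p => (⟨b p, A.anchor (b p) (v p)⟩ : TangentBundle I M)) :=
  ContMDiff.clm_bundle_apply (ϕ := fun p => A.anchor (b p)) (A.anchor.contMDiff.comp hb) hv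

end Smoothness

lemma contMDiff_anchor_section (a : Cₛ^∞⟮I; F, V⟯) :
    ContMDiff I I.tangent ∞ (fun x => (⟨x, A.anchor x (a x)⟩ : TangentBundle I M)) :=
  A.contMDiff_anchor_comp contMDiff_id a.contMDiff

lemma smoothFamily_anchorDeriv (a : Cₛ^∞⟮I; F, V⟯) {g : ℝ → M → ℝ} (hg : SmoothFamily I g) :
    SmoothFamily I (fun s => A.anchorDeriv a (g s)) :=
  hg.mvfderiv_right (Y := fun _ x => A.anchor x (a x))
    ((A.contMDiff_anchor_section a).comp contMDiff_snd)

lemma contMDiff_anchorDeriv (a : Cₛ^∞⟮I; F, V⟯) {f : M → ℝ} (hf : ContMDiff I 𝓘(ℝ, ℝ) ∞ f) :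
    ContMDiff I 𝓘(ℝ, ℝ) ∞ (A.anchorDeriv a f) :=
  (A.smoothFamily_anchorDeriv a (SmoothFamily.of_slice hf)).slice 0

lemma bracket_antisymm (a b : Cₛ^∞⟮I; F, V⟯) : A.bracket a b = -A.bracket b a := by
  have h := A.bracket_self (a + b)
  simp only [map_add, LinearMap.add_apply, A.bracket_self, zero_add, add_zero] at h
  exact eq_neg_of_add_eq_zero_right h

lemma leibniz_left (a b : Cₛ^∞⟮I; F, V⟯) (f : C^∞⟮I, M; ℝ⟯) (x : M) :
    A.bracket (smoothSMul I F V f a) b x = f x • A.bracket a b x - A.anchorDeriv b f x • a x := by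
  rw [A.bracket_antisymm, ContMDiffSection.coe_neg, Pi.neg_apply, A.leibniz, A.bracket_antisymm b a]
  simp only [ContMDiffSection.coe_neg, Pi.neg_apply, anchorDeriv]
  module

lemma bracket_bracket (a b c : Cₛ^∞⟮I; F, V⟯) :
    A.bracket (A.bracket a b) c = A.bracket a (A.bracket b c) - A.bracket b (A.bracket a c) := by
  have h := A.jacobi a b c
  rw [A.bracket_antisymm (A.bracket b c) a, A.bracket_antisymm (A.bracket c a) b,
    A.bracket_antisymm c a, map_neg, neg_neg] at h
  rw [← sub_eq_zero, ← h]
  abel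

lemma anchorDeriv_add (a : Cₛ^∞⟮I; F, V⟯) {f g : M → ℝ} {x : M}
    (hf : MDifferentiableAt I 𝓘(ℝ, ℝ) f x) (hg : MDifferentiableAt I 𝓘(ℝ, ℝ) g x) :
    A.anchorDeriv a (fun y => f y + g y) x = A.anchorDeriv a f x + A.anchorDeriv a g x := by
  have := congrArg (· (A.anchor x (a x))) (mvfderiv_add hf hg)
  exact this

lemma anchorDeriv_mul (a : Cₛ^∞⟮I; F, V⟯) {f g : M → ℝ} {x : M}
    (hf : MDifferentiableAt I 𝓘(ℝ, ℝ) f x) (hg : MDifferentiableAt I 𝓘(ℝ, ℝ) g x) :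
    A.anchorDeriv a (fun y => f y * g y) x =
      f x * A.anchorDeriv a g x + A.anchorDeriv a f x * g x := by
  have := congrArg (· (A.anchor x (a x))) (mvfderiv_mul hf hg)
  refine this.trans ?_
  simp [anchorDeriv, mul_comm]

lemma anchorDeriv_sum {ι : Type*} (a : Cₛ^∞⟮I; F, V⟯) (t : Finset ι) {f : ι → M → ℝ}
    (hf : ∀ i, ContMDiff I 𝓘(ℝ, ℝ) ∞ (f i)) (x : M) :
    A.anchorDeriv a (fun y => ∑ i ∈ t, f i y) x = ∑ i ∈ t, A.anchorDeriv a (f i) x := by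
  classical
  induction t using Finset.induction_on with
  | empty =>
    have := congrArg (· (A.anchor x (a x))) (mvfderiv_const (I := I) (0 : ℝ) (x := x))
    simpa [anchorDeriv] using this
  | insert i t hi ih =>
    have hs : ContMDiff I 𝓘(ℝ, ℝ) ∞ (fun y => ∑ i ∈ t, f i y) := ContMDiff.sum fun i _ => hf i
    simp only [Finset.sum_insert hi]
    rw [← ih]
    exact A.anchorDeriv_add a ((hf i).mdifferentiableAt (by simp)) (hs.mdifferentiableAt (by simp))

variable {A} in
lemma anchorDeriv_eq_of_nontrivial (a b c : Cₛ^∞⟮I; F, V⟯) {f : M → ℝ}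
    (hf : ContMDiff I 𝓘(ℝ, ℝ) ∞ f) (x : M) :
    (A.anchorDeriv (A.bracket a b) f x -
      (A.anchorDeriv a (A.anchorDeriv b f) x - A.anchorDeriv b (A.anchorDeriv a f) x)) • c x = 0 := by
  let f' : C^∞⟮I, M; ℝ⟯ := ⟨f, hf⟩
  let fa : C^∞⟮I, M; ℝ⟯ := ⟨A.anchorDeriv a f, A.contMDiff_anchorDeriv a hf⟩
  let fb : C^∞⟮I, M; ℝ⟯ := ⟨A.anchorDeriv b f, A.contMDiff_anchorDeriv b hf⟩
  have hL : ∀ d e : Cₛ^∞⟮I; F, V⟯, ∀ g : C^∞⟮I, M; ℝ⟯, A.bracket d (smoothSMul I F V g e) x =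
      g x • A.bracket d e x + A.anchorDeriv d g x • e x := fun d e g => A.leibniz d e g x
  have hb : A.bracket b (smoothSMul I F V f' c) =
      smoothSMul I F V f' (A.bracket b c) + smoothSMul I F V fb c := by
    ext y; exact A.leibniz b c f' y
  have ha : A.bracket a (smoothSMul I F V f' c) =
      smoothSMul I F V f' (A.bracket a c) + smoothSMul I F V fa c := by
    ext y; exact A.leibniz a c f' y
  have h1 := congrArg (fun s : Cₛ^∞⟮I; F, V⟯ => s x) (A.bracket_bracket a b (smoothSMul I F V f' c))
  have h2 := congrArg (fun s : Cₛ^∞⟮I; F, V⟯ => s x) (A.bracket_bracket a b c)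
  simp only [hb, ha, map_add, ContMDiffSection.coe_sub, ContMDiffSection.coe_add, Pi.sub_apply,
    Pi.add_apply, hL] at h1 h2
  rw [h2] at h1
  have e1 : (f' : M → ℝ) = f := rfl
  have e2 : (fa : M → ℝ) = A.anchorDeriv a f := rfl
  have e3 : (fb : M → ℝ) = A.anchorDeriv b f := rfl
  rw [e1, e2, e3] at h1
  rw [← sub_eq_zero] at h1
  rw [← h1]
  module

lemma anchorDeriv_eq_sum (fr : GlobalFrame I F V) (a : Cₛ^∞⟮I; F, V⟯) (f : M → ℝ) (x : M) :
    A.anchorDeriv a f x = ∑ i, fr.coord i x (a x) * A.anchorDeriv (fr.sec i) f x := by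
  have h := congrArg (fun v => mvfderiv I f x (A.anchor x v)) (fr.sum_coord x (a x))
  simpa [anchorDeriv] using h.symm

/-- The anchor is compatible with brackets, as derivations of functions. -/
theorem anchorDeriv_bracket (fr : GlobalFrame I F V) (a b : Cₛ^∞⟮I; F, V⟯) {f : M → ℝ}
    (hf : ContMDiff I 𝓘(ℝ, ℝ) ∞ f) (x : M) :
    A.anchorDeriv (A.bracket a b) f x =
      A.anchorDeriv a (A.anchorDeriv b f) x - A.anchorDeriv b (A.anchorDeriv a f) x := by
  by_cases h : ∃ i, fr.sec i x ≠ 0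
  · obtain ⟨i, hi⟩ := h
    exact sub_eq_zero.1
      ((smul_eq_zero.1 (anchorDeriv_eq_of_nontrivial a b (fr.sec i) hf x)).resolve_right hi)
  · push Not at h
    have h0 : ∀ v : V x, v = 0 := fun v => by
      rw [← fr.sum_coord x v]
      simp [h]
    have h1 : ∀ (c : Cₛ^∞⟮I; F, V⟯) (g : M → ℝ), A.anchorDeriv c g x = 0 := fun c g => by
      rw [anchorDeriv, h0 (c x), map_zero, map_zero]
    simp [h1]

end LieAlgebroid

namespace GlobalFrame

variable (fr : GlobalFrame I F V)

/-- The coordinates of a section, as smooth functions. -/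
def coordFun (b : Cₛ^∞⟮I; F, V⟯) (i : Fin fr.n) : C^∞⟮I, M; ℝ⟯ :=
  ⟨fun x => fr.coord i x (b x), fr.contMDiff_coord_section b i⟩

/-- The section with given smooth coefficients. -/
def ofCoeff (y : M → Fin fr.n → ℝ) (hy : ∀ i, ContMDiff I 𝓘(ℝ, ℝ) ∞ (fun x => y x i)) :
    Cₛ^∞⟮I; F, V⟯ :=
  ⟨fun x => fr.synth x (y x), fr.contMDiff_synth contMDiff_id hy⟩

lemma eq_sum_smoothSMul (b : Cₛ^∞⟮I; F, V⟯) :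
    b = ∑ i, smoothSMul I F V (fr.coordFun b i) (fr.sec i) := by
  ext x
  rw [ContMDiffSection.sum_apply]
  exact (fr.sum_coord x (b x)).symm

variable (A : LieAlgebroid I F V)

lemma bracket_right_eq (b c : Cₛ^∞⟮I; F, V⟯) (x : M) :
    A.bracket b c x = ∑ j, (fr.coord j x (c x) • A.bracket b (fr.sec j) x +
      A.anchorDeriv b (fun y => fr.coord j y (c y)) x • fr.sec j x) := by
  conv_lhs => rw [fr.eq_sum_smoothSMul c, map_sum, ContMDiffSection.sum_apply]
  exact Finset.sum_congr rfl fun j _ => A.leibniz b (fr.sec j) (fr.coordFun c j) x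

lemma bracket_left_eq (b c : Cₛ^∞⟮I; F, V⟯) (x : M) :
    A.bracket b c x = ∑ i, (fr.coord i x (b x) • A.bracket (fr.sec i) c x -
      A.anchorDeriv c (fun y => fr.coord i y (b y)) x • fr.sec i x) := by
  conv_lhs => rw [fr.eq_sum_smoothSMul b, map_sum, LinearMap.sum_apply, ContMDiffSection.sum_apply]
  exact Finset.sum_congr rfl fun i _ => A.leibniz_left (fr.sec i) c (fr.coordFun b i) x

lemma coord_bracket_eq (b c : Cₛ^∞⟮I; F, V⟯) (x : M) (k : Fin fr.n) :
    fr.coord k x (A.bracket b c x) =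
      ∑ i, ∑ j, fr.coord i x (b x) * fr.coord j x (c x) *
        fr.coord k x (A.bracket (fr.sec i) (fr.sec j) x) +
      ∑ j, ∑ i, fr.coord i x (b x) * A.anchorDeriv (fr.sec i) (fun y => fr.coord j y (c y)) x *
        fr.pmat k j x -
      ∑ i, ∑ j, fr.coord j x (c x) * A.anchorDeriv (fr.sec j) (fun y => fr.coord i y (b y)) x *
        fr.pmat k i x := by
  rw [fr.bracket_left_eq A b c x, Finset.sum_sub_distrib]
  simp_rw [fr.bracket_right_eq A _ c x, A.anchorDeriv_eq_sum fr c]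
  simp only [map_sub, map_sum, map_add, map_smul, smul_eq_mul, Finset.smul_sum, smul_add,
    Finset.sum_add_distrib, Finset.sum_mul, smul_smul]
  congr 2
  rw [Finset.sum_comm]
  rfl

/-- A family of sections with smooth coordinates. -/
def SmoothSections (b : ℝ → Cₛ^∞⟮I; F, V⟯) : Prop :=
  ∀ i, SmoothFamily I (fun s x => fr.coord i x (b s x))

/-- `b'` is the derivative of the family of sections `b` with respect to the parameter. -/
def HasSectionDeriv (b b' : ℝ → Cₛ^∞⟮I; F, V⟯) : Prop :=
  ∀ i s x, HasDerivAt (fun t => fr.coord i x (b t x)) (fr.coord i x (b' s x)) s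

variable {fr}

lemma smoothSections_const (b : Cₛ^∞⟮I; F, V⟯) : fr.SmoothSections (fun _ => b) := fun i =>
  SmoothFamily.of_slice (fr.contMDiff_coord_section b i)

lemma SmoothSections.anchorDeriv {b : ℝ → Cₛ^∞⟮I; F, V⟯} (hb : fr.SmoothSections b)
    {g : ℝ → M → ℝ} (hg : SmoothFamily I g) : SmoothFamily I (fun s => A.anchorDeriv (b s) (g s)) := by
  have : SmoothFamily I (fun s x => ∑ i, fr.coord i x (b s x) * A.anchorDeriv (fr.sec i) (g s) x) :=
    ContMDiff.sum fun i _ => (hb i).mul (A.smoothFamily_anchorDeriv (fr.sec i) hg)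
  refine ContMDiff.congr this fun p => A.anchorDeriv_eq_sum fr _ _ _

lemma SmoothSections.bracket {b c : ℝ → Cₛ^∞⟮I; F, V⟯} (hb : fr.SmoothSections b)
    (hc : fr.SmoothSections c) : fr.SmoothSections (fun s => A.bracket (b s) (c s)) := fun k => by
  have hP : ∀ j, SmoothFamily I (fun _ => fr.pmat k j) := fun j =>
    SmoothFamily.of_slice (fr.contMDiff_pmat k j)
  refine ContMDiff.congr (ContMDiff.sub (ContMDiff.add ?_ ?_) ?_)
    fun p => fr.coord_bracket_eq A (b p.1) (c p.1) p.2 k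
  · exact ContMDiff.sum fun i _ => ContMDiff.sum fun j _ => ((hb i).mul (hc j)).mul
      (SmoothFamily.of_slice (fr.contMDiff_coord_section _ k))
  · exact ContMDiff.sum fun j _ => ContMDiff.sum fun i _ =>
      ((hb i).mul (A.smoothFamily_anchorDeriv (fr.sec i) (hc j))).mul (hP j)
  · exact ContMDiff.sum fun i _ => ContMDiff.sum fun j _ =>
      ((hc j).mul (A.smoothFamily_anchorDeriv (fr.sec j) (hb i))).mul (hP i)

lemma _root_.LieAlgebroid.hasDerivAt_anchorDeriv [I.Boundaryless] (a : Cₛ^∞⟮I; F, V⟯)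
    {g : ℝ → M → ℝ} (hg : SmoothFamily I g) (s : ℝ) (x : M) :
    HasDerivAt (fun t => A.anchorDeriv a (g t) x)
      (A.anchorDeriv a (fun y => deriv (fun t => g t y) s) x) s :=
  hg.hasDerivAt_mvfderiv s _

/-- The bracket is a derivation with respect to a parameter. -/
theorem HasSectionDeriv.bracket [I.Boundaryless] {b b' c c' : ℝ → Cₛ^∞⟮I; F, V⟯}
    (hb : fr.SmoothSections b) (hc : fr.SmoothSections c)
    (hb' : fr.HasSectionDeriv b b') (hc' : fr.HasSectionDeriv c c') :
    fr.HasSectionDeriv (fun s => A.bracket (b s) (c s))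
      (fun s => A.bracket (b' s) (c s) + A.bracket (b s) (c' s)) := by
  intro k s x
  have hd : ∀ {e e' : ℝ → Cₛ^∞⟮I; F, V⟯}, fr.SmoothSections e → fr.HasSectionDeriv e e' →
      ∀ i j, HasDerivAt (fun t => A.anchorDeriv (fr.sec i) (fun y => fr.coord j y (e t y)) x)
        (A.anchorDeriv (fr.sec i) (fun y => fr.coord j y (e' s y)) x) s := by
    intro e e' he he' i j
    have := A.hasDerivAt_anchorDeriv (fr.sec i) (he j) s x
    have h0 : (fun y => deriv (fun t => fr.coord j y (e t y)) s) = fun y => fr.coord j y (e' s y) :=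
      funext fun y => (he' j s y).deriv
    rwa [h0] at this
  have h1 : HasDerivAt (fun t => ∑ i, ∑ j, fr.coord i x (b t x) * fr.coord j x (c t x) *
      fr.coord k x (A.bracket (fr.sec i) (fr.sec j) x)) _ s :=
    HasDerivAt.fun_sum fun i _ => HasDerivAt.fun_sum fun j _ =>
      ((hb' i s x).mul (hc' j s x)).mul_const _
  have h2 : HasDerivAt (fun t => ∑ j, ∑ i, fr.coord i x (b t x) *
      A.anchorDeriv (fr.sec i) (fun y => fr.coord j y (c t y)) x * fr.pmat k j x) _ s :=
    HasDerivAt.fun_sum fun j _ => HasDerivAt.fun_sum fun i _ =>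
      ((hb' i s x).mul (hd hc hc' i j)).mul_const _
  have h3 : HasDerivAt (fun t => ∑ i, ∑ j, fr.coord j x (c t x) *
      A.anchorDeriv (fr.sec j) (fun y => fr.coord i y (b t y)) x * fr.pmat k i x) _ s :=
    HasDerivAt.fun_sum fun i _ => HasDerivAt.fun_sum fun j _ =>
      ((hc' j s x).mul (hd hb hb' j i)).mul_const _
  have h := (h1.add h2).sub h3
  refine (h.congr_deriv ?_).congr_of_eventuallyEq
    (Filter.Eventually.of_forall fun t => fr.coord_bracket_eq A (b t) (c t) x k)
  rw [ContMDiffSection.coe_add, Pi.add_apply, map_add, fr.coord_bracket_eq A (b' s) (c s),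
    fr.coord_bracket_eq A (b s) (c' s)]
  simp only [add_mul, Finset.sum_add_distrib]
  ring

end GlobalFrame

end Algebroid

section SectionFlow

set_option linter.unusedSectionVars false

variable {E : Type*} [NormedAddCommGroup E] [NormedSpace ℝ E]
  {H : Type*} [TopologicalSpace H] {I : ModelWithCorners ℝ E H}
  {M : Type*} [TopologicalSpace M] [ChartedSpace H M]
  {F : Type*} [NormedAddCommGroup F] [NormedSpace ℝ F]
  {V : M → Type*} [TopologicalSpace (TotalSpace F V)]
  [∀ x, AddCommGroup (V x)] [∀ x, Module ℝ (V x)] [∀ x, TopologicalSpace (V x)]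
  [FiberBundle F V] [VectorBundle ℝ F V]
  [IsManifold I ∞ M] [∀ x, IsTopologicalAddGroup (V x)] [∀ x, ContinuousSMul ℝ (V x)]

namespace GlobalFrame

variable (fr : GlobalFrame I F V)

/-- The projection onto the space of coordinate vectors of elements of the fibre. -/
def proj (x : M) : (Fin fr.n → ℝ) →L[ℝ] (Fin fr.n → ℝ) := (fr.anal x).comp (fr.synth x)

lemma proj_eq (x : M) : fr.proj x = matrixCLM fr.n (fun k i => fr.pmat k i x) := by
  ext1 y
  funext k
  rw [matrixCLM_apply]
  exact fr.anal_synth_apply x y k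

lemma proj_apply (x : M) (y : Fin fr.n → ℝ) : fr.proj x y = fr.anal x (fr.synth x y) := rfl

@[simp]
lemma proj_anal (x : M) (v : V x) : fr.proj x (fr.anal x v) = fr.anal x v := by
  rw [proj_apply, synth_anal]

@[simp]
lemma synth_proj (x : M) (y : Fin fr.n → ℝ) : fr.synth x (fr.proj x y) = fr.synth x y := by
  rw [proj_apply, synth_anal]

lemma contMDiff_proj : ContMDiff I 𝓘(ℝ, (Fin fr.n → ℝ) →L[ℝ] (Fin fr.n → ℝ)) ∞ fr.proj := by
  simp_rw [funext fr.proj_eq]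
  exact (matrixCLM fr.n).contDiff.contMDiff.comp (contMDiff_pi₂ fr.contMDiff_pmat)

variable (A : LieAlgebroid I F V) (a : Cₛ^∞⟮I; F, V⟯)

/-- The derivative of the projection along the anchor of a section. -/
def projDeriv (x : M) : (Fin fr.n → ℝ) →L[ℝ] (Fin fr.n → ℝ) :=
  matrixCLM fr.n (fun k i => A.anchorDeriv a (fr.pmat k i) x)

/-- The matrix of the bracket with a section. -/
def bracketMat (x : M) : (Fin fr.n → ℝ) →L[ℝ] (Fin fr.n → ℝ) :=
  matrixCLM fr.n (fun k i => fr.coord k x (A.bracket a (fr.sec i) x))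

/-- The generator of the lift of the flow to coordinate vectors. -/
def generator (x : M) : (Fin fr.n → ℝ) →L[ℝ] (Fin fr.n → ℝ) :=
  (fr.projDeriv A a x).comp (fr.proj x) - fr.bracketMat A a x

lemma bracketMat_apply (x : M) (y : Fin fr.n → ℝ) :
    fr.bracketMat A a x y = fr.anal x (∑ i, y i • A.bracket a (fr.sec i) x) := by
  funext k
  rw [bracketMat, matrixCLM_apply, anal_apply, map_sum]
  simp [mul_comm]

lemma proj_bracketMat (x : M) (y : Fin fr.n → ℝ) :
    fr.proj x (fr.bracketMat A a x y) = fr.bracketMat A a x y := by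
  rw [bracketMat_apply, proj_anal]

/-- The coordinates of a bracket. -/
lemma anal_bracket (b : Cₛ^∞⟮I; F, V⟯) (x : M) :
    fr.anal x (A.bracket a b x) = fr.bracketMat A a x (fr.anal x (b x)) +
      fr.proj x (fun j => A.anchorDeriv a (fun y => fr.coord j y (b y)) x) := by
  rw [bracketMat_apply, proj_apply, ← map_add, synth_apply, ← Finset.sum_add_distrib]
  exact congrArg _ (fr.bracket_right_eq A a b x)

lemma proj_single (x : M) (i : Fin fr.n) :
    fr.proj x (Pi.single i 1) = fr.anal x (fr.sec i x) := by
  rw [proj_apply, synth_single]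

lemma projDeriv_single (x : M) (i : Fin fr.n) : fr.projDeriv A a x (Pi.single i 1) =
    fun j => A.anchorDeriv a (fun y => fr.coord j y (fr.sec i y)) x := by
  funext j
  rw [projDeriv, matrixCLM_apply, Finset.sum_eq_single i] <;> simp +contextual
  rfl

lemma bracketMat_eq (x : M) (y : Fin fr.n → ℝ) :
    fr.bracketMat A a x y =
      fr.bracketMat A a x (fr.proj x y) + fr.proj x (fr.projDeriv A a x y) := by
  have h : ∀ i, fr.bracketMat A a x (Pi.single i 1) =
      fr.bracketMat A a x (fr.proj x (Pi.single i 1)) +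
        fr.proj x (fr.projDeriv A a x (Pi.single i 1)) := by
    intro i
    have h1 := fr.anal_bracket A a (fr.sec i) x
    have h2 : fr.bracketMat A a x (Pi.single i 1) = fr.anal x (A.bracket a (fr.sec i) x) := by
      rw [bracketMat_apply, Finset.sum_eq_single i] <;> simp +contextual
    rw [h2, fr.projDeriv_single A a x i, h1, proj_single]
  have h4 : fr.bracketMat A a x = (fr.bracketMat A a x).comp (fr.proj x) +
      (fr.proj x).comp (fr.projDeriv A a x) := by
    refine ContinuousLinearMap.coe_injective (LinearMap.pi_ext' fun i => LinearMap.ext_ring ?_)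
    exact h i
  exact congrArg (· y) h4

/-- The derivative of the coordinates of a section. -/
lemma anchorDeriv_anal (b : Cₛ^∞⟮I; F, V⟯) (x : M) :
    (fun j => A.anchorDeriv a (fun y => fr.coord j y (b y)) x) =
      fr.projDeriv A a x (fr.anal x (b x)) +
        fr.proj x (fun j => A.anchorDeriv a (fun y => fr.coord j y (b y)) x) := by
  funext k
  have h1 : (fun y => fr.coord k y (b y)) = fun y => ∑ i, fr.pmat k i y * fr.coord i y (b y) := by
    funext y
    rw [← fr.anal_apply, ← fr.proj_anal, proj_apply, anal_synth_apply]
    rfl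
  have hb := fun i => fr.contMDiff_coord_section b i
  conv_lhs => rw [h1]
  rw [A.anchorDeriv_sum a Finset.univ (f := fun i y => fr.pmat k i y * fr.coord i y (b y))
    fun i => (fr.contMDiff_pmat k i).mul (hb i)]
  rw [Pi.add_apply, projDeriv, matrixCLM_apply, proj_eq, matrixCLM_apply, ← Finset.sum_add_distrib]
  refine Finset.sum_congr rfl fun i _ => ?_
  rw [A.anchorDeriv_mul a ((fr.contMDiff_pmat k i).mdifferentiableAt (by simp))
    ((hb i).mdifferentiableAt (by simp)), add_comm]
  rfl

lemma projDeriv_eq (x : M) (y : Fin fr.n → ℝ) :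
    fr.projDeriv A a x y =
      fr.projDeriv A a x (fr.proj x y) + fr.proj x (fr.projDeriv A a x y) := by
  have h : ∀ i, fr.projDeriv A a x (Pi.single i 1) =
      fr.projDeriv A a x (fr.proj x (Pi.single i 1)) +
        fr.proj x (fr.projDeriv A a x (Pi.single i 1)) := by
    intro i
    rw [projDeriv_single, proj_single]
    exact fr.anchorDeriv_anal A a (fr.sec i) x
  have h4 : fr.projDeriv A a x = (fr.projDeriv A a x).comp (fr.proj x) +
      (fr.proj x).comp (fr.projDeriv A a x) := by
    refine ContinuousLinearMap.coe_injective (LinearMap.pi_ext' fun i => LinearMap.ext_ring ?_)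
    exact h i
  exact congrArg (· y) h4

lemma synth_projDeriv (x : M) (y : Fin fr.n → ℝ) (hy : fr.proj x y = y) :
    fr.synth x (fr.projDeriv A a x y) = 0 := by
  have h := fr.projDeriv_eq A a x y
  rw [hy] at h
  have h0 := congrArg (fr.synth x) (left_eq_add.1 h)
  simpa using h0

lemma proj_projDeriv_proj (x : M) (y : Fin fr.n → ℝ) :
    fr.proj x (fr.projDeriv A a x (fr.proj x y)) = 0 := by
  rw [proj_apply, fr.synth_projDeriv A a x _ (by rw [proj_apply, synth_proj]; rfl), map_zero]

/-- The generator intertwines the projections. -/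
lemma projDeriv_add_proj_generator (x : M) (y : Fin fr.n → ℝ) :
    fr.projDeriv A a x y + fr.proj x (fr.generator A a x y) =
      fr.generator A a x (fr.proj x y) := by
  have hpp : fr.proj x (fr.proj x y) = fr.proj x y := by rw [proj_apply, synth_proj]; rfl
  simp only [generator, sub_apply, ContinuousLinearMap.comp_apply, map_sub, proj_projDeriv_proj,
    proj_bracketMat, hpp]
  have h1 := fr.bracketMat_eq A a x y
  have h2 := fr.projDeriv_eq A a x y
  rw [h1]
  nth_rewrite 1 [h2]
  abel

lemma synth_generator (x : M) (y : Fin fr.n → ℝ) (hy : fr.proj x y = y) :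
    fr.synth x (fr.generator A a x y) = -∑ i, y i • A.bracket a (fr.sec i) x := by
  simp only [generator, sub_apply, ContinuousLinearMap.comp_apply, map_sub, hy,
    fr.synth_projDeriv A a x y hy, bracketMat_apply, synth_anal, zero_sub]

lemma anchorDeriv_anal_sub_generator (b : Cₛ^∞⟮I; F, V⟯) (x : M) :
    (fun j => A.anchorDeriv a (fun y => fr.coord j y (b y)) x) -
      fr.generator A a x (fr.anal x (b x)) = fr.anal x (A.bracket a b x) := by
  rw [fr.anal_bracket A a b x]
  nth_rewrite 1 [fr.anchorDeriv_anal A a b x]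
  simp only [generator, sub_apply, ContinuousLinearMap.comp_apply, proj_anal]
  abel

variable {fr A}

lemma SmoothSections.contMDiff_projDeriv {a : ℝ → Cₛ^∞⟮I; F, V⟯} (ha : fr.SmoothSections a) :
    ContMDiff (𝓘(ℝ, ℝ).prod I) 𝓘(ℝ, (Fin fr.n → ℝ) →L[ℝ] (Fin fr.n → ℝ)) ∞
      (fun p : ℝ × M => fr.projDeriv A (a p.1) p.2) :=
  (matrixCLM fr.n).contDiff.contMDiff.comp (contMDiff_pi₂ fun k i =>
    ha.anchorDeriv A (SmoothFamily.of_slice (fr.contMDiff_pmat k i)))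

lemma SmoothSections.contMDiff_generator {a : ℝ → Cₛ^∞⟮I; F, V⟯} (ha : fr.SmoothSections a) :
    ContMDiff (𝓘(ℝ, ℝ).prod I) 𝓘(ℝ, (Fin fr.n → ℝ) →L[ℝ] (Fin fr.n → ℝ)) ∞
      (fun p : ℝ × M => fr.generator A (a p.1) p.2) :=
  ((ha.contMDiff_projDeriv).clm_comp (fr.contMDiff_proj.comp contMDiff_snd)).sub
    ((matrixCLM fr.n).contDiff.contMDiff.comp (contMDiff_pi₂ fun k i =>
      ha.bracket A (smoothSections_const (fr.sec i)) k))

end GlobalFrame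

/-- The flow of a time-dependent section `a` of a Lie algebroid: the flow `φ` of its anchor,
together with a lift `R` to coordinate vectors. -/
structure SectionFlow (A : LieAlgebroid I F V) (fr : GlobalFrame I F V)
    (a : ℝ → Cₛ^∞⟮I; F, V⟯) where
  /-- The flow on the base. -/
  φ : ℝ → M → M
  /-- The inverse of the flow on the base. -/
  ψ : ℝ → M → M
  /-- The lift to coordinate vectors. -/
  R : ℝ → M → (Fin fr.n → ℝ) →L[ℝ] (Fin fr.n → ℝ)
  contMDiff_φ : ContMDiff (𝓘(ℝ, ℝ).prod I) I ∞ (fun p : ℝ × M => φ p.1 p.2)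
  contMDiff_ψ : ContMDiff (𝓘(ℝ, ℝ).prod I) I ∞ (fun p : ℝ × M => ψ p.1 p.2)
  contMDiff_R : ContMDiff (𝓘(ℝ, ℝ).prod I) 𝓘(ℝ, (Fin fr.n → ℝ) →L[ℝ] (Fin fr.n → ℝ)) ∞
    (fun p : ℝ × M => R p.1 p.2)
  φ_zero : ∀ x, φ 0 x = x
  R_zero : ∀ x, R 0 x = ContinuousLinearMap.id ℝ _
  ψ_φ : ∀ s x, ψ s (φ s x) = x
  φ_ψ : ∀ s x, φ s (ψ s x) = x
  hasMFDerivAt_φ : ∀ s x, HasMFDerivAt 𝓘(ℝ, ℝ) I (fun t => φ t x) s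
    ((1 : ℝ →L[ℝ] ℝ).smulRight (A.anchor (φ s x) (a s (φ s x))))
  hasDerivAt_R : ∀ s x, HasDerivAt (fun t => R t x)
    ((fr.generator A (a s) (φ s x)).comp (R s x)) s

section Existence

variable [FiniteDimensional ℝ E] [I.Boundaryless] [T2Space M] [CompactSpace M]

theorem nonempty_sectionFlow (A : LieAlgebroid I F V) (fr : GlobalFrame I F V)
    {a : ℝ → Cₛ^∞⟮I; F, V⟯} (ha : fr.SmoothSections a) (h0 : ∀ s ∉ Icc (0 : ℝ) 1, ∀ x, a s x = 0) :
    Nonempty (SectionFlow A fr a) := by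
  have hsec : ContMDiff (𝓘(ℝ, ℝ).prod I) (I.prod 𝓘(ℝ, F)) ∞
      (fun p : ℝ × M => (⟨p.2, a p.1 p.2⟩ : TotalSpace F V)) := by
    have := fr.contMDiff_synth (b := fun p : ℝ × M => p.2) contMDiff_snd
      (y := fun p => fr.anal p.2 (a p.1 p.2)) ha
    simpa using this
  obtain ⟨φ, ψ, R, h1, h2, h3, h4, h5, h6, h7, h8, h9⟩ := exists_timeDependentFlow (I := I)
    (X := fun s x => A.anchor x (a s x)) (A.contMDiff_anchor_comp contMDiff_snd hsec)
    (fun s hs x => by rw [h0 s hs x, map_zero]) (L := fun s x => fr.generator A (a s) x)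
    ha.contMDiff_generator
  exact ⟨⟨φ, ψ, R, h1, h2, h3, h4, h5, h6, h7, h8, h9⟩⟩

end Existence

end SectionFlow

/-- The derivative of the inverse of a fundamental solution. -/
lemma HasDerivAt.clm_ringInverse {G : Type*} [NormedAddCommGroup G] [NormedSpace ℝ G]
    [CompleteSpace G] {R : ℝ → G →L[ℝ] G} {L : G →L[ℝ] G} {s : ℝ}
    (hR : HasDerivAt R (L.comp (R s)) s) (hu : IsUnit (R s)) :
    HasDerivAt (fun t => Ring.inverse (R t)) (-((Ring.inverse (R s)).comp L)) s := by
  obtain ⟨u, hu⟩ := hu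
  have h1 := hasFDerivAt_ringInverse (𝕜 := ℝ) u
  rw [hu] at h1
  refine (h1.comp_hasDerivAt s hR).congr_deriv ?_
  rw [← hu, Ring.inverse_unit]
  have h2 : (u : G →L[ℝ] G) * ↑u⁻¹ = 1 := u.mul_inv
  change -(↑u⁻¹ * (L * ↑u) * ↑u⁻¹) = -(↑u⁻¹ * L)
  rw [mul_assoc, mul_assoc, h2, mul_one]

lemma Continuous.comp_graph {X Y G : Type*} [TopologicalSpace X] [TopologicalSpace Y]
    [TopologicalSpace G] {f : X × Y → G} (hf : Continuous f) {c : X → Y} (hc : Continuous c) :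
    Continuous (fun s => f (s, c s)) :=
  hf.comp (continuous_id.prodMk hc)

section SectionFlowLift

set_option linter.unusedSectionVars false

variable {E : Type*} [NormedAddCommGroup E] [NormedSpace ℝ E]
  {H : Type*} [TopologicalSpace H] {I : ModelWithCorners ℝ E H}
  {M : Type*} [TopologicalSpace M] [ChartedSpace H M]
  {F : Type*} [NormedAddCommGroup F] [NormedSpace ℝ F]
  {V : M → Type*} [TopologicalSpace (TotalSpace F V)]
  [∀ x, AddCommGroup (V x)] [∀ x, Module ℝ (V x)] [∀ x, TopologicalSpace (V x)]
  [FiberBundle F V] [VectorBundle ℝ F V]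
  [IsManifold I ∞ M] [∀ x, IsTopologicalAddGroup (V x)] [∀ x, ContinuousSMul ℝ (V x)]
  {A : LieAlgebroid I F V} {fr : GlobalFrame I F V} {a : ℝ → Cₛ^∞⟮I; F, V⟯}

namespace SectionFlow

variable (Φ : SectionFlow A fr a)

lemma continuous_φ (x : M) : Continuous (fun s => Φ.φ s x) :=
  Φ.contMDiff_φ.continuous.comp (Continuous.prodMk_left x)

lemma contMDiff_φ_slice (s : ℝ) : ContMDiff I I ∞ (Φ.φ s) :=
  Φ.contMDiff_φ.comp (contMDiff_const.prodMk contMDiff_id)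

lemma continuous_generator (ha : fr.SmoothSections a) (x : M) :
    Continuous (fun s => fr.generator A (a s) (Φ.φ s x)) := by
  have h := (ha.contMDiff_generator (A := A)).continuous.comp_graph (Φ.continuous_φ x)
  exact h

lemma smoothFamily_comp {g : ℝ → M → ℝ} (hg : SmoothFamily I g) :
    SmoothFamily I (fun s x => g s (Φ.φ s x)) :=
  ContMDiff.comp (g := fun p : ℝ × M => g p.1 p.2) hg (contMDiff_fst.prodMk Φ.contMDiff_φ)

lemma hasDerivAt_comp {g : ℝ → M → ℝ} (hg : SmoothFamily I g) (s : ℝ) (x : M) :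
    HasDerivAt (fun t => g t (Φ.φ t x))
      (deriv (fun t => g t (Φ.φ s x)) s + A.anchorDeriv (a s) (g s) (Φ.φ s x)) s :=
  hg.hasDerivAt_comp (c := fun t => Φ.φ t x) (Φ.hasMFDerivAt_φ s x)

lemma hasDerivAt_comp_of_const {f : M → ℝ} (hf : ContMDiff I 𝓘(ℝ, ℝ) ∞ f) (s : ℝ) (x : M) :
    HasDerivAt (fun t => f (Φ.φ t x)) (A.anchorDeriv (a s) f (Φ.φ s x)) s := by
  simpa using Φ.hasDerivAt_comp (SmoothFamily.of_slice hf) s x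

lemma isUnit_R (ha : fr.SmoothSections a) (s : ℝ) (x : M) : IsUnit (Φ.R s x) :=
  isUnit_of_ker_eq_zero fun y hy => by
    have h := eq_zero_of_linear_ode (Φ.continuous_generator ha x) (y := fun t => Φ.R t x y)
      (fun t => by simpa using (Φ.hasDerivAt_R t x).clm_apply (hasDerivAt_const t y)) hy 0
    simpa [Φ.R_zero] using h

lemma proj_comp_R (ha : fr.SmoothSections a) (s : ℝ) (x : M) :
    (fr.proj (Φ.φ s x)).comp (Φ.R s x) = (Φ.R s x).comp (fr.proj x) := by
  have hP : ∀ t, HasDerivAt (fun t => fr.proj (Φ.φ t x)) (fr.projDeriv A (a t) (Φ.φ t x)) t := by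
    intro t
    simp_rw [fr.proj_eq]
    exact (matrixCLM fr.n).hasFDerivAt.comp_hasDerivAt t (hasDerivAt_pi.2 fun k =>
      hasDerivAt_pi.2 fun i => Φ.hasDerivAt_comp_of_const (fr.contMDiff_pmat k i) t x)
  let K : ℝ → (Fin fr.n → ℝ) →L[ℝ] (Fin fr.n → ℝ) := fun t =>
    (fr.proj (Φ.φ t x)).comp (Φ.R t x) - (Φ.R t x).comp (fr.proj x)
  have hK : ∀ t, HasDerivAt K
      (ContinuousLinearMap.compL ℝ _ _ _ (fr.generator A (a t) (Φ.φ t x)) (K t)) t := by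
    intro t
    refine (((hP t).clm_comp (Φ.hasDerivAt_R t x)).sub
      ((Φ.hasDerivAt_R t x).clm_comp (hasDerivAt_const t (fr.proj x)))).congr_deriv ?_
    ext1 y
    have := fr.projDeriv_add_proj_generator A (a t) (Φ.φ t x) (Φ.R t x y)
    simp [K, ← this]
  have h := eq_zero_of_linear_ode
    ((ContinuousLinearMap.compL ℝ _ _ _).continuous.comp (Φ.continuous_generator ha x)) hK
    (t₀ := 0) (by ext1 y; simp [K, Φ.R_zero, Φ.φ_zero]) s
  exact sub_eq_zero.1 h

lemma proj_R (ha : fr.SmoothSections a) (s : ℝ) (x : M) (y : Fin fr.n → ℝ) :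
    fr.proj (Φ.φ s x) (Φ.R s x y) = Φ.R s x (fr.proj x y) :=
  congrArg (· y) (Φ.proj_comp_R ha s x)

/-- The inverse of the lift. -/
def S (s : ℝ) (x : M) : (Fin fr.n → ℝ) →L[ℝ] (Fin fr.n → ℝ) := Ring.inverse (Φ.R s x)

lemma S_R (ha : fr.SmoothSections a) (s : ℝ) (x : M) (y : Fin fr.n → ℝ) :
    Φ.S s x (Φ.R s x y) = y :=
  congrArg (· y) (Ring.inverse_mul_cancel _ (Φ.isUnit_R ha s x))

lemma R_S (ha : fr.SmoothSections a) (s : ℝ) (x : M) (y : Fin fr.n → ℝ) :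
    Φ.R s x (Φ.S s x y) = y :=
  congrArg (· y) (Ring.mul_inverse_cancel _ (Φ.isUnit_R ha s x))

lemma proj_S (ha : fr.SmoothSections a) (s : ℝ) (x : M) (y : Fin fr.n → ℝ) :
    fr.proj x (Φ.S s x y) = Φ.S s x (fr.proj (Φ.φ s x) y) := by
  rw [← Φ.S_R ha s x (fr.proj x (Φ.S s x y)), ← Φ.proj_R ha, Φ.R_S ha]

lemma contMDiff_S (ha : fr.SmoothSections a) :
    ContMDiff (𝓘(ℝ, ℝ).prod I) 𝓘(ℝ, (Fin fr.n → ℝ) →L[ℝ] (Fin fr.n → ℝ)) ∞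
      (fun p : ℝ × M => Φ.S p.1 p.2) :=
  Φ.contMDiff_R.clm_ringInverse fun p => Φ.isUnit_R ha p.1 p.2

lemma hasDerivAt_S (ha : fr.SmoothSections a) (s : ℝ) (x : M) :
    HasDerivAt (fun t => Φ.S t x) (-((Φ.S s x).comp (fr.generator A (a s) (Φ.φ s x)))) s :=
  (Φ.hasDerivAt_R s x).clm_ringInverse (Φ.isUnit_R ha s x)

/-- The lift of the flow to the fibres. -/
def fib (s : ℝ) (x : M) : V x →L[ℝ] V (Φ.φ s x) :=
  (fr.synth (Φ.φ s x)).comp ((Φ.R s x).comp (fr.anal x))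

/-- The inverse of the lift of the flow to the fibres. -/
def fibInv (s : ℝ) (x : M) : V (Φ.φ s x) →L[ℝ] V x :=
  (fr.synth x).comp ((Φ.S s x).comp (fr.anal (Φ.φ s x)))

lemma fib_apply (s : ℝ) (x : M) (v : V x) :
    Φ.fib s x v = fr.synth (Φ.φ s x) (Φ.R s x (fr.anal x v)) := rfl

lemma fibInv_apply (s : ℝ) (x : M) (w : V (Φ.φ s x)) :
    Φ.fibInv s x w = fr.synth x (Φ.S s x (fr.anal (Φ.φ s x) w)) := rfl

lemma proj_R_anal (ha : fr.SmoothSections a) (s : ℝ) (x : M) (v : V x) :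
    fr.proj (Φ.φ s x) (Φ.R s x (fr.anal x v)) = Φ.R s x (fr.anal x v) := by
  rw [Φ.proj_R ha, fr.proj_anal]

lemma anal_fib (ha : fr.SmoothSections a) (s : ℝ) (x : M) (v : V x) :
    fr.anal (Φ.φ s x) (Φ.fib s x v) = Φ.R s x (fr.anal x v) :=
  Φ.proj_R_anal ha s x v

lemma anal_fibInv (ha : fr.SmoothSections a) (s : ℝ) (x : M) (w : V (Φ.φ s x)) :
    fr.anal x (Φ.fibInv s x w) = Φ.S s x (fr.anal (Φ.φ s x) w) := by
  rw [fibInv_apply, ← fr.proj_apply, Φ.proj_S ha, fr.proj_anal]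

lemma fibInv_fib (ha : fr.SmoothSections a) (s : ℝ) (x : M) (v : V x) :
    Φ.fibInv s x (Φ.fib s x v) = v := by
  rw [fibInv_apply, Φ.anal_fib ha, Φ.S_R ha, fr.synth_anal]

lemma fib_fibInv (ha : fr.SmoothSections a) (s : ℝ) (x : M) (w : V (Φ.φ s x)) :
    Φ.fib s x (Φ.fibInv s x w) = w := by
  rw [fib_apply, Φ.anal_fibInv ha, Φ.R_S ha, fr.synth_anal]

lemma hasDerivAt_R_apply (s : ℝ) (x : M) (y : Fin fr.n → ℝ) (i : Fin fr.n) :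
    HasDerivAt (fun t => Φ.R t x y i) (fr.generator A (a s) (Φ.φ s x) (Φ.R s x y) i) s := by
  have := (Φ.hasDerivAt_R s x).clm_apply (hasDerivAt_const s y)
  simpa using hasDerivAt_pi.1 this i

/-- The derivative of a one-form along the lifted flow. -/
lemma hasDerivAt_oneForm (ha : fr.SmoothSections a) {θ : ℝ → ∀ x, V x →L[ℝ] ℝ}
    (hθ : ∀ i, SmoothFamily I (fun s x => θ s x (fr.sec i x))) (s : ℝ) (x : M) (v : V x) :
    HasDerivAt (fun t => θ t (Φ.φ t x) (Φ.fib t x v))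
      (∑ i, Φ.R s x (fr.anal x v) i * (deriv (fun t => θ t (Φ.φ s x) (fr.sec i (Φ.φ s x))) s +
        A.anchorDeriv (a s) (fun y => θ s y (fr.sec i y)) (Φ.φ s x) -
        θ s (Φ.φ s x) (A.bracket (a s) (fr.sec i) (Φ.φ s x)))) s := by
  have h0 : (fun t => θ t (Φ.φ t x) (Φ.fib t x v)) = fun t =>
      ∑ i, Φ.R t x (fr.anal x v) i * θ t (Φ.φ t x) (fr.sec i (Φ.φ t x)) := by
    funext t
    simp [fib_apply, GlobalFrame.synth_apply]
  rw [h0]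
  refine (HasDerivAt.fun_sum fun i _ => (Φ.hasDerivAt_R_apply s x (fr.anal x v) i).mul
    (Φ.hasDerivAt_comp (hθ i) s x)).congr_deriv ?_
  have h1 := congrArg (θ s (Φ.φ s x)) (fr.synth_generator A (a s) (Φ.φ s x) _
    (Φ.proj_R_anal ha s x v))
  simp only [GlobalFrame.synth_apply, map_sum, map_neg, map_smul, smul_eq_mul] at h1
  rw [Finset.sum_add_distrib, h1, ← Finset.sum_neg_distrib, ← Finset.sum_add_distrib]
  exact Finset.sum_congr rfl fun i _ => by ring

/-- The derivative of a bilinear form along the lifted flow. -/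
lemma hasDerivAt_twoForm (ha : fr.SmoothSections a) {η : ℝ → ∀ x, V x →L[ℝ] V x →L[ℝ] ℝ}
    (hη : ∀ i j, SmoothFamily I (fun s x => η s x (fr.sec i x) (fr.sec j x))) (s : ℝ) (x : M)
    (v w : V x) :
    HasDerivAt (fun t => η t (Φ.φ t x) (Φ.fib t x v) (Φ.fib t x w))
      (∑ i, ∑ j, Φ.R s x (fr.anal x v) i * Φ.R s x (fr.anal x w) j *
        (deriv (fun t => η t (Φ.φ s x) (fr.sec i (Φ.φ s x)) (fr.sec j (Φ.φ s x))) s +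
        A.anchorDeriv (a s) (fun y => η s y (fr.sec i y) (fr.sec j y)) (Φ.φ s x) -
        η s (Φ.φ s x) (A.bracket (a s) (fr.sec i) (Φ.φ s x)) (fr.sec j (Φ.φ s x)) -
        η s (Φ.φ s x) (fr.sec i (Φ.φ s x)) (A.bracket (a s) (fr.sec j) (Φ.φ s x)))) s := by
  have h0 : (fun t => η t (Φ.φ t x) (Φ.fib t x v) (Φ.fib t x w)) = fun t =>
      ∑ i, ∑ j, Φ.R t x (fr.anal x v) i * Φ.R t x (fr.anal x w) j *
        η t (Φ.φ t x) (fr.sec i (Φ.φ t x)) (fr.sec j (Φ.φ t x)) := by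
    funext t
    simp only [fib_apply, GlobalFrame.synth_apply, map_sum, map_smul, sum_apply, smul_apply,
      smul_eq_mul, Finset.mul_sum]
    rw [Finset.sum_comm]
    exact Finset.sum_congr rfl fun i _ => Finset.sum_congr rfl fun j _ => by ring
  rw [h0]
  refine (HasDerivAt.fun_sum fun i _ => HasDerivAt.fun_sum fun j _ =>
    ((Φ.hasDerivAt_R_apply s x (fr.anal x v) i).mul
      (Φ.hasDerivAt_R_apply s x (fr.anal x w) j)).mul
    (Φ.hasDerivAt_comp (hη i j) s x)).congr_deriv ?_
  set p := Φ.φ s x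
  set y := Φ.R s x (fr.anal x v)
  set z := Φ.R s x (fr.anal x w)
  have h1 : ∑ i, ∑ j, fr.generator A (a s) p y i * z j * η s p (fr.sec i p) (fr.sec j p) =
      ∑ i, ∑ j, y i * z j * -η s p (A.bracket (a s) (fr.sec i) p) (fr.sec j p) := by
    rw [Finset.sum_comm]
    conv_rhs => rw [Finset.sum_comm]
    refine Finset.sum_congr rfl fun j _ => ?_
    have h := congrArg (fun u => z j * η s p u (fr.sec j p))
      (fr.synth_generator A (a s) p _ (Φ.proj_R_anal ha s x v))
    simp only [GlobalFrame.synth_apply, map_sum, map_neg, map_smul, sum_apply, smul_apply,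
      neg_apply, smul_eq_mul, Finset.mul_sum, ← Finset.sum_neg_distrib] at h
    refine Eq.trans (Finset.sum_congr rfl fun i _ => ?_)
      (h.trans (Finset.sum_congr rfl fun i _ => ?_)) <;> ring
  have h2 : ∑ i, ∑ j, y i * fr.generator A (a s) p z j * η s p (fr.sec i p) (fr.sec j p) =
      ∑ i, ∑ j, y i * z j * -η s p (fr.sec i p) (A.bracket (a s) (fr.sec j) p) := by
    refine Finset.sum_congr rfl fun i _ => ?_
    have h := congrArg (fun u => y i * η s p (fr.sec i p) u)
      (fr.synth_generator A (a s) p _ (Φ.proj_R_anal ha s x w))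
    simp only [GlobalFrame.synth_apply, map_sum, map_neg, map_smul,
      smul_eq_mul, Finset.mul_sum, ← Finset.sum_neg_distrib] at h
    refine Eq.trans (Finset.sum_congr rfl fun i _ => ?_)
      (h.trans (Finset.sum_congr rfl fun i _ => ?_)) <;> ring
  simp only [Pi.mul_apply, add_mul, mul_sub, mul_add, Finset.sum_add_distrib,
    Finset.sum_sub_distrib]
  rw [h1, h2]
  simp only [mul_neg, Finset.sum_neg_distrib]
  ring

/-- The pull-back of a section along the lifted flow. -/
def pull (ha : fr.SmoothSections a) (s : ℝ) (b : Cₛ^∞⟮I; F, V⟯) : Cₛ^∞⟮I; F, V⟯ :=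
  ⟨fun x => Φ.fibInv s x (b (Φ.φ s x)), by
    refine fr.contMDiff_synth contMDiff_id (y := fun x => Φ.S s x (fr.anal _ (b (Φ.φ s x))))
      (contMDiff_pi_space.1 ?_)
    exact ((Φ.contMDiff_S ha).comp (contMDiff_const.prodMk contMDiff_id)).clm_apply
      (contMDiff_pi_space.2 fun i => (fr.contMDiff_coord_section b i).comp (Φ.contMDiff_φ_slice s))⟩

lemma pull_apply (ha : fr.SmoothSections a) (s : ℝ) (b : Cₛ^∞⟮I; F, V⟯) (x : M) :
    Φ.pull ha s b x = Φ.fibInv s x (b (Φ.φ s x)) := rfl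

lemma anal_pull (ha : fr.SmoothSections a) (s : ℝ) (b : Cₛ^∞⟮I; F, V⟯) (x : M) :
    fr.anal x (Φ.pull ha s b x) = Φ.S s x (fr.anal (Φ.φ s x) (b (Φ.φ s x))) :=
  Φ.anal_fibInv ha s x _

lemma smoothSections_pull (ha : fr.SmoothSections a) (b : Cₛ^∞⟮I; F, V⟯) :
    fr.SmoothSections (fun s => Φ.pull ha s b) := by
  have h : ContMDiff (𝓘(ℝ, ℝ).prod I) 𝓘(ℝ, Fin fr.n → ℝ) ∞
      (fun p : ℝ × M => fr.anal p.2 (Φ.pull ha p.1 b p.2)) := by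
    simp_rw [Φ.anal_pull ha]
    exact (Φ.contMDiff_S ha).clm_apply (contMDiff_pi_space.2 fun i =>
      (fr.contMDiff_coord_section b i).comp Φ.contMDiff_φ)
  exact fun i => contMDiff_pi_space.1 h i

lemma hasDerivAt_anal_pull (ha : fr.SmoothSections a) (b : Cₛ^∞⟮I; F, V⟯) (s : ℝ) (x : M) :
    HasDerivAt (fun t => fr.anal x (Φ.pull ha t b x))
      (fr.anal x (Φ.pull ha s (A.bracket (a s) b) x)) s := by
  simp_rw [Φ.anal_pull ha]
  have h1 : HasDerivAt (fun t => fr.anal (Φ.φ t x) (b (Φ.φ t x)))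
      (fun j => A.anchorDeriv (a s) (fun y => fr.coord j y (b y)) (Φ.φ s x)) s :=
    hasDerivAt_pi.2 fun j => Φ.hasDerivAt_comp_of_const (fr.contMDiff_coord_section b j) s x
  refine ((Φ.hasDerivAt_S ha s x).clm_apply h1).congr_deriv ?_
  rw [← fr.anchorDeriv_anal_sub_generator A (a s) b, map_sub]
  simp only [neg_apply, ContinuousLinearMap.comp_apply]
  abel

lemma hasSectionDeriv_pull (ha : fr.SmoothSections a) (b : Cₛ^∞⟮I; F, V⟯) :
    fr.HasSectionDeriv (fun s => Φ.pull ha s b) (fun s => Φ.pull ha s (A.bracket (a s) b)) :=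
  fun i s x => hasDerivAt_pi.1 (Φ.hasDerivAt_anal_pull ha b s x) i

end SectionFlow

end SectionFlowLift

section Coframe

variable {E : Type*} [NormedAddCommGroup E] [NormedSpace ℝ E] [FiniteDimensional ℝ E]
  {H : Type*} [TopologicalSpace H] (I : ModelWithCorners ℝ E H)
  (M : Type*) [TopologicalSpace M] [ChartedSpace H M] [IsManifold I ∞ M]
  [T2Space M] [CompactSpace M]

/-- On a compact manifold there are finitely many functions whose differentials generate the
cotangent bundle, with a smooth dual family of vector fields. -/
theorem exists_exact_coframe : ∃ (k : ℕ) (f : Fin k → M → ℝ) (Y : Fin k → ∀ x : M, TangentSpace I x),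
    (∀ j, ContMDiff I 𝓘(ℝ, ℝ) ∞ (f j)) ∧
    (∀ j, ContMDiff I I.tangent ∞ (fun x => (⟨x, Y j x⟩ : TangentBundle I M))) ∧
    ∀ x (u : TangentSpace I x), ∑ j, mvfderiv I (f j) x u • Y j x = u := by
  obtain ⟨k, e, he, -, hinj⟩ := exists_embedding_euclidean_of_compact (I := I) (M := M)
  obtain ⟨fr⟩ := nonempty_globalFrame I E (TangentSpace I : M → Type _)
  let f : Fin k → M → ℝ := fun j x => e x j
  have hf : ∀ j, ContMDiff I 𝓘(ℝ, ℝ) ∞ (f j) := fun j =>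
    (EuclideanSpace.proj (𝕜 := ℝ) j).contMDiff.comp he
  have hdf : ∀ j x (u : TangentSpace I x),
      mvfderiv I (f j) x u = EuclideanSpace.proj (𝕜 := ℝ) j
        (mfderiv I 𝓘(ℝ, EuclideanSpace ℝ (Fin k)) e x u) := by
    intro j x u
    have h1 := mfderiv_comp x ((EuclideanSpace.proj (𝕜 := ℝ) j).contMDiff.mdifferentiableAt
      (n := ∞) (by simp)) (he.mdifferentiableAt (by simp) (x := x))
    have h2 : mvfderiv I (f j) x u = mfderiv I 𝓘(ℝ, ℝ) (⇑(EuclideanSpace.proj (𝕜 := ℝ) j) ∘ e) x u :=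
      rfl
    rw [h2, h1, mfderiv_eq_fderiv, ContinuousLinearMap.fderiv]
    rfl
  let β : ∀ x : M, TangentSpace I x →L[ℝ] TangentSpace I x →L[ℝ] ℝ := fun x =>
    ∑ j, (mvfderiv I (f j) x).smulRight (mvfderiv I (f j) x)
  have hβ : ∀ x u w, β x u w = ∑ j, mvfderiv I (f j) x u * mvfderiv I (f j) x w := fun x u w => by
    simp [β, sum_apply]
  have hsm : ∀ j i, ContMDiff I 𝓘(ℝ, ℝ) ∞ (fun x => mvfderiv I (f j) x (fr.sec i x)) := fun j i =>
    ((SmoothFamily.of_slice (hf j)).mvfderiv_right (Y := fun _ x => fr.sec i x)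
      ((fr.sec i).contMDiff.comp contMDiff_snd)).slice 0
  have hnd : ∀ x u, (∀ w, β x u w = 0) → u = 0 := by
    intro x u h
    have h1 := h u
    rw [hβ, Finset.sum_eq_zero_iff_of_nonneg fun j _ => mul_self_nonneg _] at h1
    refine (injective_iff_map_eq_zero _).1 (hinj x) u ?_
    have h2 : ∀ j, EuclideanSpace.proj (𝕜 := ℝ) j
        (mfderiv I 𝓘(ℝ, EuclideanSpace ℝ (Fin k)) e x u) = 0 :=
      fun j => by
        rw [← hdf]
        exact mul_self_eq_zero.1 (h1 j (Finset.mem_univ j))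
    exact PiLp.ext h2
  have hsolve : ∀ l, ∃ y : M → Fin fr.n → ℝ, (∀ i, ContMDiff I 𝓘(ℝ, ℝ) ∞ (fun p => y p i)) ∧
      ∀ p w, β p (fr.synth p (y p)) w = mvfderiv I (f l) p w := fun l =>
    fr.exists_solve (b := id) contMDiff_id (β := β) (θ := fun x => mvfderiv I (f l) x)
      (fun i j => by
        simp_rw [hβ]
        exact ContMDiff.sum fun l _ => (hsm l i).mul (hsm l j))
      (fun i => hsm l i) hnd
  choose y hy hyβ using hsolve
  refine ⟨k, f, fun l x => fr.synth x (y l x), hf, fun l => fr.contMDiff_synth contMDiff_id (hy l),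
    fun x u => ?_⟩
  refine sub_eq_zero.1 (hnd x _ fun w => ?_)
  simp only [map_sub, map_sum, map_smul, sub_apply, sum_apply, smul_apply, smul_eq_mul, hyβ]
  rw [hβ, sub_self]

end Coframe

section SectionFlowCompatibility

set_option linter.unusedSectionVars false

variable {E : Type*} [NormedAddCommGroup E] [NormedSpace ℝ E] [FiniteDimensional ℝ E]
  {H : Type*} [TopologicalSpace H] {I : ModelWithCorners ℝ E H}
  {M : Type*} [TopologicalSpace M] [ChartedSpace H M]
  {F : Type*} [NormedAddCommGroup F] [NormedSpace ℝ F]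
  {V : M → Type*} [TopologicalSpace (TotalSpace F V)]
  [∀ x, AddCommGroup (V x)] [∀ x, Module ℝ (V x)] [∀ x, TopologicalSpace (V x)]
  [FiberBundle F V] [VectorBundle ℝ F V]
  [IsManifold I ∞ M] [∀ x, IsTopologicalAddGroup (V x)] [∀ x, ContinuousSMul ℝ (V x)]
  [I.Boundaryless] [T2Space M] [CompactSpace M]
  {A : LieAlgebroid I F V} {fr : GlobalFrame I F V} {a : ℝ → Cₛ^∞⟮I; F, V⟯}

namespace SectionFlow

variable (Φ : SectionFlow A fr a)

lemma mvfderiv_comp_φ {f : M → ℝ} (hf : ContMDiff I 𝓘(ℝ, ℝ) ∞ f) (s : ℝ) (x : M)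
    (u : TangentSpace I x) : mvfderiv I (fun y => f (Φ.φ s y)) x u =
      mvfderiv I f (Φ.φ s x) (mfderiv I I (Φ.φ s) x u) :=
  mvfderiv_comp_apply (f := Φ.φ s) (g := f) x (hf.mdifferentiableAt (by simp))
    ((Φ.contMDiff_φ_slice s).mdifferentiableAt (by simp)) u

/-- The lifted flow is compatible with the anchor. -/
theorem anchor_fib (ha : fr.SmoothSections a) (s : ℝ) (x : M) (v : V x) :
    A.anchor (Φ.φ s x) (Φ.fib s x v) = mfderiv I I (Φ.φ s) x (A.anchor x v) := by
  obtain ⟨k, f, Y, hf, hY, hfY⟩ := exists_exact_coframe I M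
  let δ : ∀ t, TangentSpace I (Φ.φ t x) := fun t =>
    A.anchor (Φ.φ t x) (Φ.fib t x v) - mfderiv I I (Φ.φ t) x (A.anchor x v)
  have hXf : ∀ j, SmoothFamily I (fun t => A.anchorDeriv (a t) (f j)) := fun j =>
    ha.anchorDeriv A (SmoothFamily.of_slice (hf j))
  have hq : ∀ t j, HasDerivAt (fun t => mvfderiv I (f j) (Φ.φ t x) (δ t))
      (mvfderiv I (A.anchorDeriv (a t) (f j)) (Φ.φ t x) (δ t)) t := by
    intro t j
    have h1 := Φ.hasDerivAt_oneForm ha (θ := fun _ y => (mvfderiv I (f j) y).comp (A.anchor y))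
      (fun i => A.smoothFamily_anchorDeriv (fr.sec i) (SmoothFamily.of_slice (hf j))) t x v
    have h2 := (Φ.smoothFamily_comp (SmoothFamily.of_slice (hf j))).hasDerivAt_mvfderiv t
      (A.anchor x v)
    have h3 : (fun y => deriv (fun t => f j (Φ.φ t y)) t) =
        fun y => A.anchorDeriv (a t) (f j) (Φ.φ t y) :=
      funext fun y => (Φ.hasDerivAt_comp_of_const (hf j) t y).deriv
    rw [h3, Φ.mvfderiv_comp_φ ((hXf j).slice t)] at h2
    have h4 : (fun t => mvfderiv I (f j) (Φ.φ t x) (δ t)) = fun t =>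
        mvfderiv I (f j) (Φ.φ t x) (A.anchor (Φ.φ t x) (Φ.fib t x v)) -
          mvfderiv I (fun y => f j (Φ.φ t y)) x (A.anchor x v) := by
      funext t
      rw [Φ.mvfderiv_comp_φ (hf j)]
      exact map_sub _ _ _
    rw [h4]
    refine (h1.sub h2).congr_deriv ?_
    simp only [δ, map_sub]
    congr 1
    simp only [deriv_const, zero_add, fib_apply, GlobalFrame.synth_apply, map_sum, map_smul,
      smul_eq_mul]
    refine Finset.sum_congr rfl fun i _ => ?_
    congr 1
    have h5 := A.anchorDeriv_bracket fr (a t) (fr.sec i) (hf j) (Φ.φ t x)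
    exact sub_eq_iff_eq_add.2 (sub_eq_iff_eq_add'.1 h5.symm) |>.trans rfl
  have hzero := eq_zero_of_linear_system
    (m := fun t j l => mvfderiv I (A.anchorDeriv (a t) (f j)) (Φ.φ t x) (Y l (Φ.φ t x)))
    (fun j l => ((hXf j).mvfderiv_right (Y := fun _ y => Y l y)
      ((hY l).comp contMDiff_snd)).continuous_comp (Φ.continuous_φ x))
    (z := fun t j => mvfderiv I (f j) (Φ.φ t x) (δ t)) (t₀ := 0) (fun t j => by
      refine (hq t j).congr_deriv ?_
      conv_lhs => rw [← hfY (Φ.φ t x) (δ t)]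
      simp [mul_comm]) (fun j => by
      have h1 : mvfderiv I (f j) (Φ.φ 0 x) (A.anchor (Φ.φ 0 x) (Φ.fib 0 x v)) =
          ∑ i, Φ.R 0 x (fr.anal x v) i * A.anchorDeriv (fr.sec i) (f j) (Φ.φ 0 x) := by
        simp [fib_apply, GlobalFrame.synth_apply, LieAlgebroid.anchorDeriv]
      have h2 : (fun y => f j (Φ.φ 0 y)) = f j := funext fun y => by rw [Φ.φ_zero]
      have h3 : mvfderiv I (f j) x (A.anchor x v) =
          ∑ i, fr.anal x v i * A.anchorDeriv (fr.sec i) (f j) x := by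
        conv_lhs => rw [← fr.synth_anal x v]
        simp [GlobalFrame.synth_apply, LieAlgebroid.anchorDeriv]
      simp only [δ, map_sub]
      rw [← Φ.mvfderiv_comp_φ (hf j), h2, sub_eq_zero, h1, h3, Φ.φ_zero, Φ.R_zero]
      rfl) s
  refine sub_eq_zero.1 ?_
  change δ s = 0
  rw [← hfY (Φ.φ s x) (δ s)]
  exact Finset.sum_eq_zero fun j _ => by rw [hzero j, zero_smul]

lemma anchorDeriv_pull (ha : fr.SmoothSections a) (s : ℝ) (b : Cₛ^∞⟮I; F, V⟯) {f : M → ℝ}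
    (hf : ContMDiff I 𝓘(ℝ, ℝ) ∞ f) (x : M) :
    A.anchorDeriv (Φ.pull ha s b) (fun y => f (Φ.φ s y)) x = A.anchorDeriv b f (Φ.φ s x) := by
  rw [LieAlgebroid.anchorDeriv, Φ.mvfderiv_comp_φ hf, ← Φ.anchor_fib ha, pull_apply, Φ.fib_fibInv ha]
  rfl

/-- A function precomposed with the flow. -/
def comp (s : ℝ) (f : C^∞⟮I, M; ℝ⟯) : C^∞⟮I, M; ℝ⟯ :=
  ⟨fun x => f (Φ.φ s x), f.contMDiff.comp (Φ.contMDiff_φ_slice s)⟩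

lemma pull_smoothSMul (ha : fr.SmoothSections a) (s : ℝ) (f : C^∞⟮I, M; ℝ⟯) (b : Cₛ^∞⟮I; F, V⟯) :
    Φ.pull ha s (smoothSMul I F V f b) = smoothSMul I F V (Φ.comp s f) (Φ.pull ha s b) := by
  ext x
  rw [pull_apply, smoothSMul_apply, map_smul]
  rfl

/-- The failure of the pull-back to commute with brackets. -/
def defect (ha : fr.SmoothSections a) (s : ℝ) (b c : Cₛ^∞⟮I; F, V⟯) : Cₛ^∞⟮I; F, V⟯ :=
  Φ.pull ha s (A.bracket b c) - A.bracket (Φ.pull ha s b) (Φ.pull ha s c)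

lemma pull_add (ha : fr.SmoothSections a) (s : ℝ) (b c : Cₛ^∞⟮I; F, V⟯) :
    Φ.pull ha s (b + c) = Φ.pull ha s b + Φ.pull ha s c := by
  ext x
  exact map_add (Φ.fibInv s x) _ _

lemma pull_neg (ha : fr.SmoothSections a) (s : ℝ) (b : Cₛ^∞⟮I; F, V⟯) :
    Φ.pull ha s (-b) = -Φ.pull ha s b := by
  ext x
  exact map_neg (Φ.fibInv s x) _

lemma pull_zero (ha : fr.SmoothSections a) (s : ℝ) : Φ.pull ha s 0 = 0 := by
  ext x
  exact map_zero (Φ.fibInv s x)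

lemma defect_antisymm (ha : fr.SmoothSections a) (s : ℝ) (b c : Cₛ^∞⟮I; F, V⟯) :
    Φ.defect ha s b c = -Φ.defect ha s c b := by
  rw [defect, defect, A.bracket_antisymm b c, A.bracket_antisymm (Φ.pull ha s b), pull_neg]
  abel

lemma defect_add_left (ha : fr.SmoothSections a) (s : ℝ) (b b' c : Cₛ^∞⟮I; F, V⟯) :
    Φ.defect ha s (b + b') c = Φ.defect ha s b c + Φ.defect ha s b' c := by
  simp only [defect, map_add, LinearMap.add_apply, pull_add]
  abel

lemma defect_smul_left (ha : fr.SmoothSections a) (s : ℝ) (f : C^∞⟮I, M; ℝ⟯)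
    (b c : Cₛ^∞⟮I; F, V⟯) (x : M) :
    Φ.defect ha s (smoothSMul I F V f b) c x = f (Φ.φ s x) • Φ.defect ha s b c x := by
  simp only [defect, ContMDiffSection.coe_sub, Pi.sub_apply, pull_smoothSMul, A.leibniz_left]
  have h := Φ.anchorDeriv_pull ha s c f.contMDiff x
  have h' : A.anchorDeriv (Φ.pull ha s c) (Φ.comp s f) x = A.anchorDeriv c f (Φ.φ s x) := h
  rw [h', pull_apply, A.leibniz_left, map_sub, map_smul, map_smul, ← pull_apply Φ ha,
    ← pull_apply Φ ha]
  change _ - (f (Φ.φ s x) • _ - _) = _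
  module

lemma defect_left_eq (ha : fr.SmoothSections a) (s : ℝ) (b c : Cₛ^∞⟮I; F, V⟯) (x : M) :
    Φ.defect ha s b c x =
      ∑ i, fr.coord i (Φ.φ s x) (b (Φ.φ s x)) • Φ.defect ha s (fr.sec i) c x := by
  let D : Cₛ^∞⟮I; F, V⟯ →+ V x :=
    { toFun := fun b => Φ.defect ha s b c x
      map_zero' := by
        simp only [defect, map_zero, LinearMap.zero_apply, pull_zero, sub_zero]
        rfl
      map_add' := fun b b' => by rw [defect_add_left]; rfl }
  change D b = _
  conv_lhs => rw [fr.eq_sum_smoothSMul b, map_sum]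
  exact Finset.sum_congr rfl fun i _ => Φ.defect_smul_left ha s (fr.coordFun b i) (fr.sec i) c x

lemma defect_right_eq (ha : fr.SmoothSections a) (s : ℝ) (b c : Cₛ^∞⟮I; F, V⟯) (x : M) :
    Φ.defect ha s b c x =
      ∑ i, fr.coord i (Φ.φ s x) (c (Φ.φ s x)) • Φ.defect ha s b (fr.sec i) x := by
  rw [defect_antisymm, ContMDiffSection.coe_neg, Pi.neg_apply, defect_left_eq,
    ← Finset.sum_neg_distrib]
  refine Finset.sum_congr rfl fun i _ => ?_
  rw [Φ.defect_antisymm ha s b, ContMDiffSection.coe_neg, Pi.neg_apply, smul_neg]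

lemma pull_time_zero (ha : fr.SmoothSections a) (b : Cₛ^∞⟮I; F, V⟯) :
    Φ.pull ha 0 b = b := by
  ext x
  rw [← fr.synth_anal x (Φ.pull ha 0 b x), ← fr.synth_anal x (b x), Φ.anal_pull ha, S, Φ.R_zero]
  have h1 : fr.anal (Φ.φ 0 x) (b (Φ.φ 0 x)) = fr.anal x (b x) := by rw [Φ.φ_zero]
  have h2 : Ring.inverse (ContinuousLinearMap.id ℝ (Fin fr.n → ℝ)) = 1 := Ring.inverse_one _
  rw [h1, h2]
  rfl

lemma hasDerivAt_coord_defect (ha : fr.SmoothSections a) (b c : Cₛ^∞⟮I; F, V⟯) (s : ℝ) (x : M)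
    (k : Fin fr.n) :
    HasDerivAt (fun t => fr.coord k x (Φ.defect ha t b c x))
      (fr.coord k x (Φ.defect ha s (A.bracket (a s) b) c x) +
        fr.coord k x (Φ.defect ha s b (A.bracket (a s) c) x)) s := by
  have h1 := Φ.hasSectionDeriv_pull ha (A.bracket b c) k s x
  have h2 := GlobalFrame.HasSectionDeriv.bracket A (Φ.smoothSections_pull ha b)
    (Φ.smoothSections_pull ha c) (Φ.hasSectionDeriv_pull ha b) (Φ.hasSectionDeriv_pull ha c) k s x
  have h3 : A.bracket (a s) (A.bracket b c) =
      A.bracket (A.bracket (a s) b) c + A.bracket b (A.bracket (a s) c) := by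
    rw [A.bracket_bracket (a s) b c]
    abel
  beta_reduce at h1 h2
  rw [h3, pull_add] at h1
  have h4 : ∀ t, fr.coord k x (Φ.defect ha t b c x) = fr.coord k x (Φ.pull ha t (A.bracket b c) x) -
      fr.coord k x (A.bracket (Φ.pull ha t b) (Φ.pull ha t c) x) := fun t => map_sub _ _ _
  simp_rw [h4]
  refine (h1.sub h2).congr_deriv ?_
  simp only [defect, ContMDiffSection.coe_sub, ContMDiffSection.coe_add, Pi.sub_apply,
    Pi.add_apply, map_sub, map_add]
  ring

/-- The pull-back along the lifted flow is compatible with brackets. -/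
theorem pull_bracket (ha : fr.SmoothSections a) (s : ℝ) (b c : Cₛ^∞⟮I; F, V⟯) :
    Φ.pull ha s (A.bracket b c) = A.bracket (Φ.pull ha s b) (Φ.pull ha s c) := by
  classical
  have hframe : ∀ x k (p : Fin fr.n × Fin fr.n),
      fr.coord k x (Φ.defect ha s (fr.sec p.1) (fr.sec p.2) x) = 0 := by
    intro x k p
    let Γ : ℝ → Fin fr.n → Fin fr.n → ℝ := fun t l i =>
      fr.coord l (Φ.φ t x) (A.bracket (a t) (fr.sec i) (Φ.φ t x))
    have hΓ : ∀ l i, Continuous fun t => Γ t l i := fun l i =>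
      (ha.bracket A (GlobalFrame.smoothSections_const (fr.sec i)) l).continuous_comp
        (Φ.continuous_φ x)
    refine eq_zero_of_linear_system (ι := Fin fr.n × Fin fr.n)
      (m := fun t p q => (if q.2 = p.2 then Γ t q.1 p.1 else 0) +
        (if q.1 = p.1 then Γ t q.2 p.2 else 0))
      (fun p q => ?_)
      (z := fun t p => fr.coord k x (Φ.defect ha t (fr.sec p.1) (fr.sec p.2) x)) (fun t p => ?_)
      (t₀ := 0) (fun p => ?_) s p
    · refine Continuous.add ?_ ?_ <;> split_ifs <;> first | exact hΓ _ _ | exact continuous_const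
    · refine (Φ.hasDerivAt_coord_defect ha (fr.sec p.1) (fr.sec p.2) t x k).congr_deriv ?_
      rw [Φ.defect_left_eq ha t (A.bracket (a t) (fr.sec p.1)),
        Φ.defect_right_eq ha t (fr.sec p.1) (A.bracket (a t) (fr.sec p.2))]
      simp only [map_sum, map_smul, smul_eq_mul, add_mul, Finset.sum_add_distrib,
        Fintype.sum_prod_type, ite_mul, zero_mul]
      congr 1
      · simp [Γ]
      · rw [Finset.sum_comm]
        simp [Γ]
    · rw [defect]
      simp only [pull_time_zero, sub_self]
      exact map_zero (fr.coord k x)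
  refine sub_eq_zero.1 ?_
  ext x
  change Φ.defect ha s b c x = 0
  rw [defect_left_eq]
  refine Finset.sum_eq_zero fun i _ => ?_
  rw [defect_right_eq, Finset.sum_eq_zero, smul_zero]
  intro j _
  rw [← fr.synth_anal x (Φ.defect ha s (fr.sec i) (fr.sec j) x)]
  have : fr.anal x (Φ.defect ha s (fr.sec i) (fr.sec j) x) = 0 := funext fun k => hframe x k (i, j)
  rw [this, map_zero, smul_zero]

end SectionFlow

end SectionFlowCompatibility

section SectionFlowAut

set_option linter.unusedSectionVars false

variable {E : Type*} [NormedAddCommGroup E] [NormedSpace ℝ E] [FiniteDimensional ℝ E]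
  {H : Type*} [TopologicalSpace H] {I : ModelWithCorners ℝ E H}
  {M : Type*} [TopologicalSpace M] [ChartedSpace H M]
  {F : Type*} [NormedAddCommGroup F] [NormedSpace ℝ F]
  {V : M → Type*} [TopologicalSpace (TotalSpace F V)]
  [∀ x, AddCommGroup (V x)] [∀ x, Module ℝ (V x)] [∀ x, TopologicalSpace (V x)]
  [FiberBundle F V] [VectorBundle ℝ F V]
  [IsManifold I ∞ M] [∀ x, IsTopologicalAddGroup (V x)] [∀ x, ContinuousSMul ℝ (V x)]
  [I.Boundaryless] [T2Space M] [CompactSpace M]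
  {A : LieAlgebroid I F V} {fr : GlobalFrame I F V} {a : ℝ → Cₛ^∞⟮I; F, V⟯}

namespace SectionFlow

variable (Φ : SectionFlow A fr a)

lemma contMDiff_anal (fr : GlobalFrame I F V) : ContMDiff (I.prod 𝓘(ℝ, F)) 𝓘(ℝ, Fin fr.n → ℝ) ∞
    (fun p : TotalSpace F V => fr.anal p.1 p.2) :=
  contMDiff_pi_space.2 fr.contMDiff_coord

variable [ContMDiffVectorBundle ∞ F V I]

lemma contMDiff_total :
    ContMDiff (𝓘(ℝ, ℝ).prod (I.prod 𝓘(ℝ, F))) (I.prod 𝓘(ℝ, F)) ∞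
      (fun p : ℝ × TotalSpace F V =>
        (⟨Φ.φ p.1 p.2.1, Φ.fib p.1 p.2.1 p.2.2⟩ : TotalSpace F V)) := by
  have hbase : ContMDiff (𝓘(ℝ, ℝ).prod (I.prod 𝓘(ℝ, F))) (𝓘(ℝ, ℝ).prod I) ∞
      (fun p : ℝ × TotalSpace F V => (p.1, p.2.1)) :=
    contMDiff_fst.prodMk ((contMDiff_proj V).comp contMDiff_snd)
  refine fr.contMDiff_synth (b := fun p : ℝ × TotalSpace F V => Φ.φ p.1 p.2.1)
    (Φ.contMDiff_φ.comp hbase) (y := fun p => Φ.R p.1 p.2.1 (fr.anal p.2.1 p.2.2))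
    (contMDiff_pi_space.1 ?_)
  exact (Φ.contMDiff_R.comp hbase).clm_apply ((contMDiff_anal fr).comp contMDiff_snd)

lemma contMDiff_totalInv (ha : fr.SmoothSections a) (s : ℝ) :
    ContMDiff (I.prod 𝓘(ℝ, F)) (I.prod 𝓘(ℝ, F)) ∞ (fun p : TotalSpace F V =>
      (⟨Φ.ψ s p.1, fr.synth (Φ.ψ s p.1) (Φ.S s (Φ.ψ s p.1) (fr.anal p.1 p.2))⟩ :
        TotalSpace F V)) := by
  have hbase : ContMDiff (I.prod 𝓘(ℝ, F)) I ∞ (fun p : TotalSpace F V => Φ.ψ s p.1) :=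
    Φ.contMDiff_ψ.comp (contMDiff_const.prodMk (contMDiff_proj V))
  refine fr.contMDiff_synth hbase
    (y := fun p => Φ.S s (Φ.ψ s p.1) (fr.anal p.1 p.2)) (contMDiff_pi_space.1 ?_)
  exact ((Φ.contMDiff_S ha).comp (contMDiff_const.prodMk hbase)).clm_apply (contMDiff_anal fr)

/-- The time-`s` map of the flow of a time-dependent section, as a Lie algebroid automorphism. -/
def aut (ha : fr.SmoothSections a) (s : ℝ) : A.Aut where
  total :=
    { toFun := fun p => ⟨Φ.φ s p.1, Φ.fib s p.1 p.2⟩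
      invFun := fun p => ⟨Φ.ψ s p.1, fr.synth (Φ.ψ s p.1) (Φ.S s (Φ.ψ s p.1) (fr.anal p.1 p.2))⟩
      left_inv := by
        rintro ⟨x, v⟩
        have h : ∀ x', x' = x → (⟨x', fr.synth x' (Φ.S s x' (fr.anal (Φ.φ s x) (Φ.fib s x v)))⟩ :
            TotalSpace F V) = ⟨x, v⟩ := by
          rintro _ rfl
          exact congrArg _ (Φ.fibInv_fib ha s _ v)
        exact h _ (Φ.ψ_φ s x)
      right_inv := by
        rintro ⟨y, w⟩
        have h : ∀ x, Φ.φ s x = y → (⟨Φ.φ s x, Φ.fib s x (fr.synth x (Φ.S s x (fr.anal y w)))⟩ :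
            TotalSpace F V) = ⟨y, w⟩ := by
          rintro x rfl
          exact congrArg _ (Φ.fib_fibInv ha s x w)
        exact h _ (Φ.φ_ψ s y)
      contMDiff_toFun := Φ.contMDiff_total.comp (contMDiff_const.prodMk contMDiff_id)
      contMDiff_invFun := Φ.contMDiff_totalInv ha s }
  base :=
    { toFun := Φ.φ s
      invFun := Φ.ψ s
      left_inv := Φ.ψ_φ s
      right_inv := Φ.φ_ψ s
      contMDiff_toFun := Φ.contMDiff_φ_slice s
      contMDiff_invFun := Φ.contMDiff_ψ.comp (contMDiff_const.prodMk contMDiff_id) }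
  fiber x := ContinuousLinearEquiv.equivOfInverse (Φ.fib s x) (Φ.fibInv s x)
    (Φ.fibInv_fib ha s x) (Φ.fib_fibInv ha s x)
  total_mk _ _ := rfl
  map_anchor x v := Φ.anchor_fib ha s x v
  map_bracket b c b' c' hb hc x := by
    have h : ∀ d d' : Cₛ^∞⟮I; F, V⟯, (∀ x, d' (Φ.φ s x) = Φ.fib s x (d x)) →
        Φ.pull ha s d' = d := fun d d' hd => by
      ext x
      rw [pull_apply, hd, Φ.fibInv_fib ha]
    have h1 := Φ.pull_bracket ha s b' c'
    rw [h b b' hb, h c c' hc] at h1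
    have h2 := congrArg (fun d : Cₛ^∞⟮I; F, V⟯ => Φ.fib s x (d x)) h1
    simp only [pull_apply, Φ.fib_fibInv ha] at h2
    exact h2

lemma fib_zero (x : M) (v : V x) :
    (⟨Φ.φ 0 x, Φ.fib 0 x v⟩ : TotalSpace F V) = ⟨x, v⟩ := by
  have h : ∀ x', x' = x → (⟨x', fr.synth x' (fr.anal x v)⟩ : TotalSpace F V) = ⟨x, v⟩ := by
    rintro _ rfl
    rw [fr.synth_anal]
  rw [fib_apply, Φ.R_zero]
  exact h _ (Φ.φ_zero x)

lemma isotopicToId_aut (ha : fr.SmoothSections a) : (Φ.aut ha 1).IsotopicToId :=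
  ⟨Φ.aut ha, Φ.contMDiff_total.contMDiffOn, fun p => Φ.fib_zero p.1 p.2, fun _ => rfl⟩

/-- If the derivative of a family of two-forms along the flow of `a` vanishes, the time-one map
pulls back the final form to the initial one. -/
theorem pullback_aut (ha : fr.SmoothSections a) {η : ℝ → ∀ x, V x →L[ℝ] V x →L[ℝ] ℝ}
    (hη : ∀ i j, SmoothFamily I (fun s x => η s x (fr.sec i x) (fr.sec j x)))
    (h : ∀ s x i j, deriv (fun t => η t x (fr.sec i x) (fr.sec j x)) s +
        A.anchorDeriv (a s) (fun y => η s y (fr.sec i y) (fr.sec j y)) x -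
        η s x (A.bracket (a s) (fr.sec i) x) (fr.sec j x) -
        η s x (fr.sec i x) (A.bracket (a s) (fr.sec j) x) = 0) (x : M) (v w : V x) :
    (Φ.aut ha 1).pullback (η 1) x v w = η 0 x v w := by
  have hd : ∀ s, HasDerivAt (fun t => η t (Φ.φ t x) (Φ.fib t x v) (Φ.fib t x w)) 0 s := fun s => by
    refine (Φ.hasDerivAt_twoForm ha hη s x v w).congr_deriv ?_
    exact Finset.sum_eq_zero fun i _ => Finset.sum_eq_zero fun j _ => by rw [h, mul_zero]
  have h1 := is_const_of_deriv_eq_zero (fun s => (hd s).differentiableAt) (fun s => (hd s).deriv) 1 0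
  refine Eq.trans h1 ?_
  have h2 : ∀ x', x' = x → η 0 x' (fr.synth x' (fr.anal x v)) (fr.synth x' (fr.anal x w)) =
      η 0 x v w := by
    rintro _ rfl
    rw [fr.synth_anal, fr.synth_anal]
  simp only [fib_apply, Φ.R_zero]
  exact h2 _ (Φ.φ_zero x)

end SectionFlow

end SectionFlowAut

section Moser

set_option linter.unusedSectionVars false

variable {E : Type*} [NormedAddCommGroup E] [NormedSpace ℝ E]
  {H : Type*} [TopologicalSpace H] {I : ModelWithCorners ℝ E H}
  {M : Type*} [TopologicalSpace M] [ChartedSpace H M]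
  {F : Type*} [NormedAddCommGroup F] [NormedSpace ℝ F]
  {V : M → Type*} [TopologicalSpace (TotalSpace F V)]
  [∀ x, AddCommGroup (V x)] [∀ x, Module ℝ (V x)] [∀ x, TopologicalSpace (V x)]
  [FiberBundle F V] [VectorBundle ℝ F V]
  [∀ x, IsTopologicalAddGroup (V x)] [∀ x, ContinuousSMul ℝ (V x)]

lemma contMDiff_reparam {τ : ℝ → ℝ} (hτ : ContDiff ℝ ∞ τ) :
    ContMDiff (𝓘(ℝ, ℝ).prod I) (𝓘(ℝ, ℝ).prod I) ∞ (fun p : ℝ × M => (τ p.1, p.2)) :=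
  (hτ.contMDiff.comp contMDiff_fst).prodMk contMDiff_snd

lemma LieAlgebroid.IsSmoothFamilyTwo.smoothFamily {η : ℝ → ∀ x : M, V x →L[ℝ] V x →L[ℝ] ℝ}
    (hη : LieAlgebroid.IsSmoothFamilyTwo I F η) {τ : ℝ → ℝ} (hτ : ContDiff ℝ ∞ τ)
    (hτ' : ∀ s, τ s ∈ Icc (0 : ℝ) 1) (b c : Cₛ^∞⟮I; F, V⟯) :
    SmoothFamily I (fun s x => η (τ s) x (b x) (c x)) := by
  have h1 := ContMDiffOn.comp_contMDiff hη (contMDiff_reparam (I := I) (M := M) hτ)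
    fun p => ⟨hτ' p.1, mem_univ _⟩
  have h2 : ContMDiff (𝓘(ℝ, ℝ).prod I) (I.prod 𝓘(ℝ, ℝ)) ∞ (fun p : ℝ × M =>
      TotalSpace.mk' ℝ (E := Bundle.Trivial M ℝ) p.2 (η (τ p.1) p.2 (b p.2) (c p.2))) :=
    ContMDiff.clm_bundle_apply₂ (F₁ := F) (F₂ := F) h1 (b.contMDiff.comp contMDiff_snd)
      (c.contMDiff.comp contMDiff_snd)
  intro p
  have h3 := h2 p
  simp only [contMDiffAt_totalSpace] at h3
  exact h3.2

lemma LieAlgebroid.IsSmoothFamilyOne.smoothFamily {ξ : ℝ → ∀ x : M, V x →L[ℝ] ℝ}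
    (hξ : LieAlgebroid.IsSmoothFamilyOne I F ξ) {τ : ℝ → ℝ} (hτ : ContDiff ℝ ∞ τ)
    (hτ' : ∀ s, τ s ∈ Icc (0 : ℝ) 1) (b : Cₛ^∞⟮I; F, V⟯) :
    SmoothFamily I (fun s x => ξ (τ s) x (b x)) := by
  have h1 := ContMDiffOn.comp_contMDiff hξ (contMDiff_reparam (I := I) (M := M) hτ)
    fun p => ⟨hτ' p.1, mem_univ _⟩
  have h2 : ContMDiff (𝓘(ℝ, ℝ).prod I) (I.prod 𝓘(ℝ, ℝ)) ∞ (fun p : ℝ × M =>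
      TotalSpace.mk' ℝ (E := Bundle.Trivial M ℝ) p.2 (ξ (τ p.1) p.2 (b p.2))) :=
    ContMDiff.clm_bundle_apply (F₁ := F) h1 (b.contMDiff.comp contMDiff_snd)
  intro p
  have h3 := h2 p
  simp only [contMDiffAt_totalSpace] at h3
  exact h3.2

lemma deriv_smoothTransition_eq_zero {s : ℝ} (hs : s ∉ Icc (0 : ℝ) 1) :
    deriv Real.smoothTransition s = 0 := by
  rcases lt_or_ge s 0 with h | h
  · have : Real.smoothTransition =ᶠ[nhds s] fun _ => 0 := by
      filter_upwards [gt_mem_nhds h] with t ht using Real.smoothTransition.zero_of_nonpos ht.le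
    rw [this.deriv_eq, deriv_const]
  · have h1 : 1 < s := lt_of_not_ge fun h' => hs ⟨h, h'⟩
    have : Real.smoothTransition =ᶠ[nhds s] fun _ => 1 := by
      filter_upwards [lt_mem_nhds h1] with t ht using Real.smoothTransition.one_of_one_le ht.le
    rw [this.deriv_eq, deriv_const]

variable [IsManifold I ∞ M]

lemma LieAlgebroid.IsSymplectic.antisymm {A : LieAlgebroid I F V}
    {η : ∀ x, V x →L[ℝ] V x →L[ℝ] ℝ} (hη : A.IsSymplectic η) (x : M) (v w : V x) :
    η x v w = -η x w v := by
  have h := hη.alternating x (v + w)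
  simp only [map_add, add_apply, hη.alternating, zero_add, add_zero] at h
  linarith

/-- The infinitesimal Moser argument: if `Ω(a, ·) = c • ξ`, then the derivative of `Ω` along `a`
is `c • dξ`. -/
lemma LieAlgebroid.IsSymplectic.lieDerivative_eq {A : LieAlgebroid I F V}
    {η : ∀ x, V x →L[ℝ] V x →L[ℝ] ℝ} (hη : A.IsSymplectic η) {ξ : ∀ x, V x →L[ℝ] ℝ} {r : ℝ}
    {a b c : Cₛ^∞⟮I; F, V⟯} (ha : ∀ x v, η x (a x) v = r * ξ x v)
    (hb : ContMDiff I 𝓘(ℝ, ℝ) ∞ (fun x => ξ x (b x)))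
    (hc : ContMDiff I 𝓘(ℝ, ℝ) ∞ (fun x => ξ x (c x))) (x : M) :
    A.anchorDeriv a (fun y => η y (b y) (c y)) x - η x (A.bracket a b x) (c x) -
      η x (b x) (A.bracket a c x) = r * A.dOne ξ b c x := by
  have h := hη.closed a b c x
  have hmul : ∀ (d : Cₛ^∞⟮I; F, V⟯) (f : M → ℝ), ContMDiff I 𝓘(ℝ, ℝ) ∞ f →
      A.anchorDeriv d (fun y => r * f y) x = r * A.anchorDeriv d f x := by
    intro d f hf
    have h0 : A.anchorDeriv d (fun _ => r) x = 0 := by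
      simp [anchorDeriv, mvfderiv_const]
    rw [A.anchorDeriv_mul d mdifferentiableAt_const (hf.mdifferentiableAt (by simp)), h0, zero_mul,
      add_zero]
  simp only [dTwo, ha] at h
  rw [hmul b _ hc, hmul c _ hb, hη.antisymm x (A.bracket b c x), ha,
    hη.antisymm x (A.bracket a c x)] at h
  simp only [dOne]
  linarith

end Moser

end

theorem mainTheorem5
    {E : Type*} [NormedAddCommGroup E] [NormedSpace ℝ E] [FiniteDimensional ℝ E]
    {M : Type*} [TopologicalSpace M] [ChartedSpace E M] [IsManifold 𝓘(ℝ, E) ∞ M]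
    [T2Space M] [CompactSpace M]
    {F : Type*} [NormedAddCommGroup F] [NormedSpace ℝ F] [FiniteDimensional ℝ F]
    {V : M → Type*} [TopologicalSpace (TotalSpace F V)]
    [∀ x, AddCommGroup (V x)] [∀ x, Module ℝ (V x)] [∀ x, TopologicalSpace (V x)]
    [∀ x, IsTopologicalAddGroup (V x)] [∀ x, ContinuousSMul ℝ (V x)]
    [FiberBundle F V] [VectorBundle ℝ F V] [ContMDiffVectorBundle ∞ F V 𝓘(ℝ, E)]
    (A : LieAlgebroid 𝓘(ℝ, E) F V)
    (Ω : ℝ → ∀ x : M, V x →L[ℝ] V x →L[ℝ] ℝ)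
    (hΩ_smooth : LieAlgebroid.IsSmoothFamilyTwo 𝓘(ℝ, E) F Ω)
    (hΩ_symp : ∀ t ∈ Icc (0 : ℝ) 1, A.IsSymplectic (Ω t))
    (ξ : ℝ → ∀ x : M, V x →L[ℝ] ℝ)
    (hξ_smooth : LieAlgebroid.IsSmoothFamilyOne 𝓘(ℝ, E) F ξ)
    (hξ : ∀ t ∈ Icc (0 : ℝ) 1, ∀ (a b : Cₛ^∞⟮𝓘(ℝ, E); F, V⟯) (x : M),
      HasDerivWithinAt (fun s => Ω s x (a x) (b x)) (-(A.dOne (ξ t) a b x))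
        (Icc (0 : ℝ) 1) t) :
    ∃ φ : A.Aut, φ.IsotopicToId ∧ ∀ (x : M) (v w : V x), φ.pullback (Ω 1) x v w = Ω 0 x v w := by
  obtain ⟨fr⟩ := nonempty_globalFrame 𝓘(ℝ, E) F V
  let τ : ℝ → ℝ := Real.smoothTransition
  have hτ : ContDiff ℝ ∞ τ := Real.smoothTransition.contDiff
  have hτ' : ∀ s, τ s ∈ Icc (0 : ℝ) 1 := fun s =>
    ⟨Real.smoothTransition.nonneg s, Real.smoothTransition.le_one s⟩
  have hτd : ContDiff ℝ ∞ (deriv τ) := (contDiff_infty_iff_deriv.1 hτ).2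
  have hΩf := hΩ_smooth.smoothFamily hτ hτ'
  have hξf := hξ_smooth.smoothFamily hτ hτ'
  obtain ⟨y, hy, hyξ⟩ := fr.exists_solve (J := 𝓘(ℝ, ℝ).prod 𝓘(ℝ, E))
    (b := fun p : ℝ × M => p.2) contMDiff_snd (β := fun p => Ω (τ p.1) p.2)
    (θ := fun p => deriv τ p.1 • ξ (τ p.1) p.2) (fun i j => hΩf _ _)
    (fun i => (hτd.contMDiff.comp contMDiff_fst).smul (hξf _))
    (fun p => (hΩ_symp _ (hτ' p.1)).nondegenerate p.2)
  let a : ℝ → Cₛ^∞⟮𝓘(ℝ, E); F, V⟯ := fun s => fr.ofCoeff (fun x => y (s, x)) fun i =>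
    SmoothFamily.slice (g := fun s x => y (s, x) i) (hy i) s
  have haξ : ∀ s x v, Ω (τ s) x (a s x) v = deriv τ s * ξ (τ s) x v := fun s x v => hyξ (s, x) v
  have ha : fr.SmoothSections a := fun k => by
    have h : (fun p : ℝ × M => fr.coord k p.2 (a p.1 p.2)) =
        fun p => ∑ i, fr.pmat k i p.2 * y p i := funext fun p => fr.anal_synth_apply p.2 (y p) k
    change ContMDiff _ _ _ (fun p : ℝ × M => fr.coord k p.2 (a p.1 p.2))
    rw [h]
    exact ContMDiff.sum fun i _ => ((fr.contMDiff_pmat k i).comp contMDiff_snd).mul (hy i)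
  have ha0 : ∀ s ∉ Icc (0 : ℝ) 1, ∀ x, a s x = 0 := fun s hs x =>
    (hΩ_symp _ (hτ' s)).nondegenerate x _ fun w => by
      rw [haξ, deriv_smoothTransition_eq_zero hs, zero_mul]
  obtain ⟨Φ⟩ := nonempty_sectionFlow A fr ha ha0
  refine ⟨Φ.aut ha 1, Φ.isotopicToId_aut ha, fun x v w => ?_⟩
  have h := Φ.pullback_aut ha (η := fun s => Ω (τ s)) (fun i j => hΩf _ _) (fun s x i j => by
    have h1 : HasDerivAt (fun t => Ω (τ t) x (fr.sec i x) (fr.sec j x))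
        (-(A.dOne (ξ (τ s)) (fr.sec i) (fr.sec j) x) * deriv τ s) s :=
      (hξ _ (hτ' s) (fr.sec i) (fr.sec j) x).comp_hasDerivAt s
        (hτ.differentiable (by simp) s).hasDerivAt (Filter.Eventually.of_forall hτ')
    have h2 := (hΩ_symp _ (hτ' s)).lieDerivative_eq (haξ s)
      (SmoothFamily.slice (hξf (fr.sec i)) s) (SmoothFamily.slice (hξf (fr.sec j)) s) x
    rw [h1.deriv]
    linarith) x v w
  have e0 : τ 0 = 0 := Real.smoothTransition.zero
  have e1 : τ 1 = 1 := Real.smoothTransition.one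
  simpa only [e0, e1] using h
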